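/- Let $p$ be a prime and let $n\ge p^2$ be an integer with $n\equiv 0$ or $1 \pmod p$; assume moreover $n\ge 8$ if $p=2$. Let $G=A_n$ be the alternating group on $n$ letters and let $S$ be any Sylow $p$-subgroup of $G$. Let $\mathcal F=\mathcal F_S(G)$ be the fusion system of $G$ over $S$, i.e. the category whose objects are the subgroups of $S$ and whose morphisms $P\to Q$ are the homomorphisms induced by conjugation by elements of $G$. Then $\mathcal F$ is reduced. That is: $\mathcal F$ is saturated, and 1. the only subgroup of $S$ normal in $\mathcal F$ is the trivial one; 2. $\mathcal F$ has no proper normal subsystem of $p$-power index; 3. $\mathcal F$ has no proper normal subsystem of index prime to $p$. Here a subgroup $P\trianglelefteq S$ is normal in $\mathcal F$ if each $\varphi\in\mathrm{Hom}_{\mathcal F}(Q,R)$ extends to some $\bar\varphi\in\mathrm{Hom}_{\mathcal F}(PQ,PR)$ with $\bar\varphi(P)=P$. A saturated fusion subsystem $\mathcal F_0\subseteq\mathcal F$ over $S_0\le S$ is normal if (i) no element of $S_0$ is $\mathcal F$-conjugate to an element of $S\smallsetminus S_0$; (ii) each $\varphi\in\mathrm{Hom}_{\mathcal F}(P,Q)$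 with $P,Q\le S_0$ has the form $\varphi=\varphi_0\circ\alpha|_P$ with $\alpha\in\mathrm{Aut}_{\mathcal F}(S_0)$ and $\varphi_0\in\mathrm{Hom}_{\mathcal F_0}(\alpha(P),Q)$; (iii) $\beta\varphi\beta^{-1}\in\mathrm{Hom}_{\mathcal F_0}(\beta(P),\beta(Q))$ for all $P,Q\le S_0$, $\varphi\in\mathrm{Hom}_{\mathcal F_0}(P,Q)$ and $\beta\in\mathrm{Aut}_{\mathcal F}(S_0)$. It has $p$-power index if $S_0$ contains the hyperfocal subgroup $\langle s^{-1}\alpha(s)\mid s\in P\le S,\ \alpha\in O^p(\mathrm{Aut}_{\mathcal F}(P))\rangle$ and $\mathrm{Aut}_{\mathcal F_0}(P)\ge O^p(\mathrm{Aut}_{\mathcal F}(P))$ for all $P\le S_0$; it has index prime to $p$ if $S_0=S$ and $\mathrm{Aut}_{\mathcal F_0}(P)\ge O^{p'}(\mathrm{Aut}_{\mathcal F}(P))$ for all $P\le S$. -/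

import Mathlib

/-- A fusion system over a finite `p`-group `S`: a category whose objects are the subgroups of `S`,
with `Hom_S(P, Q) ⊆ Hom(P, Q) ⊆ Inj(P, Q)`, in which each morphism is an isomorphism of the
category followed by an inclusion.  (Identities are conjugations by `1`.) -/
@[ext]
structure FusionSystem (p : ℕ) (S : Type*) [Group S] [Finite S] where
  isPGroup : IsPGroup p S
  Hom : ∀ P Q : Subgroup S, Set (P →* Q)
  injective_of_mem : ∀ {P Q : Subgroup S} {φ : P →* Q}, φ ∈ Hom P Q → Function.Injective φ
  conj_mem : ∀ {P Q : Subgroup S} {φ : P →* Q} (g : S),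
    (∀ x : P, (φ x : S) = g * x * g⁻¹) → φ ∈ Hom P Q
  comp_mem : ∀ {P Q R : Subgroup S} {φ : P →* Q} {ψ : Q →* R},
    φ ∈ Hom P Q → ψ ∈ Hom Q R → ψ.comp φ ∈ Hom P R
  factor : ∀ {P Q : Subgroup S} {φ : P →* Q}, φ ∈ Hom P Q →
    ∃ (R : Subgroup S) (hR : R ≤ Q) (e : P ≃* R),
      e.toMonoidHom ∈ Hom P R ∧ e.symm.toMonoidHom ∈ Hom R P ∧
        φ = (Subgroup.inclusion hR).comp e.toMonoidHom

namespace FusionSystem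

section Groups

/-- `O^p(A)`: the smallest normal subgroup of `p`-power index of a finite group `A`. -/
def upperP (p : ℕ) (A : Type*) [Group A] : Subgroup A :=
  sInf {N : Subgroup A | N.Normal ∧ ∃ k : ℕ, N.index = p ^ k}

/-- `O^{p'}(A)`: the smallest normal subgroup of index prime to `p` of a finite group `A`. -/
def upperPPrime (p : ℕ) (A : Type*) [Group A] : Subgroup A :=
  sInf {N : Subgroup A | N.Normal ∧ N.index.Coprime p}

/-- `Aut_S(P)`: the automorphisms of `P` induced by conjugation by elements of `N_S(P)`. -/
def autInner {S : Type*} [Group S] (P : Subgroup S) : Subgroup (MulAut P) :=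
  P.normalizerMonoidHom.range

/-- `N_φ = {g ∈ N_S(P) | φ c_g φ⁻¹ ∈ Aut_S(φ(P))}`, for an isomorphism `φ : P → Q = φ(P)`. -/
def extender {S : Type*} [Group S] {P Q : Subgroup S} (φ : P ≃* Q) : Subgroup S :=
  ((autInner Q).comap
    ((MulAut.congr φ).toMonoidHom.comp P.normalizerMonoidHom)).map
      (Subgroup.normalizer (P : Set S)).subtype

/-- A subgroup `P` of `S₀ ≤ S`, regarded as a subgroup of `S`. -/
noncomputable def embed {S : Type*} [Group S] {S₀ : Subgroup S} (P : Subgroup S₀) :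
    P ≃* P.map S₀.subtype :=
  P.equivMapOfInjective S₀.subtype S₀.subtype_injective

end Groups

variable {p : ℕ} {S : Type*} [Group S] [Finite S]

theorem symm_mem (F : FusionSystem p S) {P Q : Subgroup S} (e : P ≃* Q)
    (he : e.toMonoidHom ∈ F.Hom P Q) : e.symm.toMonoidHom ∈ F.Hom Q P := by
  obtain ⟨R, hR, e', _, h2, h3⟩ := F.factor he
  have hx : ∀ x : P, (e x : S) = (e' x : S) := fun x =>
    congrArg Subtype.val (DFunLike.congr_fun h3 x)
  have hRQ : R = Q := by
    refine le_antisymm hR fun y hy => ?_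
    have := hx (e.symm ⟨y, hy⟩)
    rw [MulEquiv.apply_symm_apply] at this
    simp only at this
    rw [this]
    exact (e' _).2
  subst hRQ
  have : e = e' := MulEquiv.ext fun x => Subtype.ext (hx x)
  rw [this]
  exact h2

/-- `Aut_F(P)`. -/
def aut (F : FusionSystem p S) (P : Subgroup S) : Subgroup (MulAut P) where
  carrier := {α | MulEquiv.toMonoidHom α ∈ F.Hom P P}
  one_mem' := F.conj_mem 1 (by intro x; simp)
  mul_mem' {a b} ha hb := F.comp_mem (φ := MulEquiv.toMonoidHom b) hb ha
  inv_mem' {a} ha := F.symm_mem a ha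

/-- `O^p(Aut_F(P))`, as a group of automorphisms of `P`. -/
def autUpperP (F : FusionSystem p S) (P : Subgroup S) : Subgroup (MulAut P) :=
  (upperP p (F.aut P)).map (F.aut P).subtype

/-- `O^{p'}(Aut_F(P))`, as a group of automorphisms of `P`. -/
def autUpperPPrime (F : FusionSystem p S) (P : Subgroup S) : Subgroup (MulAut P) :=
  (upperPPrime p (F.aut P)).map (F.aut P).subtype

/-- `P` and `Q` are `F`-conjugate: isomorphic as objects of `F`. -/
def Conj (F : FusionSystem p S) (P Q : Subgroup S) : Prop :=
  ∃ e : P ≃* Q, e.toMonoidHom ∈ F.Hom P Q ∧ e.symm.toMonoidHom ∈ F.Hom Q P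

def FullyCentralized (F : FusionSystem p S) (P : Subgroup S) : Prop :=
  ∀ Q : Subgroup S, F.Conj P Q →
    Nat.card (Subgroup.centralizer (Q : Set S)) ≤ Nat.card (Subgroup.centralizer (P : Set S))

def FullyNormalized (F : FusionSystem p S) (P : Subgroup S) : Prop :=
  ∀ Q : Subgroup S, F.Conj P Q →
    Nat.card (Subgroup.normalizer (Q : Set S)) ≤ Nat.card (Subgroup.normalizer (P : Set S))

/-- Saturated fusion systems.  In `extension`, the morphisms `φ ∈ Hom_F(P, S)` are written as
isomorphisms `φ : P → Q` in `F` onto their images `Q = φ(P)`. -/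
structure IsSaturated (F : FusionSystem p S) : Prop where
  fullyCentralized : ∀ P : Subgroup S, F.FullyNormalized P → F.FullyCentralized P
  sylow : ∀ P : Subgroup S, F.FullyNormalized P →
    ∃ T : Sylow p (F.aut P), (T : Subgroup (F.aut P)).map (F.aut P).subtype = autInner P
  extension : ∀ (P Q : Subgroup S) (φ : P ≃* Q), φ.toMonoidHom ∈ F.Hom P Q →
    F.FullyCentralized Q →
      ∃ hP : P ≤ extender φ, ∃ ψ ∈ F.Hom (extender φ) ⊤,
        ∀ x : P, (ψ (Subgroup.inclusion hP x) : S) = φ x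

/-- `P` is normal in `F`: it is normal in `S` and each `φ ∈ Hom_F(Q, R)` extends to some
`ψ ∈ Hom_F(PQ, PR)` with `ψ(P) = P`. -/
def IsNormalSubgroup (F : FusionSystem p S) (P : Subgroup S) : Prop :=
  P.Normal ∧ ∀ (Q R : Subgroup S), ∀ φ ∈ F.Hom Q R,
    ∃ ψ ∈ F.Hom (P ⊔ Q) (P ⊔ R),
      (∀ x : Q, (ψ (Subgroup.inclusion le_sup_right x) : S) = φ x) ∧
        (P.subgroupOf (P ⊔ Q)).map ψ = P.subgroupOf (P ⊔ R)

/-- Elements `x`, `y` of `S` are `F`-conjugate if some `φ ∈ Hom_F(⟨x⟩, ⟨y⟩)` sends `x` to `y`. -/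
def ConjElem (F : FusionSystem p S) (x y : S) : Prop :=
  ∃ φ ∈ F.Hom (Subgroup.zpowers x) (Subgroup.zpowers y),
    (φ ⟨x, Subgroup.mem_zpowers x⟩ : S) = y

/-- No element of `P` is `F`-conjugate to an element of `S ∖ P`. -/
def StronglyClosed (F : FusionSystem p S) (P : Subgroup S) : Prop :=
  ∀ x y : S, x ∈ P → F.ConjElem x y → y ∈ P

/-- The hyperfocal subgroup, generated by all `s⁻¹ α(s)` with `s ∈ P ≤ S`,
`α ∈ O^p(Aut_F(P))`. -/
def hyperfocal (F : FusionSystem p S) : Subgroup S :=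
  Subgroup.closure {t : S | ∃ (P : Subgroup S) (s : P), ∃ α ∈ F.autUpperP P,
    t = (s : S)⁻¹ * (α s : S)}

/-- The full subcategory of `F` on the subgroups of `S₀ ≤ S`, a fusion system over `S₀`. -/
def restrict (F : FusionSystem p S) (S₀ : Subgroup S) : FusionSystem p S₀ where
  isPGroup := F.isPGroup.to_subgroup S₀
  Hom P Q := {φ | ((embed Q).toMonoidHom.comp φ).comp (embed P).symm.toMonoidHom ∈
    F.Hom (P.map S₀.subtype) (Q.map S₀.subtype)}
  injective_of_mem {P Q φ} h := by
    have := F.injective_of_mem h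
    intro x y hxy
    have h2 := @this (embed P x) (embed P y) (by simp [hxy])
    exact (embed P).injective h2
  conj_mem {P Q φ} g h := by
    refine F.conj_mem (g : S) fun x => ?_
    obtain ⟨x, rfl⟩ := (embed P).surjective x
    have := congrArg Subtype.val (h x)
    simpa [embed] using this
  comp_mem {P Q R φ ψ} h1 h2 := by
    have := F.comp_mem h1 h2
    have heq : ((embed R).toMonoidHom.comp (ψ.comp φ)).comp (embed P).symm.toMonoidHom =
        (((embed R).toMonoidHom.comp ψ).comp (embed Q).symm.toMonoidHom).comp
          (((embed Q).toMonoidHom.comp φ).comp (embed P).symm.toMonoidHom) := by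
      ext x
      simp
    rw [Set.mem_ofPred_eq, heq]
    exact this
  factor {P Q φ} h := by
    obtain ⟨R', hR, e, h1, h2, h3⟩ := F.factor h
    obtain ⟨R, rfl⟩ : ∃ R : Subgroup S₀, R' = R.map S₀.subtype := by
      refine ⟨R'.subgroupOf S₀, ?_⟩
      rw [Subgroup.subgroupOf_map_subtype, inf_eq_left.mpr]
      exact hR.trans (Subgroup.map_subtype_le Q)
    refine ⟨R, (Subgroup.map_le_map_iff_of_injective S₀.subtype_injective).mp hR,
      ((embed P).trans e).trans (embed R).symm, ?_, ?_, ?_⟩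
    · have heq : ((embed R).toMonoidHom.comp
          (((embed P).trans e).trans (embed R).symm).toMonoidHom).comp
            (embed P).symm.toMonoidHom = e.toMonoidHom := by
        ext x
        simp
      rw [Set.mem_ofPred_eq, heq]
      exact h1
    · have heq : ((embed P).toMonoidHom.comp
          (((embed P).trans e).trans (embed R).symm).symm.toMonoidHom).comp
            (embed R).symm.toMonoidHom = e.symm.toMonoidHom := by
        ext x
        simp
      rw [Set.mem_ofPred_eq, heq]
      exact h2
    · ext x
      have h4 := congrArg Subtype.val (DFunLike.congr_fun h3 (embed P x))
      have h5 : ∀ y : R.map S₀.subtype, (((embed R).symm y : S₀) : S) = y := by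
        intro y
        obtain ⟨y, rfl⟩ := (embed R).surjective y
        simp [embed]
      have h6 : ∀ y : Q, (((embed Q) y : S)) = ((y : S₀) : S) := fun y => by simp [embed]
      simp only [MonoidHom.comp_apply, MulEquiv.toMonoidHom_eq_coe, MonoidHom.coe_coe,
        MulEquiv.symm_apply_apply, h6] at h4
      simp [h5, h4]

/-- `F₀` is a fusion subsystem of `F` over `S₀ ≤ S`: a subcategory which is itself a fusion
system over `S₀`. -/
def IsSubsystem (F : FusionSystem p S) (S₀ : Subgroup S) (F₀ : FusionSystem p S₀) : Prop :=
  ∀ P Q : Subgroup S₀, F₀.Hom P Q ⊆ (F.restrict S₀).Hom P Q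

/-- `β φ β⁻¹ : β(P) → β(Q)`, for `φ : P → Q` and an automorphism `β` of the ambient group. -/
noncomputable def conjHom {T : Type*} [Group T] (β : MulAut T) {P Q : Subgroup T}
    (φ : P →* Q) :
    P.map (MulEquiv.toMonoidHom β) →* Q.map (MulEquiv.toMonoidHom β) :=
  ((MulEquiv.subgroupMap β Q).toMonoidHom.comp φ).comp (MulEquiv.subgroupMap β P).symm.toMonoidHom

/-- The saturated subsystem `F₀` of `F`, over `S₀ ≤ S`, is normal in `F`. -/
structure IsNormalSubsystem (F : FusionSystem p S) (S₀ : Subgroup S)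
    (F₀ : FusionSystem p S₀) : Prop where
  isSubsystem : F.IsSubsystem S₀ F₀
  isSaturated : F₀.IsSaturated
  stronglyClosed : F.StronglyClosed S₀
  frattini : ∀ P Q : Subgroup S₀, ∀ φ ∈ (F.restrict S₀).Hom P Q,
    ∃ α ∈ F.aut S₀, ∃ φ₀ ∈ F₀.Hom (P.map (MulEquiv.toMonoidHom α)) Q,
      φ = φ₀.comp (MulEquiv.subgroupMap α P).toMonoidHom
  invariant : ∀ P Q : Subgroup S₀, ∀ φ ∈ F₀.Hom P Q, ∀ β ∈ F.aut S₀,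
    conjHom β φ ∈ F₀.Hom (P.map (MulEquiv.toMonoidHom β)) (Q.map (MulEquiv.toMonoidHom β))

/-- The subsystem `F₀` over `S₀` has `p`-power index in `F`. -/
def HasPPowerIndex (F : FusionSystem p S) (S₀ : Subgroup S) (F₀ : FusionSystem p S₀) : Prop :=
  F.hyperfocal ≤ S₀ ∧ ∀ P : Subgroup S₀, (F.restrict S₀).autUpperP P ≤ F₀.aut P

/-- The subsystem `F₀` over `S₀` has index prime to `p` in `F`. -/
def HasIndexPrimeToP (F : FusionSystem p S) (S₀ : Subgroup S) (F₀ : FusionSystem p S₀) : Prop :=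
  S₀ = ⊤ ∧ ∀ P : Subgroup S₀, (F.restrict S₀).autUpperPPrime P ≤ F₀.aut P

/-- The subsystem `F₀` over `S₀` is not proper, i.e. it is all of `F`. -/
def IsWhole (F : FusionSystem p S) (S₀ : Subgroup S) (F₀ : FusionSystem p S₀) : Prop :=
  S₀ = ⊤ ∧ F₀ = F.restrict S₀

/-- Reduced fusion systems. -/
structure IsReduced (F : FusionSystem p S) : Prop where
  isSaturated : F.IsSaturated
  eq_bot_of_isNormalSubgroup : ∀ P : Subgroup S, F.IsNormalSubgroup P → P = ⊥
  isWhole_of_hasPPowerIndex : ∀ (S₀ : Subgroup S) (F₀ : FusionSystem p S₀),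
    F.IsNormalSubsystem S₀ F₀ → F.HasPPowerIndex S₀ F₀ → F.IsWhole S₀ F₀
  isWhole_of_hasIndexPrimeToP : ∀ (S₀ : Subgroup S) (F₀ : FusionSystem p S₀),
    F.IsNormalSubsystem S₀ F₀ → F.HasIndexPrimeToP S₀ F₀ → F.IsWhole S₀ F₀

/-- The fusion system `F_S(G)` of a finite group `G` over a Sylow `p`-subgroup `S`: the morphisms
from `P` to `Q` are the homomorphisms induced by conjugation by elements of `G`. -/
def ofSylow {G : Type*} [Group G] [Finite G] (S : Sylow p G) : FusionSystem p S where
  isPGroup := S.isPGroup'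
  Hom P Q := {φ | ∃ g : G, ∀ x : P, ((φ x : S) : G) = g * ((x : S) : G) * g⁻¹}
  injective_of_mem {P Q φ} := by
    rintro ⟨g, hg⟩ x y hxy
    have := hg x
    rw [hxy, hg y] at this
    exact (Subtype.ext (Subtype.ext (mul_left_cancel (mul_right_cancel this)))).symm
  conj_mem {P Q φ} g h := ⟨(g : G), fun x => by simp [h x]⟩
  comp_mem {P Q R φ ψ} := by
    rintro ⟨g, hg⟩ ⟨k, hk⟩
    refine ⟨k * g, fun x => ?_⟩
    simp only [MonoidHom.comp_apply, hk, hg]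
    group
  factor {P Q φ} := by
    rintro ⟨g, hg⟩
    have hinj : Function.Injective φ := by
      intro x y hxy
      have := hg x
      rw [hxy, hg y] at this
      exact (Subtype.ext (Subtype.ext (mul_left_cancel (mul_right_cancel this)))).symm
    let f : P →* S := Q.subtype.comp φ
    have hf : Function.Injective f := Q.subtype_injective.comp hinj
    have hfr : f.range ≤ Q := by
      rintro _ ⟨x, rfl⟩
      exact (φ x).2
    have hfa : ∀ x, ((f x : S) : G) = g * ((x : S) : G) * g⁻¹ := hg
    refine ⟨f.range, hfr, MonoidHom.ofInjective hf, ⟨g, hfa⟩, ⟨g⁻¹, fun y => ?_⟩, ?_⟩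
    · obtain ⟨x, rfl⟩ := (MonoidHom.ofInjective hf).surjective y
      have h1 : (((MonoidHom.ofInjective hf) x : S) : G) = g * ((x : S) : G) * g⁻¹ := hfa x
      rw [h1]
      simp [mul_assoc]
    · ext x
      rfl

end FusionSystem

set_option linter.unusedSectionVars false
set_option linter.unusedSimpArgs false

open scoped Pointwise

/-! ### Conjugates of subgroups, and Sylow subgroups of subgroups -/

namespace Subgroup

variable {G : Type*} [Group G]

/-! Write n = pk + r with r ≤ 1 and k ≥ p. The points form k rows, each a copy of `ZMod p`, with at
most one further point; p of the rows form a plane `ZMod p × ZMod p`. By Legendre's formula the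
wreath product of the row shifts with the row permutations has index prime to p in the symmetric
group. Hence a Sylow p-subgroup T of A_n can be chosen inside it, containing the group V of even
shifts and the group E of translations of the plane (`exists_isNice`). The group V contains its
centralizer in A_n. Its normalizer supplies row permutations and dilations, whereas the normalizer
of E supplies linear maps of the plane that do not respect the rows. The interplay of the two proves
the theorem.

Saturation holds for every finite group and is a consequence of Sylow's theorem
(`ofSylow_isSaturated`).

Normal subgroups (`StableUnder.eq_bot`). If P ≠ 1 is normal in the fusion system, commutators with
elements of V put a nonzero shift into P, and symmetries of the rows turn it into one that moves
only one row of the plane. The automorphism of E given by a shear extends to a conjugation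
preserving P. That conjugation carries the shift to an element breaking up a row, which is
impossible in T.

p-power index (`isWhole_of_hasPPowerIndex`). As A_n is perfect, the focal subgroup theorem gives
focal subgroup S, and a maximal subgroup of S containing the hyperfocal subgroup would contain the
focal one; so the hyperfocal subgroup is S. The subsystem is then over S, and it contains Aut_F(S),
which is generated by O^p(Aut_F(S)) and inner automorphisms. The Frattini condition does the rest.

Index prime to p (`related_of_conj_le`). Again it suffices to find Aut_F(S) in the subsystem. An
element normalizing T is a product of a shift, a row permutation and a dilation, and since V is
self-centralizing it is enough to treat its action on V. For p = 2, transpositions of rows generate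
what is needed. For p odd, p-elements normalizing V give the even row permutations and the dilations
of determinant 1. The other determinants come from diagonal matrices of SL₂(p) acting on the plane:
these are products of transvections, which are p-elements normalizing E, and saturation carries them
from E times the remaining shifts over to V. -/

theorem mem_conj_smul {g x : G} {P : Subgroup G} :
    x ∈ MulAut.conj g • P ↔ g⁻¹ * x * g ∈ P := by
  rw [mem_pointwise_smul_iff_inv_smul_mem, ← map_inv, MulAut.smul_def, MulAut.conj_apply, inv_inv]

theorem conj_mem_conj_smul {g x : G} {P : Subgroup G} (hx : x ∈ P) :
    g * x * g⁻¹ ∈ MulAut.conj g • P :=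
  smul_mem_pointwise_smul x (MulAut.conj g) P hx

theorem conj_smul_le_iff {g : G} {P Q : Subgroup G} :
    MulAut.conj g • P ≤ Q ↔ ∀ x ∈ P, g * x * g⁻¹ ∈ Q := by
  constructor
  · exact fun h x hx => h (conj_mem_conj_smul hx)
  · intro h y hy
    have := h _ (mem_conj_smul.mp hy)
    simpa [mul_assoc] using this

theorem conj_smul_conj_smul (g h : G) (P : Subgroup G) :
    MulAut.conj g • MulAut.conj h • P = MulAut.conj (g * h) • P := by
  rw [smul_smul, map_mul]

theorem conj_inv_smul_conj_smul (g : G) (P : Subgroup G) :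
    MulAut.conj g⁻¹ • MulAut.conj g • P = P := by
  rw [conj_smul_conj_smul, inv_mul_cancel, map_one, one_smul]

theorem conj_smul_eq_self_iff {g : G} {P : Subgroup G} :
    MulAut.conj g • P = P ↔ g ∈ normalizer (P : Set G) := by
  rw [mem_normalizer_iff_map_conj_eq]
  rfl

theorem conj_smul_normalizer (g : G) (P : Subgroup G) :
    MulAut.conj g • normalizer (P : Set G) =
      normalizer ((MulAut.conj g • P : Subgroup G) : Set G) := by
  ext x
  rw [mem_conj_smul, ← conj_smul_eq_self_iff, ← conj_smul_eq_self_iff, conj_smul_conj_smul,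
    ← smul_left_cancel_iff (MulAut.conj g), conj_smul_conj_smul]
  simp [mul_assoc]

theorem conj_smul_centralizer (g : G) (P : Subgroup G) :
    MulAut.conj g • centralizer (P : Set G) =
      centralizer ((MulAut.conj g • P : Subgroup G) : Set G) := by
  ext x
  rw [mem_conj_smul, mem_centralizer_iff, mem_centralizer_iff]
  constructor
  · intro h y hy
    have := h _ (mem_conj_smul.mp hy)
    have h2 := congrArg (fun t => g * t * g⁻¹) this
    simpa [mul_assoc] using h2
  · intro h y hy
    have := h _ (conj_mem_conj_smul (g := g) hy)
    have h2 := congrArg (fun t => g⁻¹ * t * g) this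
    simpa [mul_assoc] using h2

theorem card_conj_smul (g : G) (P : Subgroup G) :
    Nat.card (MulAut.conj g • P : Subgroup G) = Nat.card P :=
  (Nat.card_congr (equivSMul (MulAut.conj g) P).toEquiv).symm

theorem conj_smul_mono {g : G} {P Q : Subgroup G} (h : P ≤ Q) :
    MulAut.conj g • P ≤ MulAut.conj g • Q :=
  pointwise_smul_le_pointwise_smul_iff.mpr h

theorem isPGroup_conj_smul {p : ℕ} {P : Subgroup G} (h : IsPGroup p P) (g : G) :
    IsPGroup p (MulAut.conj g • P : Subgroup G) :=
  h.of_equiv (equivSMul (MulAut.conj g) P)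

/-- `X` is a Sylow `p`-subgroup of the subgroup `H`. -/
def IsSylowIn (p : ℕ) (X H : Subgroup G) : Prop :=
  ∃ T : Sylow p H, (T : Subgroup H).map H.subtype = X

namespace IsSylowIn

variable {p : ℕ} {X H K Y : Subgroup G}

theorem le (h : IsSylowIn p X H) : X ≤ H := by
  obtain ⟨T, rfl⟩ := h
  exact map_subtype_le _

theorem isPGroup (h : IsSylowIn p X H) : IsPGroup p X := by
  obtain ⟨T, rfl⟩ := h
  exact T.isPGroup'.map _

theorem eq_of_le (h : IsSylowIn p X H) (hY : Y ≤ H) (hp : IsPGroup p Y) (hXY : X ≤ Y) :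
    Y = X := by
  obtain ⟨T, rfl⟩ := h
  have h1 : IsPGroup p (Y.subgroupOf H) := hp.comap_subtype
  have h2 : (T : Subgroup H) ≤ Y.subgroupOf H := by
    intro t ht
    exact hXY ⟨t, ht, rfl⟩
  have := T.is_maximal' h1 h2
  rw [← this, map_subgroupOf_eq_of_le hY]

theorem of_maximal (hX : X ≤ H) (hp : IsPGroup p X)
    (h : ∀ Y ≤ H, IsPGroup p Y → X ≤ Y → Y ≤ X) : IsSylowIn p X H := by
  refine ⟨⟨X.subgroupOf H, hp.comap_subtype, ?_⟩, map_subgroupOf_eq_of_le hX⟩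
  intro Q hQ hle
  have h1 : X ≤ Q.map H.subtype := by
    rw [← map_subgroupOf_eq_of_le hX]
    exact map_mono hle
  have h2 := h (Q.map H.subtype) (map_subtype_le _) (hQ.map _) h1
  refine le_antisymm (fun q hq => h2 ⟨q, hq, rfl⟩) hle

theorem exists_le (hY : Y ≤ H) (hp : IsPGroup p Y) : ∃ X, IsSylowIn p X H ∧ Y ≤ X := by
  obtain ⟨T, hT⟩ := IsPGroup.exists_le_sylow (G := H) (P := Y.subgroupOf H) hp.comap_subtype
  refine ⟨_, ⟨T, rfl⟩, ?_⟩
  rw [← map_subgroupOf_eq_of_le hY]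
  exact map_mono hT

theorem conj_smul (h : IsSylowIn p X H) (g : G) :
    IsSylowIn p (MulAut.conj g • X) (MulAut.conj g • H) := by
  refine of_maximal (conj_smul_mono h.le) (isPGroup_conj_smul h.isPGroup g) fun Y hY hp hle => ?_
  have h1 := conj_smul_mono (g := g⁻¹) hY
  have h2 := conj_smul_mono (g := g⁻¹) hle
  rw [conj_inv_smul_conj_smul] at h1 h2
  have h3 := h.eq_of_le h1 (isPGroup_conj_smul hp _) h2
  rw [← h3]
  have := conj_inv_smul_conj_smul g⁻¹ Y
  rw [inv_inv] at this
  exact this.ge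

variable [Finite G] [Fact p.Prime]

theorem exists_conj_le (h : IsSylowIn p X H) (hY : Y ≤ H) (hp : IsPGroup p Y) :
    ∃ k ∈ H, MulAut.conj k • Y ≤ X := by
  obtain ⟨Z, ⟨U, rfl⟩, hYZ⟩ := exists_le hY hp
  obtain ⟨T, rfl⟩ := h
  obtain ⟨k, rfl⟩ := MulAction.exists_smul_eq H U T
  refine ⟨k, k.2, conj_smul_le_iff.mpr fun y hy => ?_⟩
  obtain ⟨u, hu, rfl⟩ := hYZ hy
  refine ⟨k * u * k⁻¹, ?_, by simp⟩
  exact conj_mem_conj_smul hu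

theorem card_le (h : IsSylowIn p X H) (hY : Y ≤ H) (hp : IsPGroup p Y) :
    Nat.card Y ≤ Nat.card X := by
  obtain ⟨k, -, hk⟩ := h.exists_conj_le hY hp
  rw [← card_conj_smul k Y]
  exact card_le_of_le hk

theorem of_card_le (h : IsSylowIn p X H) (hY : Y ≤ H) (hp : IsPGroup p Y)
    (hc : Nat.card X ≤ Nat.card Y) : IsSylowIn p Y H := by
  refine of_maximal hY hp fun Z hZ hpZ hle => ?_
  exact (eq_of_le_of_card_ge hle ((h.card_le hZ hpZ).trans hc)).ge

/-- A Sylow subgroup of K is conjugate in H into X, and the conjugate stays in K because H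
normalizes K; so X ⊓ K is large enough. -/
theorem inf (h : IsSylowIn p X H) (hK : K ≤ H) (hn : H ≤ normalizer (K : Set G)) :
    IsSylowIn p (X ⊓ K) K := by
  obtain ⟨Z, hZ, hle⟩ := exists_le (p := p) (Y := X ⊓ K) (H := K) inf_le_right
    (h.isPGroup.to_le inf_le_left)
  refine hZ.of_card_le inf_le_right (h.isPGroup.to_le inf_le_left) ?_
  obtain ⟨k, hk, hkX⟩ := h.exists_conj_le (hZ.le.trans hK) hZ.isPGroup
  rw [← card_conj_smul k Z]
  refine card_le_of_le (le_inf hkX ?_)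
  rw [← conj_smul_eq_self_iff.mpr (hn hk)]
  exact conj_smul_mono hZ.le

/-- If `Y` normalizes `C` and `Y ⊓ C` is Sylow in `C`, then `Y` is Sylow in `Y ⊔ C`. -/
theorem sup_of_inf {C : Subgroup G} (hp : IsPGroup p Y) (hn : Y ≤ normalizer (C : Set G))
    (h : IsSylowIn p (Y ⊓ C) C) : IsSylowIn p Y (Y ⊔ C) := by
  refine of_maximal le_sup_left hp fun Z hZ hpZ hle x hx => ?_
  have hx' : x ∈ ((Y ⊔ C : Subgroup G) : Set G) := hZ hx
  rw [coe_mul_of_left_le_normalizer_right Y C hn] at hx'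
  obtain ⟨y, hy, c, hc, rfl⟩ := hx'
  have hcZ : c ∈ Z := by
    have := mul_mem (inv_mem (hle hy)) hx
    simpa using this
  have h1 : Z ⊓ C = Y ⊓ C :=
    h.eq_of_le inf_le_right (hpZ.to_le inf_le_left) (inf_le_inf_right C hle)
  have h2 : c ∈ Y ⊓ C := h1 ▸ (⟨hcZ, hc⟩ : c ∈ Z ⊓ C)
  exact mul_mem hy h2.1

end IsSylowIn

theorem isSylowIn_top {p : ℕ} (S : Sylow p G) : IsSylowIn p (S : Subgroup G) ⊤ :=
  IsSylowIn.of_maximal le_top S.isPGroup' fun _ _ hp hle => (S.is_maximal' hp hle).le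

/-- A subgroup of a Sylow subgroup `S` is conjugate to some `R ≤ S` such that `N_S(R)` is Sylow
in `N_G(R)`. -/
theorem exists_conj_isSylowIn_normalizer {p : ℕ} [Finite G] [Fact p.Prime] (S : Sylow p G)
    {P : Subgroup G} (hP : P ≤ S) : ∃ g : G, MulAut.conj g • P ≤ S ∧
      IsSylowIn p (S ⊓ normalizer ((MulAut.conj g • P : Subgroup G) : Set G))
        (normalizer ((MulAut.conj g • P : Subgroup G) : Set G)) := by
  obtain ⟨X, hX, hPX⟩ := IsSylowIn.exists_le (p := p) (P.le_normalizer) (S.isPGroup'.to_le hP)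
  obtain ⟨g, -, hg⟩ := (isSylowIn_top S).exists_conj_le le_top hX.isPGroup
  refine ⟨g, (conj_smul_mono hPX).trans hg, ?_⟩
  rw [← conj_smul_normalizer]
  refine (hX.conj_smul g).of_card_le inf_le_right (S.isPGroup'.to_le inf_le_left) ?_
  exact card_le_of_le (le_inf hg (conj_smul_mono hX.le))

/-- If `N_S(R)` is Sylow in `N_G(R)`, any conjugation onto `R` can be corrected so as to carry
`N_S(P)` into `S`. -/
theorem exists_conj_normalizer_le {p : ℕ} [Finite G] [Fact p.Prime] {S : Subgroup G}
    (hS : IsPGroup p S) {P : Subgroup G} {g : G}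
    (h : IsSylowIn p (S ⊓ normalizer ((MulAut.conj g • P : Subgroup G) : Set G))
        (normalizer ((MulAut.conj g • P : Subgroup G) : Set G))) :
    ∃ k : G, MulAut.conj k • P = MulAut.conj g • P ∧
      MulAut.conj k • (S ⊓ normalizer (P : Set G)) ≤ S := by
  obtain ⟨k, hk, hle⟩ := h.exists_conj_le
    (Y := MulAut.conj g • (S ⊓ normalizer (P : Set G)))
    (by rw [← conj_smul_normalizer]; exact conj_smul_mono inf_le_right)
    (isPGroup_conj_smul (hS.to_le inf_le_left) g)
  refine ⟨k * g, ?_, ?_⟩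
  · rw [← conj_smul_conj_smul, conj_smul_eq_self_iff.mpr hk]
  · rw [← conj_smul_conj_smul]
    exact hle.trans inf_le_left

/-- For an injective `ι : T → Γ` and `P ≤ T`, the action on `P` of the normalizer of `ι(P)`. -/
noncomputable def conjAut {T : Type*} [Group T] {ι : T →* G} (hι : Function.Injective ι)
    (P : Subgroup T) : normalizer ((P.map ι : Subgroup G) : Set G) →* MulAut P :=
  (MulAut.congr (P.equivMapOfInjective ι hι).symm).toMonoidHom.comp
    (P.map ι).normalizerMonoidHom

theorem conjAut_apply {T : Type*} [Group T] {ι : T →* G} (hι : Function.Injective ι)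
    {P : Subgroup T} (g : normalizer ((P.map ι : Subgroup G) : Set G)) (x : P) :
    ι (conjAut hι P g x) = g * ι x * (g : G)⁻¹ := by
  have h2 : ∀ z, ι ((P.equivMapOfInjective ι hι).symm z : P) = z := by
    intro z
    obtain ⟨z, rfl⟩ := (P.equivMapOfInjective ι hι).surjective z
    simp
  have h1 : ((P.map ι).normalizerMonoidHom g (P.equivMapOfInjective ι hι x) : G) =
      g * ι x * (g : G)⁻¹ := rfl
  rw [← h1, ← h2]
  rfl

end Subgroup

namespace Subgroup

theorem normalizer_le_normalizer_centralizer {G : Type*} [Group G] (P : Subgroup G) :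
    normalizer (P : Set G) ≤ normalizer ((centralizer (P : Set G) : Subgroup G) : Set G) := by
  intro g hg
  rw [← conj_smul_eq_self_iff, conj_smul_centralizer, conj_smul_eq_self_iff.mpr hg]

end Subgroup

/-! ### Saturation of the fusion system of a finite group -/

namespace FusionSystem

open Subgroup

section Extender

variable {S : Type*} [Group S]

theorem mem_autInner_iff {P : Subgroup S} {α : MulAut P} :
    α ∈ autInner P ↔ ∃ s : S, s ∈ normalizer (P : Set S) ∧
      ∀ x : P, (α x : S) = s * x * s⁻¹ := by
  constructor
  · rintro ⟨s, rfl⟩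
    exact ⟨s, s.2, fun x => by simp⟩
  · rintro ⟨s, hs, h⟩
    exact ⟨⟨s, hs⟩, MulEquiv.ext fun x => Subtype.ext (by rw [h]; simp)⟩

/-- Unfolds N_φ into equations between elements of S. The variable x' stands for s x s⁻¹, so that no
proof of membership in P enters the formula. -/
theorem mem_extender_iff {P Q : Subgroup S} {φ : P ≃* Q} {s : S} :
    s ∈ extender φ ↔ s ∈ normalizer (P : Set S) ∧ ∃ t ∈ normalizer (Q : Set S),
      ∀ (x : P) (x' : P), (x' : S) = s * x * s⁻¹ → (φ x' : S) = t * φ x * t⁻¹ := by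
  constructor
  · rintro ⟨s, hs, rfl⟩
    refine ⟨s.2, ?_⟩
    obtain ⟨t, ht, h⟩ := mem_autInner_iff.mp hs
    refine ⟨t, ht, fun x x' hx => ?_⟩
    have := h (φ x)
    simp only [MonoidHom.comp_apply] at this
    rw [← this]
    have hx' : x' = P.normalizerMonoidHom s x := Subtype.ext (by rw [hx]; simp)
    rw [hx']
    simp [MulAut.congr]
  · rintro ⟨hs, t, ht, h⟩
    refine ⟨⟨s, hs⟩, mem_autInner_iff.mpr ⟨t, ht, fun y => ?_⟩, rfl⟩
    obtain ⟨x, rfl⟩ := φ.surjective y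
    rw [← h x (P.normalizerMonoidHom ⟨s, hs⟩ x) (by simp)]
    simp [MulAut.congr]

theorem le_extender {P Q : Subgroup S} (φ : P ≃* Q) : P ≤ extender φ := by
  intro s hs
  refine mem_extender_iff.mpr ⟨P.le_normalizer hs, φ ⟨s, hs⟩, Q.le_normalizer (φ ⟨s, hs⟩).2,
    fun x x' hx => ?_⟩
  have : x' = ⟨s, hs⟩ * x * ⟨s, hs⟩⁻¹ := Subtype.ext hx
  rw [this]
  simp

end Extender

section OfSylow

variable {p : ℕ} {G : Type*} [Group G] [Finite G] (S : Sylow p G)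

/-- The inclusion of a Sylow subgroup, as a homomorphism. -/
def sylowIncl : S →* G := (S : Subgroup G).subtype

variable {S}

theorem sylowIncl_apply (x : S) : sylowIncl S x = (x : G) := rfl

theorem sylowIncl_injective : Function.Injective (sylowIncl S) := Subtype.val_injective

theorem map_sylowIncl_le (P : Subgroup S) : P.map (sylowIncl S) ≤ S := by
  rintro _ ⟨x, _, rfl⟩
  exact x.2

theorem coe_mem_map {P : Subgroup S} {x : S} : (x : G) ∈ P.map (sylowIncl S) ↔ x ∈ P :=
  mem_map_iff_mem sylowIncl_injective (x := x)

theorem exists_map_sylowIncl {P : Subgroup G} (hP : P ≤ S) :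
    ∃ Q : Subgroup S, Q.map (sylowIncl S) = P :=
  ⟨P.comap (sylowIncl S), map_comap_eq_self (hP.trans fun x hx => ⟨⟨x, hx⟩, rfl⟩)⟩

theorem map_normalizer (P : Subgroup S) :
    (normalizer (P : Set S)).map (sylowIncl S) =
      (S : Subgroup G) ⊓ normalizer ((P.map (sylowIncl S) : Subgroup G) : Set G) := by
  ext x
  constructor
  · rintro ⟨x, hx, rfl⟩
    refine ⟨x.2, mem_normalizer_iff.mpr fun y => ⟨?_, ?_⟩⟩
    · rintro ⟨y, hy, rfl⟩
      exact ⟨x * y * x⁻¹, (mem_normalizer_iff.mp hx y).mp hy, rfl⟩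
    · intro h
      have hyS : y ∈ (S : Subgroup G) := by
        have h1 := map_sylowIncl_le P h
        have := mul_mem (mul_mem (inv_mem x.2) h1) x.2
        simpa [sylowIncl_apply, mul_assoc] using this
      have h2 : ((x * ⟨y, hyS⟩ * x⁻¹ : S) : G) ∈ P.map (sylowIncl S) := h
      rw [coe_mem_map] at h2
      exact coe_mem_map.mpr ((mem_normalizer_iff.mp hx ⟨y, hyS⟩).mpr h2)
  · rintro ⟨hxS, hx⟩
    refine ⟨⟨x, hxS⟩, mem_normalizer_iff.mpr fun y => ?_, rfl⟩
    rw [← coe_mem_map, mem_normalizer_iff.mp hx, ← coe_mem_map]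
    rfl

theorem map_centralizer (P : Subgroup S) :
    (centralizer (P : Set S)).map (sylowIncl S) =
      (S : Subgroup G) ⊓ centralizer ((P.map (sylowIncl S) : Subgroup G) : Set G) := by
  ext x
  constructor
  · rintro ⟨x, hx, rfl⟩
    refine ⟨x.2, mem_centralizer_iff.mpr ?_⟩
    rintro _ ⟨y, hy, rfl⟩
    exact congrArg (sylowIncl S) (mem_centralizer_iff.mp hx y hy)
  · rintro ⟨hxS, hx⟩
    refine ⟨⟨x, hxS⟩, mem_centralizer_iff.mpr fun y hy => ?_, rfl⟩
    exact Subtype.ext (mem_centralizer_iff.mp hx y ⟨y, hy, rfl⟩)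

theorem card_map_sylowIncl (P : Subgroup S) : Nat.card (P.map (sylowIncl S)) = Nat.card P :=
  card_map_of_injective sylowIncl_injective

/-- The homomorphism `P → Q` induced by conjugation by `g`. -/
def homOfConj (P Q : Subgroup S) (g : G)
    (h : ∀ x ∈ P, g * (x : G) * g⁻¹ ∈ Q.map (sylowIncl S)) : P →* Q where
  toFun x := ⟨⟨g * (x : S) * g⁻¹, map_sylowIncl_le _ (h x x.2)⟩, coe_mem_map.mp (h x x.2)⟩
  map_one' := by ext; simp
  map_mul' x y := by ext; simp

theorem homOfConj_apply {P Q : Subgroup S} {g : G}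
    (h : ∀ x ∈ P, g * (x : G) * g⁻¹ ∈ Q.map (sylowIncl S)) (x : P) :
    ((homOfConj P Q g h x : S) : G) = g * ((x : S) : G) * g⁻¹ := rfl

theorem homOfConj_mem {P Q : Subgroup S} {g : G}
    (h : ∀ x ∈ P, g * (x : G) * g⁻¹ ∈ Q.map (sylowIncl S)) :
    homOfConj P Q g h ∈ (ofSylow S).Hom P Q :=
  ⟨g, homOfConj_apply h⟩

theorem map_conj_eq_of_surjective {P Q : Subgroup S} {φ : P →* Q} {g : G}
    (hφ : Function.Surjective φ) (hg : ∀ x : P, ((φ x : S) : G) = g * ((x : S) : G) * g⁻¹) :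
    MulAut.conj g • P.map (sylowIncl S) = Q.map (sylowIncl S) := by
  refine le_antisymm (conj_smul_le_iff.mpr ?_) ?_
  · rintro _ ⟨x, hx, rfl⟩
    exact ⟨φ ⟨x, hx⟩, (φ ⟨x, hx⟩).2, hg ⟨x, hx⟩⟩
  · rintro _ ⟨y, hy, rfl⟩
    obtain ⟨x, hx⟩ := hφ ⟨y, hy⟩
    rw [mem_conj_smul]
    refine ⟨x, x.2, ?_⟩
    have h1 := hg x
    rw [hx] at h1
    have h2 : (y : G) = g * ((x : S) : G) * g⁻¹ := h1
    simp only [sylowIncl_apply, h2]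
    simp [mul_assoc]

/-- The isomorphism `P → Q` induced by conjugation by `g`. -/
noncomputable def equivOfConj (P Q : Subgroup S) (g : G)
    (h : MulAut.conj g • P.map (sylowIncl S) = Q.map (sylowIncl S)) : P ≃* Q :=
  MulEquiv.ofBijective
    (homOfConj P Q g fun x hx =>
      h.le (conj_mem_conj_smul (mem_map_of_mem (sylowIncl S) hx))) (by
      constructor
      · exact (ofSylow S).injective_of_mem (homOfConj_mem _)
      · rintro ⟨y, hy⟩
        obtain ⟨x, hx, hxy⟩ := mem_conj_smul.mp (h.ge (mem_map_of_mem (sylowIncl S) hy))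
        refine ⟨⟨x, hx⟩, Subtype.ext (Subtype.ext ?_)⟩
        rw [homOfConj_apply]
        simp only [sylowIncl_apply] at hxy
        simp only [hxy]
        group)

theorem equivOfConj_mem {P Q : Subgroup S} {g : G}
    (h : MulAut.conj g • P.map (sylowIncl S) = Q.map (sylowIncl S)) :
    (equivOfConj P Q g h).toMonoidHom ∈ (ofSylow S).Hom P Q :=
  ⟨g, fun _ => rfl⟩

theorem conj_iff {P Q : Subgroup S} :
    (ofSylow S).Conj P Q ↔
      ∃ g : G, MulAut.conj g • P.map (sylowIncl S) = Q.map (sylowIncl S) := by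
  constructor
  · rintro ⟨e, ⟨g, hg⟩, -⟩
    exact ⟨g, map_conj_eq_of_surjective e.surjective hg⟩
  · rintro ⟨g, hg⟩
    exact ⟨equivOfConj P Q g hg, equivOfConj_mem hg, (ofSylow S).symm_mem _ (equivOfConj_mem hg)⟩

variable [Fact p.Prime]

/-- Some conjugate Q ≤ S of P has N_S(Q) Sylow in N_G(Q). Full normalization makes N_S(P) at least
as large, while N_G(P) and N_G(Q) are conjugate. -/
theorem FullyNormalized.isSylowIn {P : Subgroup S} (h : (ofSylow S).FullyNormalized P) :
    IsSylowIn p ((S : Subgroup G) ⊓ normalizer ((P.map (sylowIncl S) : Subgroup G) : Set G))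
      (normalizer ((P.map (sylowIncl S) : Subgroup G) : Set G)) := by
  obtain ⟨g, hgS, hg⟩ := exists_conj_isSylowIn_normalizer S (map_sylowIncl_le P)
  obtain ⟨Q, hQ⟩ := exists_map_sylowIncl hgS
  have h1 := h Q (conj_iff.mpr ⟨g, hQ.symm⟩)
  have h2 := hg.conj_smul g⁻¹
  rw [← card_map_sylowIncl, ← card_map_sylowIncl, map_normalizer, map_normalizer, hQ] at h1
  rw [conj_smul_normalizer, conj_inv_smul_conj_smul] at h2
  refine h2.of_card_le inf_le_right (S.isPGroup'.to_le inf_le_left) ?_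
  rwa [card_conj_smul]

theorem isSylowIn_centralizer {P : Subgroup S}
    (h : IsSylowIn p ((S : Subgroup G) ⊓ normalizer ((P.map (sylowIncl S) : Subgroup G) : Set G))
      (normalizer ((P.map (sylowIncl S) : Subgroup G) : Set G))) :
    IsSylowIn p ((S : Subgroup G) ⊓ centralizer ((P.map (sylowIncl S) : Subgroup G) : Set G))
      (centralizer ((P.map (sylowIncl S) : Subgroup G) : Set G)) := by
  have h1 := h.inf (centralizer_le_normalizer _) (normalizer_le_normalizer_centralizer _)
  rwa [inf_assoc, inf_eq_right.mpr (centralizer_le_normalizer _)] at h1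

theorem fullyCentralized_of_isSylowIn {P : Subgroup S}
    (h : IsSylowIn p ((S : Subgroup G) ⊓ centralizer ((P.map (sylowIncl S) : Subgroup G) : Set G))
      (centralizer ((P.map (sylowIncl S) : Subgroup G) : Set G))) :
    (ofSylow S).FullyCentralized P := by
  intro Q hQ
  obtain ⟨g, hg⟩ := conj_iff.mp hQ
  rw [← card_map_sylowIncl, ← card_map_sylowIncl, map_centralizer, map_centralizer]
  have h1 := h.conj_smul g
  rw [conj_smul_centralizer, hg] at h1
  have h2 := h1.card_le inf_le_right (S.isPGroup'.to_le inf_le_left)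
  rwa [card_conj_smul] at h2

theorem FullyCentralized.isSylowIn {P : Subgroup S} (h : (ofSylow S).FullyCentralized P) :
    IsSylowIn p ((S : Subgroup G) ⊓ centralizer ((P.map (sylowIncl S) : Subgroup G) : Set G))
      (centralizer ((P.map (sylowIncl S) : Subgroup G) : Set G)) := by
  obtain ⟨g, hgS, hg⟩ := exists_conj_isSylowIn_normalizer S (map_sylowIncl_le P)
  obtain ⟨Q, hQ⟩ := exists_map_sylowIncl hgS
  have h1 := h Q (conj_iff.mpr ⟨g, hQ.symm⟩)
  rw [← hQ] at hg
  have h2 := (isSylowIn_centralizer hg).conj_smul g⁻¹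
  rw [← card_map_sylowIncl, ← card_map_sylowIncl, map_centralizer, map_centralizer] at h1
  rw [hQ, conj_smul_centralizer, conj_inv_smul_conj_smul, ← hQ] at h2
  refine h2.of_card_le inf_le_right (S.isPGroup'.to_le inf_le_left) ?_
  rwa [card_conj_smul]

/-- The action of `N_G(P)` on `P ≤ S`. -/
noncomputable def normalizerToAut (P : Subgroup S) :
    normalizer ((P.map (sylowIncl S) : Subgroup G) : Set G) →* (ofSylow S).aut P :=
  (conjAut sylowIncl_injective P).codRestrict ((ofSylow S).aut P)
    fun g => ⟨g, conjAut_apply sylowIncl_injective g⟩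

theorem normalizerToAut_apply {P : Subgroup S}
    (g : normalizer ((P.map (sylowIncl S) : Subgroup G) : Set G)) (x : P) :
    ((((normalizerToAut P g : (ofSylow S).aut P) : MulAut P) x : S) : G) =
      g * ((x : S) : G) * (g : G)⁻¹ :=
  conjAut_apply sylowIncl_injective g x

theorem normalizerToAut_surjective (P : Subgroup S) :
    Function.Surjective (normalizerToAut P) := by
  rintro ⟨α, g, hg⟩
  have hn : g ∈ normalizer ((P.map (sylowIncl S) : Subgroup G) : Set G) := by
    rw [← conj_smul_eq_self_iff]
    exact map_conj_eq_of_surjective (φ := MulEquiv.toMonoidHom α) α.surjective hg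
  refine ⟨⟨g, hn⟩, Subtype.ext (MulEquiv.ext fun x => Subtype.ext (Subtype.ext ?_))⟩
  rw [normalizerToAut_apply]
  exact (hg x).symm

/-- The map N_G(P) → Aut_F(P) is onto, so it carries the Sylow subgroup N_S(P) to a Sylow subgroup.
-/
theorem exists_sylow_eq_autInner {P : Subgroup S} (h : (ofSylow S).FullyNormalized P) :
    ∃ T : Sylow p ((ofSylow S).aut P),
      (T : Subgroup ((ofSylow S).aut P)).map ((ofSylow S).aut P).subtype = autInner P := by
  obtain ⟨T, hT⟩ := h.isSylowIn
  refine ⟨T.mapSurjective (normalizerToAut_surjective P), ?_⟩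
  rw [Sylow.coe_mapSurjective]
  ext α
  rw [mem_autInner_iff]
  constructor
  · rintro ⟨_, ⟨g, hg, rfl⟩, rfl⟩
    have h1 : (g : G) ∈ (S : Subgroup G) ⊓
        normalizer ((P.map (sylowIncl S) : Subgroup G) : Set G) := by
      rw [← hT]
      exact ⟨g, hg, rfl⟩
    rw [← map_normalizer] at h1
    obtain ⟨s, hs, hsg⟩ := h1
    refine ⟨s, hs, fun x => Subtype.ext ?_⟩
    have := normalizerToAut_apply g x
    rw [← hsg] at this
    exact this
  · rintro ⟨s, hs, hα⟩
    have h1 : (s : G) ∈ (S : Subgroup G) ⊓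
        normalizer ((P.map (sylowIncl S) : Subgroup G) : Set G) := by
      rw [← map_normalizer]
      exact ⟨s, hs, rfl⟩
    rw [← hT] at h1
    obtain ⟨g, hg, hgs⟩ := h1
    refine ⟨normalizerToAut P g, ⟨g, hg, rfl⟩, MulEquiv.ext fun x => Subtype.ext (Subtype.ext ?_)⟩
    have := normalizerToAut_apply g x
    have hgs' : (g : G) = s := hgs
    rw [hgs'] at this
    rw [hα]
    exact this

/-- Put Y = N_S(Q) and C = C_G(Q). Conjugation by g sends N_φ into YC, where Y is Sylow, so a
further conjugation by some yc moves it into Y. The factor y normalizes Y and can be dropped; the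
remaining correction c does not affect the values of φ on P. -/
theorem ofSylow_extension {P Q : Subgroup S} {φ : P ≃* Q} {g : G}
    (hg : ∀ x : P, ((φ x : S) : G) = g * ((x : S) : G) * g⁻¹)
    (h : IsSylowIn p ((S : Subgroup G) ⊓ centralizer ((Q.map (sylowIncl S) : Subgroup G) : Set G))
      (centralizer ((Q.map (sylowIncl S) : Subgroup G) : Set G))) :
    ∃ c ∈ centralizer ((Q.map (sylowIncl S) : Subgroup G) : Set G),
      MulAut.conj (c * g) • (extender φ).map (sylowIncl S) ≤ S := by
  set C := centralizer ((Q.map (sylowIncl S) : Subgroup G) : Set G) with hC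
  set Y := (S : Subgroup G) ⊓ normalizer ((Q.map (sylowIncl S) : Subgroup G) : Set G) with hY
  have hYp : IsPGroup p Y := S.isPGroup'.to_le inf_le_left
  have hYn : Y ≤ normalizer (C : Set G) :=
    inf_le_right.trans (normalizer_le_normalizer_centralizer _)
  have hYC : Y ⊓ C = (S : Subgroup G) ⊓ C := by
    rw [hY, inf_assoc, inf_eq_right.mpr (centralizer_le_normalizer _)]
  have hSyl : IsSylowIn p Y (Y ⊔ C) := IsSylowIn.sup_of_inf hYp hYn (by rwa [hYC])
  have hle : MulAut.conj g • (extender φ).map (sylowIncl S) ≤ Y ⊔ C := by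
    rw [conj_smul_le_iff]
    rintro _ ⟨s, hs, rfl⟩
    obtain ⟨hsP, t, ht, h⟩ := mem_extender_iff.mp hs
    have htY : (t : G) ∈ Y := by
      rw [hY, ← map_normalizer]
      exact ⟨t, ht, rfl⟩
    -- The elements t and g s g⁻¹ induce the same automorphism of Q.
    have hc : (t : G)⁻¹ * (g * s * g⁻¹) ∈ C := by
      rw [hC, mem_centralizer_iff]
      rintro _ ⟨y, hy, rfl⟩
      obtain ⟨x, hx⟩ := φ.surjective ⟨y, hy⟩
      have h1 := congrArg Subtype.val (h x ⟨s * x * s⁻¹, (mem_normalizer_iff.mp hsP x).mp x.2⟩ rfl)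
      simp only [coe_mul, coe_inv, hg] at h1
      have h2 := hg x
      rw [hx] at h2
      have h2' : sylowIncl S y = g * ((x : S) : G) * g⁻¹ := h2
      rw [h2']
      have h3 := congrArg (fun z => (t : G)⁻¹ * z * (g * s * g⁻¹)) h1
      simp only [mul_assoc, inv_mul_cancel_left, inv_mul_cancel, mul_one] at h3 ⊢
      exact h3.symm
    have := mul_mem (mem_sup_left (T := C) htY) (mem_sup_right hc)
    rwa [mul_inv_cancel_left] at this
  obtain ⟨k, hk, hkY⟩ := hSyl.exists_conj_le hle
    (isPGroup_conj_smul (S.isPGroup'.to_le (map_sylowIncl_le _)) g)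
  have hk' : k ∈ ((Y ⊔ C : Subgroup G) : Set G) := hk
  rw [coe_mul_of_left_le_normalizer_right Y C hYn] at hk'
  obtain ⟨y, hy, c, hc, rfl⟩ := hk'
  refine ⟨c, hc, ?_⟩
  have h1 := conj_smul_mono (g := y⁻¹) hkY
  simp only [conj_smul_conj_smul] at h1 ⊢
  rw [conj_smul_eq_self_of_mem (inv_mem (show y ∈ Y from hy))] at h1
  have h2 : y⁻¹ * (y * c * g) = c * g := by group
  rw [h2] at h1
  exact h1.trans inf_le_left

/-- The fusion system of a finite group is saturated. -/
theorem ofSylow_isSaturated (S : Sylow p G) : (ofSylow S).IsSaturated where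
  fullyCentralized P hP := fullyCentralized_of_isSylowIn (isSylowIn_centralizer hP.isSylowIn)
  sylow P hP := exists_sylow_eq_autInner hP
  extension P Q φ := by
    rintro ⟨g, hg⟩ hQ
    obtain ⟨c, hc, hcS⟩ := ofSylow_extension hg hQ.isSylowIn
    refine ⟨le_extender φ, homOfConj _ _ (c * g) ?_, homOfConj_mem _, fun x => Subtype.ext ?_⟩
    · intro x hx
      have := hcS (conj_mem_conj_smul (mem_map_of_mem (sylowIncl S) hx))
      exact ⟨⟨_, this⟩, mem_top _, rfl⟩
    · refine (homOfConj_apply _ _).trans ?_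
      have h1 := mem_centralizer_iff.mp hc (φ x : S) (mem_map_of_mem (sylowIncl S) (φ x).2)
      have h2 : ((φ x : S) : G) = g * ((x : S) : G) * g⁻¹ := hg x
      have h3 : c * g * (((inclusion (le_extender φ) x : _) : S) : G) * (c * g)⁻¹ =
          c * ((φ x : S) : G) * c⁻¹ := by
        rw [h2]
        simp only [coe_inclusion]
        group
      rw [h3, ← h1]
      simp

end OfSylow

end FusionSystem

/-! ### The hyperfocal subgroup of a perfect group -/

namespace Subgroup

/-- Normalizers grow in finite `p`-groups. -/
theorem lt_inf_normalizer_of_lt {p : ℕ} [Fact p.Prime] {G : Type*} [Group G] [Finite G]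
    {P Q : Subgroup G} (hQ : IsPGroup p Q) (h : P < Q) : P < Q ⊓ normalizer (P : Set G) := by
  have : Group.IsNilpotent Q := hQ.isNilpotent
  have h1 : P.subgroupOf Q < ⊤ := by
    rw [lt_top_iff_ne_top, Ne, subgroupOf_eq_top]
    exact h.not_ge
  have h2 := Group.normalizerCondition_of_isNilpotent (G := Q) _ h1
  refine lt_of_le_of_ne (le_inf h.le P.le_normalizer) fun heq => h2.not_ge fun x hx => ?_
  rw [mem_subgroupOf, heq]
  refine ⟨x.2, mem_normalizer_iff.mpr fun y => ⟨fun hy => ?_, fun hy => ?_⟩⟩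
  · exact (mem_normalizer_iff.mp hx ⟨y, h.le hy⟩).mp hy
  · have hyQ : y ∈ Q := by
      have := mul_mem (mul_mem (inv_mem x.2) (h.le hy)) x.2
      simpa [mul_assoc] using this
    exact (mem_normalizer_iff.mp hx ⟨y, hyQ⟩).mpr hy

end Subgroup

namespace FusionSystem

open Subgroup

section UpperP

variable {p : ℕ} {A : Type*} [Group A]

theorem orderOf_dvd_index {N : Subgroup A} [N.Normal] (x : A) :
    orderOf (x : A ⧸ N) ∣ N.index := orderOf_dvd_natCard _

theorem mem_of_orderOf_coprime {N : Subgroup A} (hN : N.Normal) {x : A}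
    (h : (orderOf x).Coprime N.index) : x ∈ N := by
  rw [← QuotientGroup.eq_one_iff, ← orderOf_eq_one_iff]
  exact Nat.eq_one_of_dvd_coprimes h (orderOf_map_dvd (QuotientGroup.mk' N) x)
    (orderOf_dvd_index x)

theorem mem_upperP_of_coprime {x : A} (h : (orderOf x).Coprime p) : x ∈ upperP p A := by
  refine mem_sInf.mpr ?_
  rintro N ⟨hN, k, hk⟩
  exact mem_of_orderOf_coprime hN (hk ▸ h.pow_right k)

theorem mem_upperPPrime_of_pow_eq_one {x : A} {k : ℕ} (h : x ^ p ^ k = 1) :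
    x ∈ upperPPrime p A := by
  refine mem_sInf.mpr ?_
  rintro N ⟨hN, hk⟩
  exact mem_of_orderOf_coprime hN
    (Nat.Coprime.coprime_dvd_left (orderOf_dvd_of_pow_eq_one h) (hk.symm.pow_left k))

instance upperP_normal : (upperP p A).Normal := by
  refine ⟨fun x hx g => mem_sInf.mpr fun N hN => ?_⟩
  exact hN.1.conj_mem x (mem_sInf.mp hx N hN) g

theorem map_upperP_le {B : Type*} [Group B] {f : A →* B} (hf : Function.Surjective f) :
    (upperP p A).map f ≤ upperP p B := by
  refine le_sInf ?_
  rintro N ⟨hN, k, hk⟩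
  rw [map_le_iff_le_comap]
  exact sInf_le ⟨hN.comap f, k, by rw [index_comap_of_surjective _ hf, hk]⟩

/-- The quotient A / O^p(A) is a p-group: if p^k is the p-part of the order of g, then g^(p^k) has
order prime to p and lies in O^p(A). Hence the index of the join is a power of p, and it is prime to
p because the join contains T. -/
theorem upperP_sup_sylow [Fact p.Prime] [Finite A] (T : Sylow p A) :
    upperP p A ⊔ T = ⊤ := by
  have hp : p.Prime := Fact.out
  have h1 : IsPGroup p (A ⧸ upperP p A) := by
    intro g
    obtain ⟨g, rfl⟩ := QuotientGroup.mk_surjective g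
    obtain ⟨k, m, hm, hkm⟩ := Nat.exists_eq_pow_mul_and_not_dvd (orderOf_pos g).ne' p hp.ne_one
    refine ⟨k, ?_⟩
    rw [← QuotientGroup.mk_pow, QuotientGroup.eq_one_iff]
    refine mem_upperP_of_coprime ?_
    rw [orderOf_pow_of_dvd (pow_ne_zero _ hp.ne_zero) (hkm ▸ dvd_mul_right _ _), hkm,
      Nat.mul_div_cancel_left _ (pow_pos hp.pos k)]
    exact ((hp.coprime_iff_not_dvd).mpr hm).symm
  obtain ⟨k, hk⟩ := IsPGroup.iff_card.mp h1
  rw [← index_eq_one]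
  have h2 : (upperP p A ⊔ T).index ∣ p ^ k := by
    rw [← hk]
    exact index_dvd_of_le le_sup_left
  have h3 : ¬ p ∣ (upperP p A ⊔ T).index := fun h =>
    T.not_dvd_index (h.trans (index_dvd_of_le le_sup_right))
  exact Nat.Coprime.eq_one_of_dvd (((hp.coprime_iff_not_dvd).mpr h3).symm.pow_right k) h2

end UpperP

section Hyperfocal

variable {p : ℕ} [Fact p.Prime] {G : Type*} [Group G] [Finite G] {S : Sylow p G}

theorem inv_mul_conj_mem_hyperfocal {P : Subgroup S}
    {u : normalizer ((P.map (sylowIncl S) : Subgroup G) : Set G)} (hu : u ∈ upperP p _)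
    {x : G} (hx : x ∈ P.map (sylowIncl S)) :
    x⁻¹ * (u * x * (u : G)⁻¹) ∈ (ofSylow S).hyperfocal.map (sylowIncl S) := by
  obtain ⟨x, hx, rfl⟩ := hx
  have hα := map_upperP_le (normalizerToAut_surjective P) (mem_map_of_mem _ hu)
  refine ⟨x⁻¹ * ((normalizerToAut P u : MulAut P) ⟨x, hx⟩ : S), ?_, ?_⟩
  · exact subset_closure ⟨P, ⟨x, hx⟩, _, ⟨_, hα, rfl⟩, rfl⟩
  · have := normalizerToAut_apply u ⟨x, hx⟩
    rw [map_mul, map_inv]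
    exact congrArg _ this

/-- Factor n = ut with u ∈ O^p(N_G(R)) and t ∈ N_S(R). The factor t contributes a commutator of S,
the factor u an element of the hyperfocal subgroup. -/
theorem inv_mul_conj_mem_of_mem_normalizer {M R : Subgroup G} (hRS : R ≤ S)
    (hhyp : (ofSylow S).hyperfocal.map (sylowIncl S) ≤ M)
    (hcomm : ∀ s ∈ S, ∀ x ∈ S, x⁻¹ * (s * x * s⁻¹) ∈ M)
    (hR : IsSylowIn p ((S : Subgroup G) ⊓ normalizer (R : Set G)) (normalizer (R : Set G)))
    {n : G} (hn : n ∈ normalizer (R : Set G)) {y : G} (hy : y ∈ R) :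
    y⁻¹ * (n * y * n⁻¹) ∈ M := by
  obtain ⟨T, hT⟩ := hR
  have h1 : (⟨n, hn⟩ : normalizer (R : Set G)) ∈
      ((upperP p (normalizer (R : Set G)) ⊔ T : Subgroup _) : Set _) := by
    rw [upperP_sup_sylow]
    exact mem_top _
  rw [normal_mul] at h1
  obtain ⟨u, hu, t, ht, hut⟩ := h1
  have hn' : n = u * t := (congrArg Subtype.val hut).symm
  have htS : (t : G) ∈ S := by
    have : (t : G) ∈ (S : Subgroup G) ⊓ normalizer (R : Set G) := hT ▸ mem_map_of_mem _ ht
    exact this.1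
  have hz : t * y * (t : G)⁻¹ ∈ R := (mem_normalizer_iff.mp t.2 y).mp hy
  obtain ⟨R, rfl⟩ := exists_map_sylowIncl hRS
  have h2 := mul_mem (hcomm t htS y (hRS hy)) (hhyp (inv_mul_conj_mem_hyperfocal hu hz))
  have h3 : y⁻¹ * (n * y * n⁻¹) = y⁻¹ * (t * y * (t : G)⁻¹) * ((t * y * (t : G)⁻¹)⁻¹ *
      (u * (t * y * (t : G)⁻¹) * (u : G)⁻¹)) := by
    rw [hn']
    group
  rw [h3]
  exact h2

/-- A subgroup of `S` containing the hyperfocal subgroup and the commutators of `S` contains the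
focal subgroup. -/
theorem inv_mul_conj_mem {M : Subgroup G}
    (hhyp : (ofSylow S).hyperfocal.map (sylowIncl S) ≤ M)
    (hcomm : ∀ s ∈ S, ∀ x ∈ S, x⁻¹ * (s * x * s⁻¹) ∈ M) (m : ℕ) :
    ∀ P : Subgroup G, P ≤ S → Nat.card S - Nat.card P = m → ∀ g : G, MulAut.conj g • P ≤ S →
      ∀ x ∈ P, x⁻¹ * (g * x * g⁻¹) ∈ M := by
  induction m using Nat.strong_induction_on with
  | _ m ih =>
  -- When N_S(hP) is Sylow in N_G(hP), h can be replaced by some k with kP = hP that carries N_S(P)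
  -- into S. For P < S the group N_S(P) is strictly larger than P, so induction applies to k.
  have aux : ∀ P : Subgroup G, P ≤ S → Nat.card S - Nat.card P = m → ∀ h : G,
      MulAut.conj h • P ≤ S →
      IsSylowIn p ((S : Subgroup G) ⊓ normalizer ((MulAut.conj h • P : Subgroup G) : Set G))
        (normalizer ((MulAut.conj h • P : Subgroup G) : Set G)) →
      ∃ k : G, MulAut.conj k • P = MulAut.conj h • P ∧ ∀ x ∈ P, x⁻¹ * (k * x * k⁻¹) ∈ M := by
    intro P hP hm h hhS hh
    rcases eq_or_lt_of_le hP with heq | hlt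
    · refine ⟨1, ?_, fun x _ => by simp⟩
      rw [map_one, one_smul]
      refine (eq_of_le_of_card_ge (hhS.trans heq.ge) ?_).symm
      rw [card_conj_smul]
    · obtain ⟨k, hk, hkS⟩ := exists_conj_normalizer_le S.isPGroup' hh
      refine ⟨k, hk, fun x hx => ?_⟩
      have hlt' := lt_inf_normalizer_of_lt S.isPGroup' hlt
      refine ih _ ?_ _ inf_le_left rfl k hkS x (hlt'.le hx)
      have h1 : Nat.card P < Nat.card ((S : Subgroup G) ⊓ normalizer (P : Set G) : Subgroup G) := by
        by_contra hc
        exact hlt'.ne (eq_of_le_of_card_ge hlt'.le (not_lt.mp hc))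
      have h2 : Nat.card ((S : Subgroup G) ⊓ normalizer (P : Set G) : Subgroup G) ≤ Nat.card S :=
        card_le_of_le (K := (S : Subgroup G)) inf_le_left
      omega
  intro P hP hm g hg x hx
  obtain ⟨h, hhS, hh⟩ := exists_conj_isSylowIn_normalizer S hP
  obtain ⟨k, hk, hkM⟩ := aux P hP hm h hhS hh
  have hhg : MulAut.conj (h * g⁻¹) • MulAut.conj g • P = MulAut.conj h • P := by
    rw [conj_smul_conj_smul, inv_mul_cancel_right]
  obtain ⟨k', hk', hkM'⟩ := aux (MulAut.conj g • P) hg (by rw [card_conj_smul, hm]) (h * g⁻¹)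
    (hhg.le.trans hhS) (by rw [hhg]; exact hh)
  rw [hhg] at hk'
  -- As in Alperin's fusion theorem, g factors as k'⁻¹ · n · k, where k and k' come from `aux` for P
  -- and gP, and n normalizes their common image hP.
  have hn : k' * g * k⁻¹ ∈ normalizer ((MulAut.conj h • P : Subgroup G) : Set G) := by
    rw [← conj_smul_eq_self_iff]
    nth_rw 1 [← hk]
    rw [conj_smul_conj_smul, inv_mul_cancel_right, ← conj_smul_conj_smul, hk']
  have h1 := hkM x hx
  have h2 := hkM' _ (conj_mem_conj_smul (g := g) hx)
  have h3 := inv_mul_conj_mem_of_mem_normalizer hhS hhyp hcomm hh hn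
    (hk ▸ conj_mem_conj_smul (g := k) hx)
  have h4 : x⁻¹ * (g * x * g⁻¹) = x⁻¹ * (k * x * k⁻¹) *
      ((k * x * k⁻¹)⁻¹ * (k' * g * k⁻¹ * (k * x * k⁻¹) * (k' * g * k⁻¹)⁻¹)) *
      ((g * x * g⁻¹)⁻¹ * (k' * (g * x * g⁻¹) * k'⁻¹))⁻¹ := by
    group
  rw [h4]
  exact mul_mem (mul_mem h1 h3) (inv_mem h2)

/-- By nilpotency M is normal. If M did not contain the commutator subgroup, maximality would make P
/ M perfect, contradicting that it is solvable and nontrivial. -/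
theorem commutator_le_of_isCoatom {P : Type*} [Group P] [Finite P] (hP : IsPGroup p P)
    {M : Subgroup P} (hM : IsCoatom M) : commutator P ≤ M := by
  have hnil : Group.IsNilpotent P := hP.isNilpotent
  have hn : M.Normal :=
    (Group.normalizerCondition_of_isNilpotent (G := P)).normal_of_coatom _ hM
  by_contra hc
  have h1 : M ⊔ commutator P = ⊤ := hM.2 _ (left_lt_sup.mpr hc)
  have hnt : Nontrivial (P ⧸ M) := QuotientGroup.nontrivial_iff.mpr hM.1
  have h2 : commutator (P ⧸ M) < ⊤ := Group.IsSolvable.commutator_lt_top_of_nontrivial _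
  refine h2.ne ?_
  rw [eq_top_iff, ← map_top_of_surjective _ (QuotientGroup.mk'_surjective M), ← h1, Subgroup.map_sup,
    QuotientGroup.map_mk'_self, bot_sup_eq, commutator_def, commutator_def, map_commutator]
  exact commutator_mono le_top le_top

/-- The hyperfocal subgroup of a perfect group is the whole Sylow subgroup. -/
theorem hyperfocal_eq_top (S : Sylow p G) (hG : commutator G = ⊤) :
    (ofSylow S).hyperfocal = ⊤ := by
  by_contra hne
  -- Such an M also contains the commutators of S, hence the focal subgroup, which is S ⊓ [G, G] =
  -- S.
  obtain ⟨M, hM, hle⟩ := (eq_top_or_exists_le_coatom (ofSylow S).hyperfocal).resolve_left hne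
  have hcM := commutator_le_of_isCoatom S.isPGroup' hM
  have hfoc := commutator_inf_eq_focalSubgroup S
  rw [hG, top_inf_eq] at hfoc
  refine hM.1 (eq_top_iff.mpr fun s _ => ?_)
  have hs : (s : G) ∈ focalSubgroup (S : Subgroup G) := hfoc ▸ s.2
  have hfM : focalSubgroup (S : Subgroup G) ≤ M.map (sylowIncl S) := by
    rw [focalSubgroup_def, closure_le]
    rintro _ ⟨hgS, x, hx, u, rfl⟩
    have h1 : (u * x * u⁻¹)  ∈ (S : Subgroup G) := by
      have := inv_mem (mul_mem (inv_mem hx) hgS)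
      simpa [commutatorElement_def, mul_assoc] using this
    -- The generator x u x⁻¹ u⁻¹ has the form y⁻¹ (u y u⁻¹) for y = x⁻¹.
    have h2 := inv_mul_conj_mem (S := S) (map_mono hle) (M := M.map (sylowIncl S)) ?_ _
      (zpowers x⁻¹) (zpowers_le.mpr (inv_mem hx)) rfl u ?_ x⁻¹ (mem_zpowers _)
    · simpa [commutatorElement_def, mul_assoc] using h2
    · intro s hs x hx
      have : (⟨x, hx⟩ : S)⁻¹ * (⟨s, hs⟩ * ⟨x, hx⟩ * (⟨s, hs⟩ : S)⁻¹) ∈ M := by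
        refine hcM ?_
        have := commutator_mem_commutator (mem_top (⟨x, hx⟩ : S)⁻¹) (mem_top (⟨s, hs⟩ : S))
        rw [commutatorElement_def, inv_inv, mul_assoc, mul_assoc] at this
        rw [mul_assoc]
        exact this
      exact mem_map_of_mem (sylowIncl S) this
    · rw [conj_smul_le_iff]
      rintro _ ⟨k, rfl⟩
      have := zpow_mem h1 (-k)
      rw [conj_zpow] at this
      simpa using this
  exact coe_mem_map.mp (hfM hs)

end Hyperfocal

end FusionSystem

/-! ### Morphisms induced by conjugation in an ambient group -/

namespace FusionSystem

open Subgroup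

section Induces

variable {p : ℕ} {T Γ : Type*} [Group T] [Finite T] [Group Γ]

/-- The morphisms of `E` are the homomorphisms induced, through `ι : T → Γ`, by conjugation by
elements of `A`. -/
structure IsConjFusion (ι : T →* Γ) (A : Subgroup Γ) (E : FusionSystem p T) : Prop where
  injective : Function.Injective ι
  range_le : ι.range ≤ A
  mem_iff : ∀ {P Q : Subgroup T} {φ : P →* Q},
    φ ∈ E.Hom P Q ↔ ∃ g ∈ A, ∀ x : P, ι (φ x) = g * ι x * g⁻¹

/-- Conjugation by `g` restricts to a morphism of `F₀` defined on `P`. -/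
def Induces (ι : T →* Γ) (F₀ : FusionSystem p T) (P : Subgroup T) (g : Γ) : Prop :=
  ∃ φ ∈ F₀.Hom P ⊤, ∀ x : P, ι (φ x) = g * ι x * g⁻¹

theorem inclusion_mem (F : FusionSystem p T) {P Q : Subgroup T} (h : P ≤ Q) :
    inclusion h ∈ F.Hom P Q := F.conj_mem 1 fun x => by simp

theorem exists_mem_of_forall_mem (F : FusionSystem p T) {P Q R : Subgroup T} {φ : P →* Q}
    (hφ : φ ∈ F.Hom P Q) (h : ∀ x, (φ x : T) ∈ R) : ∃ ψ ∈ F.Hom P R, ∀ x, (ψ x : T) = φ x := by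
  obtain ⟨K, hK, e, he, -, rfl⟩ := F.factor hφ
  have hKR : K ≤ R := by
    intro y hy
    obtain ⟨x, hx⟩ := e.surjective ⟨y, hy⟩
    have := h x
    simp only [MonoidHom.comp_apply, MulEquiv.toMonoidHom_eq_coe, MonoidHom.coe_coe, hx] at this
    exact this
  exact ⟨_, F.comp_mem he (F.inclusion_mem hKR), fun x => rfl⟩

variable {ι : T →* Γ} {F₀ : FusionSystem p T}

namespace Induces

theorem of_hom {P Q : Subgroup T} {φ : P →* Q} (hφ : φ ∈ F₀.Hom P Q) {g : Γ}
    (hg : ∀ x : P, ι (φ x) = g * ι x * g⁻¹) : Induces ι F₀ P g :=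
  ⟨_, F₀.comp_mem hφ (F₀.inclusion_mem le_top), hg⟩

theorem exists_hom {P Q : Subgroup T} {g : Γ} (h : Induces ι F₀ P g)
    (hι : Function.Injective ι) (hQ : ∀ x ∈ P, g * ι x * g⁻¹ ∈ Q.map ι) :
    ∃ φ ∈ F₀.Hom P Q, ∀ x : P, ι (φ x) = g * ι x * g⁻¹ := by
  obtain ⟨φ, hφ, hg⟩ := h
  obtain ⟨ψ, hψ, h⟩ := F₀.exists_mem_of_forall_mem hφ (R := Q) fun x => by
    rw [← mem_map_iff_mem hι, hg]
    exact hQ x x.2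
  exact ⟨ψ, hψ, fun x => by rw [h, hg]⟩

theorem mono {P Q : Subgroup T} {g : Γ} (h : Induces ι F₀ P g) (hQ : Q ≤ P) :
    Induces ι F₀ Q g := by
  obtain ⟨φ, hφ, hg⟩ := h
  exact ⟨_, F₀.comp_mem (F₀.inclusion_mem hQ) hφ, fun x => hg _⟩

theorem mul {P Q : Subgroup T} {g h : Γ} (hι : Function.Injective ι) (hg : Induces ι F₀ P g)
    (hh : Induces ι F₀ Q h) (hQ : ∀ x ∈ P, g * ι x * g⁻¹ ∈ Q.map ι) :
    Induces ι F₀ P (h * g) := by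
  obtain ⟨φ, hφ, hφg⟩ := hg.exists_hom hι hQ
  obtain ⟨ψ, hψ, hψh⟩ := hh
  refine ⟨_, F₀.comp_mem hφ hψ, fun x => ?_⟩
  rw [MonoidHom.comp_apply, hψh, hφg]
  group

theorem inv {P Q : Subgroup T} {g : Γ} (hι : Function.Injective ι) (hg : Induces ι F₀ P g)
    (hQ : ∀ y ∈ Q, g⁻¹ * ι y * g ∈ P.map ι) : Induces ι F₀ Q g⁻¹ := by
  obtain ⟨φ, hφ, hφg⟩ := hg
  obtain ⟨K, hK, e, he, he', rfl⟩ := F₀.factor hφ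
  have hφg' : ∀ x : P, ι (e x) = g * ι x * g⁻¹ := hφg
  refine (of_hom he' (g := g⁻¹) ?_).mono ?_ (P := K)
  · intro y
    obtain ⟨x, rfl⟩ := e.surjective y
    rw [hφg']
    simp [mul_assoc]
  · intro y hy
    obtain ⟨x, hx, hxy⟩ := hQ y hy
    have h1 : ι (e ⟨x, hx⟩) = ι y := by
      rw [hφg', hxy]
      simp [mul_assoc]
    rw [← hι h1]
    exact (e ⟨x, hx⟩).2

theorem of_mem {P : Subgroup T} (t : T) : Induces ι F₀ P (ι t) := by
  refine ⟨((MulAut.conj t).toMonoidHom.comp P.subtype).codRestrict ⊤ fun _ => mem_top _,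
    F₀.conj_mem t fun x => rfl, fun x => ?_⟩
  simp

/-- If `ι(P)` contains its centralizer in `A`, then a morphism of the saturated system `F₀`
induced on `P` by `g` is also induced by `g` on any `Q ≥ P` carried into `T` by `g`. -/
theorem extend {A : Subgroup Γ} {E : FusionSystem p T} [Fact p.Prime]
    (hE : IsConjFusion ι A E) (hsub : ∀ P Q, F₀.Hom P Q ⊆ E.Hom P Q) (hsat : F₀.IsSaturated)
    {g : Γ} (hgA : g ∈ A) {Q : Subgroup T} (hQ : ∀ x ∈ Q, g * ι x * g⁻¹ ∈ ι.range) (m : ℕ) :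
    ∀ P : Subgroup T, P ≤ Q → Nat.card Q - Nat.card P = m →
      A ⊓ centralizer ((P.map ι : Subgroup Γ) : Set Γ) ≤ P.map ι →
      Induces ι F₀ P g → Induces ι F₀ Q g := by
  have hι := hE.injective
  induction m using Nat.strong_induction_on with
  | _ m ih =>
  intro P hPQ hm hC hP
  rcases eq_or_lt_of_le hPQ with rfl | hlt
  · exact hP
  have hlt' := lt_inf_normalizer_of_lt (F₀.isPGroup.to_subgroup Q) hlt
  set N := Q ⊓ normalizer (P : Set T) with hN
  have hcard : Nat.card P < Nat.card N := by
    by_contra hc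
    exact hlt'.ne (eq_of_le_of_card_ge hlt'.le (not_lt.mp hc))
  have hcard' : Nat.card N ≤ Nat.card Q := card_le_of_le inf_le_left
  -- Extend from P to N = N_Q(P) only; the centralizer condition passes from P to N, and induction
  -- covers the rest of Q.
  refine ih (Nat.card Q - Nat.card N) (by omega) N inf_le_left rfl ?_ ?_
  · intro x hx
    exact map_mono hlt'.le (hC ⟨hx.1, centralizer_le (map_mono hlt'.le) hx.2⟩)
  obtain ⟨φ, hφ, hφ'⟩ := hP
  obtain ⟨R, hRT, e, he, he', hφe⟩ := F₀.factor hφ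
  have heg : ∀ x : P, ι (e x) = g * ι x * g⁻¹ := fun x => by
    rw [← hφ' x, hφe]
    rfl
  -- Each F₀-conjugate K of R = φ(P) inherits from P the property of containing its centralizer. So
  -- the isomorphism k⁻¹ : K → R is defined on that centralizer and embeds it in the centralizer of
  -- R.
  have hRc : F₀.FullyCentralized R := by
    rintro K ⟨k, hk, -⟩
    obtain ⟨h, hh, hkh⟩ := hE.mem_iff.mp (hsub _ _ (F₀.comp_mem he hk))
    have hKc : centralizer (K : Set T) ≤ K := by
      intro z hz
      have h1 : h⁻¹ * ι z * h ∈ P.map ι := by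
        refine hC (mem_inf.mpr ⟨A.mul_mem (A.mul_mem (A.inv_mem hh) (hE.range_le ⟨z, rfl⟩)) hh, ?_⟩)
        rw [mem_centralizer_iff]
        rintro _ ⟨x, hx, rfl⟩
        have h2 := congrArg ι (mem_centralizer_iff.mp hz _ (k (e ⟨x, hx⟩)).2)
        have h3 := hkh ⟨x, hx⟩
        simp only [MonoidHom.comp_apply, MulEquiv.toMonoidHom_eq_coe, MonoidHom.coe_coe] at h3
        rw [map_mul, map_mul, h3] at h2
        have h4 := congrArg (fun w => h⁻¹ * w * h) h2
        simpa [mul_assoc] using h4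
      obtain ⟨x, hx, hxz⟩ := h1
      have h3 := hkh ⟨x, hx⟩
      simp only [MonoidHom.comp_apply, MulEquiv.toMonoidHom_eq_coe, MonoidHom.coe_coe, hxz] at h3
      have h4 : ι (k (e ⟨x, hx⟩)) = ι z := by
        rw [h3]
        group
      rw [← hι h4]
      exact (k (e ⟨x, hx⟩)).2
    refine Nat.card_le_card_of_injective
      (fun z => (⟨k.symm ⟨z, hKc z.2⟩, ?_⟩ : centralizer (R : Set T))) ?_
    · rw [mem_centralizer_iff]
      intro r hr
      have h1 := mem_centralizer_iff.mp z.2 (k ⟨r, hr⟩) (k ⟨r, hr⟩).2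
      have h2 : k ⟨r, hr⟩ * ⟨z, hKc z.2⟩ = ⟨z, hKc z.2⟩ * k ⟨r, hr⟩ := Subtype.ext h1
      have h3 := congrArg k.symm h2
      rw [map_mul, map_mul, MulEquiv.symm_apply_apply] at h3
      exact congrArg Subtype.val h3
    · intro z w hzw
      have h1 := congrArg Subtype.val hzw
      have h2 := k.symm.injective (Subtype.ext h1)
      rw [Subtype.mk.injEq] at h2
      exact Subtype.ext h2
  obtain ⟨hPe, ψ, hψ, hψe⟩ := hsat.extension P R e he hRc
  -- For s ∈ N the element g s g⁻¹ lies in T by `hQ`, and it serves as the required t.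
  have hNe : N ≤ extender e := by
    intro s hs
    obtain ⟨t, ht⟩ := hQ s hs.1
    have key : ∀ x x' : P, (x' : T) = s * x * s⁻¹ → (e x' : T) = t * e x * t⁻¹ := by
      intro x x' hx
      apply hι
      rw [heg, hx]
      simp only [map_mul, map_inv, heg, ht]
      group
    refine mem_extender_iff.mpr ⟨hs.2, t, ?_, key⟩
    rw [mem_normalizer_iff]
    intro r
    constructor
    · intro hr
      obtain ⟨x, hx⟩ := e.surjective ⟨r, hr⟩
      have := key x ⟨s * x * s⁻¹, (mem_normalizer_iff.mp hs.2 x).mp x.2⟩ rfl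
      rw [hx] at this
      rw [← this]
      exact (e _).2
    · intro hr
      obtain ⟨x, hx⟩ := e.surjective ⟨_, hr⟩
      have h1 := key ⟨s⁻¹ * x * s, (mem_normalizer_iff''.mp hs.2 x).mp x.2⟩ x
        (by simp [mul_assoc])
      rw [hx] at h1
      have h2 : r = e ⟨s⁻¹ * x * s, (mem_normalizer_iff''.mp hs.2 x).mp x.2⟩ := by
        simpa using h1
      rw [h2]
      exact (e _).2
  obtain ⟨k, hk, hψk⟩ := hE.mem_iff.mp (hsub _ _ hψ)
  -- The extension ψ is conjugation by some k agreeing with g on P, but not necessarily on N. The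
  -- discrepancy centralizes ι(P), hence lies in ι(P) and can be removed inside F₀.
  have hz : g⁻¹ * k ∈ P.map ι := by
    refine hC (mem_inf.mpr ⟨A.mul_mem (A.inv_mem hgA) hk, ?_⟩)
    rw [mem_centralizer_iff]
    rintro _ ⟨x, hx, rfl⟩
    have h1 := hψk (inclusion hPe ⟨x, hx⟩)
    rw [hψe ⟨x, hx⟩] at h1
    have h2 := heg ⟨x, hx⟩
    simp only [coe_inclusion] at h1
    rw [h1] at h2
    have h3 := congrArg (fun w => g⁻¹ * w * k) h2
    simpa [mul_assoc] using h3.symm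
  obtain ⟨z, hz, hzk⟩ := hz
  have h1 : Induces ι F₀ (extender e) k := ⟨ψ, hψ, hψk⟩
  have h2 : Induces ι F₀ N (k * ι z⁻¹) := by
    refine mul hι (of_mem z⁻¹) h1 fun x hx => ?_
    have hzN : z⁻¹ ∈ N := inv_mem (hlt'.le hz)
    exact ⟨z⁻¹ * x * z⁻¹⁻¹, hNe (mul_mem (mul_mem hzN hx) (inv_mem hzN)), by simp⟩
  have h3 : k * ι z⁻¹ = g := by
    rw [map_inv, hzk]
    group
  rwa [h3] at h2

end Induces

theorem IsConjFusion.conjAut_mem {A : Subgroup Γ} {E : FusionSystem p T}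
    (hE : IsConjFusion ι A E) {P : Subgroup T}
    (g : (A ⊓ normalizer ((P.map ι : Subgroup Γ) : Set Γ) : Subgroup Γ)) :
    conjAut hE.injective P (inclusion inf_le_right g) ∈ E.aut P :=
  hE.mem_iff.mpr ⟨g, g.2.1, conjAut_apply hE.injective _⟩

/-- The action on `P` of the normalizer of `ι(P)` in `A`. -/
noncomputable def IsConjFusion.toAut {A : Subgroup Γ} {E : FusionSystem p T}
    (hE : IsConjFusion ι A E) (P : Subgroup T) :
    (A ⊓ normalizer ((P.map ι : Subgroup Γ) : Set Γ) : Subgroup Γ) →* E.aut P :=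
  ((conjAut hE.injective P).comp (inclusion inf_le_right)).codRestrict (E.aut P) hE.conjAut_mem

theorem IsConjFusion.toAut_apply {A : Subgroup Γ} {E : FusionSystem p T}
    (hE : IsConjFusion ι A E) {P : Subgroup T}
    (g : (A ⊓ normalizer ((P.map ι : Subgroup Γ) : Set Γ) : Subgroup Γ)) (x : P) :
    ι ((hE.toAut P g : MulAut P) x) = g * ι x * (g : Γ)⁻¹ :=
  conjAut_apply hE.injective _ x

theorem IsConjFusion.toAut_surjective {A : Subgroup Γ} {E : FusionSystem p T}
    (hE : IsConjFusion ι A E) (P : Subgroup T) : Function.Surjective (hE.toAut P) := by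
  rintro ⟨α, hα⟩
  obtain ⟨g, hg, hαg⟩ := hE.mem_iff.mp hα
  have hαg' : ∀ x : P, ι (α x) = g * ι x * g⁻¹ := hαg
  have hn : g ∈ normalizer ((P.map ι : Subgroup Γ) : Set Γ) := by
    rw [← conj_smul_eq_self_iff]
    refine le_antisymm (conj_smul_le_iff.mpr ?_) ?_
    · rintro _ ⟨x, hx, rfl⟩
      exact ⟨α ⟨x, hx⟩, (α ⟨x, hx⟩).2, hαg' ⟨x, hx⟩⟩
    · rintro _ ⟨y, hy, rfl⟩
      obtain ⟨x, hx⟩ := α.surjective ⟨y, hy⟩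
      rw [mem_conj_smul]
      refine ⟨x, x.2, ?_⟩
      have := hαg' x
      rw [hx] at this
      simp only at this
      rw [this]
      group
  refine ⟨⟨g, hg, hn⟩, Subtype.ext (MulEquiv.ext fun x => Subtype.ext (hE.injective ?_))⟩
  rw [hE.toAut_apply]
  exact (hαg' x).symm

end Induces

end FusionSystem

/-! ### Reduction to conditions on subgroups of an ambient group -/

namespace FusionSystem

open Subgroup

section Reduced

variable {p : ℕ} {T Γ : Type*} [Group T] [Finite T] [Group Γ]

theorem IsConjFusion.restrict {ι : T →* Γ} {A : Subgroup Γ} {E : FusionSystem p T}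
    (hE : IsConjFusion ι A E) (T₀ : Subgroup T) :
    IsConjFusion (ι.comp T₀.subtype) A (E.restrict T₀) where
  injective := hE.injective.comp T₀.subtype_injective
  range_le := by
    rintro _ ⟨x, rfl⟩
    exact hE.range_le ⟨x, rfl⟩
  mem_iff {P Q φ} := by
    refine (hE.mem_iff (φ := ((embed Q).toMonoidHom.comp φ).comp
      (embed P).symm.toMonoidHom)).trans (exists_congr fun g => and_congr_right fun _ => ?_)
    constructor
    · intro h x
      have := h (embed P x)
      simpa [embed] using this
    · intro h x
      obtain ⟨x, rfl⟩ := (embed P).surjective x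
      simpa [embed] using h x

theorem ofSylow_isConjFusion {G : Type*} [Group G] [Finite G] (S : Sylow p G) {f : G →* Γ}
    (hf : Function.Injective f) : IsConjFusion (f.comp (sylowIncl S)) f.range (ofSylow S) where
  injective := hf.comp sylowIncl_injective
  range_le := by
    rintro _ ⟨x, rfl⟩
    exact ⟨x, rfl⟩
  mem_iff {P Q φ} := by
    constructor
    · rintro ⟨g, hg⟩
      refine ⟨f g, ⟨g, rfl⟩, fun x => ?_⟩
      simp only [MonoidHom.comp_apply, sylowIncl_apply, hg, map_mul, map_inv]
    · rintro ⟨_, ⟨g, rfl⟩, hg⟩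
      refine ⟨g, fun x => hf ?_⟩
      simpa [sylowIncl_apply] using hg x

/-- The Frattini condition writes each morphism of E as an automorphism of the whole p-group
followed by a morphism of F₀, so only those automorphisms need to be found in F₀. -/
theorem isWhole_of_induces {ι : T →* Γ} {A : Subgroup Γ} {E : FusionSystem p T}
    (hE : IsConjFusion ι A E) {F₀ : FusionSystem p (⊤ : Subgroup T)}
    (hF₀ : E.IsNormalSubsystem ⊤ F₀)
    (h : ∀ g ∈ A, (∀ x, g * ι x * g⁻¹ ∈ ι.range) →
      Induces (ι.comp (⊤ : Subgroup T).subtype) F₀ ⊤ g) : E.IsWhole ⊤ F₀ := by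
  refine ⟨rfl, FusionSystem.ext ?_⟩
  funext P Q
  refine Set.Subset.antisymm (hF₀.isSubsystem P Q) fun φ hφ => ?_
  obtain ⟨α, hα, φ₀, hφ₀, rfl⟩ := hF₀.frattini P Q φ hφ
  obtain ⟨g, hgA, hg⟩ := hE.mem_iff.mp hα
  have hg' : ∀ x, ι (α x) = g * ι x * g⁻¹ := hg
  have hinj := (hE.restrict ⊤).injective
  obtain ⟨ψ, hψ, hψg⟩ := ((h g hgA fun x => ⟨α ⟨x, mem_top x⟩, hg' ⟨x, mem_top x⟩⟩).mono
    (le_top : P ≤ ⊤)).exists_hom hinj (Q := P.map (MulEquiv.toMonoidHom α))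
    fun x hx => ⟨α x, mem_map_of_mem _ hx, hg' x⟩
  have heq : ψ = (MulEquiv.subgroupMap α P).toMonoidHom := by
    ext1 x
    refine Subtype.ext (hinj ?_)
    rw [hψg]
    exact (hg' x).symm
  rw [← heq]
  exact F₀.comp_mem hψ hφ₀

/-- The hyperfocal subgroup being S, the subsystem lives on S. It contains the action of O^p(N_G(S))
by hypothesis and that of S as inner automorphisms; together these two groups make up N_G(S). -/
theorem isWhole_of_hasPPowerIndex {G : Type*} [Group G] [Finite G] [Fact p.Prime]
    {S : Sylow p G} (hG : commutator G = ⊤) {S₀ : Subgroup S} {F₀ : FusionSystem p S₀}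
    (hF₀ : (ofSylow S).IsNormalSubsystem S₀ F₀) (hind : (ofSylow S).HasPPowerIndex S₀ F₀) :
    (ofSylow S).IsWhole S₀ F₀ := by
  obtain rfl : S₀ = ⊤ := eq_top_iff.mpr ((hyperfocal_eq_top S hG).ge.trans hind.1)
  have hE := ofSylow_isConjFusion S (f := MonoidHom.id G) Function.injective_id
  have hE' := hE.restrict ⊤
  refine isWhole_of_induces hE hF₀ fun g hgA hg => ?_
  set ι := ((MonoidHom.id G).comp (sylowIncl S)).comp (⊤ : Subgroup S).subtype with hι
  have hmem : ∀ {x : G}, x ∈ (⊤ : Subgroup (⊤ : Subgroup S)).map ι ↔ x ∈ S := by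
    intro x
    constructor
    · rintro ⟨x, -, rfl⟩
      exact x.1.2
    · intro hx
      exact ⟨⟨⟨x, hx⟩, mem_top _⟩, mem_top _, rfl⟩
  have hmap : (⊤ : Subgroup (⊤ : Subgroup S)).map ι = S := Subgroup.ext fun x => hmem
  set D := (MonoidHom.id G).range ⊓ normalizer (((⊤ : Subgroup (⊤ : Subgroup S)).map ι :
    Subgroup G) : Set G) with hD
  have hgS : MulAut.conj g • (S : Subgroup G) = S := by
    refine eq_of_le_of_card_ge (conj_smul_le_iff.mpr fun x hx => ?_) (card_conj_smul _ _).ge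
    obtain ⟨y, hy⟩ := hg ⟨x, hx⟩
    have hy' : (y : G) = g * x * g⁻¹ := hy
    rw [← hy']
    exact y.2
  have hgD : g ∈ D := by
    refine ⟨hgA, ?_⟩
    rw [hmap]
    exact conj_smul_eq_self_iff.mp hgS
  obtain ⟨U⟩ : Nonempty (Sylow p D) := inferInstance
  have h1 : (⟨g, hgD⟩ : D) ∈ ((upperP p D ⊔ U : Subgroup D) : Set D) := by
    rw [upperP_sup_sylow]
    exact mem_top _
  rw [normal_mul] at h1
  obtain ⟨u, hu, t, ht, hut⟩ := h1
  -- A p-subgroup normalizing the Sylow subgroup S is contained in S.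
  have htS : (t : G) ∈ (S : Subgroup G) := by
    have h2 : IsPGroup p ((U : Subgroup D).map D.subtype) := U.isPGroup'.map _
    have h3 := h2.inf_normalizer_sylow S
    have h4 : (t : G) ∈ (U : Subgroup D).map D.subtype ⊓ normalizer ((S : Subgroup G) : Set G) := by
      refine ⟨mem_map_of_mem _ ht, ?_⟩
      rw [← hmap]
      exact t.2.2
    exact (h3 ▸ h4 : _ ∈ (U : Subgroup D).map D.subtype ⊓ (S : Subgroup G)).2
  have hgut : g = u * t := (congrArg Subtype.val hut).symm
  rw [hgut]
  refine Induces.mul hE'.injective (Induces.of_mem (⟨⟨t, htS⟩, mem_top _⟩ : (⊤ : Subgroup S)))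
    (Q := ⊤) ?_ ?_
  · have h2 := map_upperP_le (hE'.toAut_surjective ⊤) (mem_map_of_mem _ hu)
    have h3 := hind.2 ⊤ ⟨_, h2, rfl⟩
    exact ⟨_, h3, hE'.toAut_apply u⟩
  · intro x _
    rw [hmem]
    exact mul_mem (mul_mem htS x.1.2) (inv_mem htS)

/-- Closure properties of the relation "conjugation by `g` on `P ≤ T` belongs to a given normal
subsystem of index prime to `p` of the fusion system of `A` over `T`". -/
structure ConjClosed (p : ℕ) (A T : Subgroup Γ) (R : Subgroup Γ → Γ → Prop) : Prop where
  mono : ∀ {P Q g}, R P g → Q ≤ P → R Q g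
  mul : ∀ {P g h}, R P g → R (MulAut.conj g • P) h → R P (h * g)
  inv : ∀ {P g}, R P g → R (MulAut.conj g • P) g⁻¹
  of_mem : ∀ {P t}, P ≤ T → t ∈ T → R P t
  of_pow_eq_one : ∀ {P : Subgroup Γ} {g k}, P ≤ T → g ∈ A → g ∈ normalizer (P : Set Γ) →
    g ^ p ^ k = 1 → R P g
  extend : ∀ {P Q : Subgroup Γ} {g}, A ⊓ centralizer (P : Set Γ) ≤ P → R P g → P ≤ Q → Q ≤ T →
    g ∈ A → MulAut.conj g • Q ≤ T → R Q g

/-- Turns the subsystem into a relation between subgroups and elements of Γ. A p-element acts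
through O^{p'}(Aut(P)), and `extend` is where saturation enters. The condition P ≤ ι.range is
recorded because `P.comap ι` only sees the part of P in the range. -/
theorem conjClosed_induces [Fact p.Prime] {ι : T →* Γ} {A : Subgroup Γ} {E F₀ : FusionSystem p T}
    (hE : IsConjFusion ι A E) (hsub : ∀ P Q, F₀.Hom P Q ⊆ E.Hom P Q) (hsat : F₀.IsSaturated)
    (hind : ∀ P, E.autUpperPPrime P ≤ F₀.aut P) :
    ConjClosed p A ι.range fun P g => P ≤ ι.range ∧ Induces ι F₀ (P.comap ι) g := by
  have hcm : ∀ {P : Subgroup Γ}, P ≤ ι.range → (P.comap ι).map ι = P := fun h =>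
    map_comap_eq_self h
  have hrange : ∀ {P : Subgroup Γ} {g : Γ}, P ≤ ι.range → Induces ι F₀ (P.comap ι) g →
      MulAut.conj g • P ≤ ι.range := by
    rintro P g hP ⟨φ, -, hφ⟩
    rw [conj_smul_le_iff]
    intro x hx
    obtain ⟨x, rfl⟩ := hP hx
    exact ⟨φ ⟨x, hx⟩, hφ ⟨x, hx⟩⟩
  refine ⟨?_, ?_, ?_, ?_, ?_, ?_⟩
  · rintro P Q g ⟨hP, h⟩ hQ
    exact ⟨hQ.trans hP, h.mono (comap_mono hQ)⟩
  · rintro P g h ⟨hP, hg⟩ ⟨hgP, hh⟩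
    refine ⟨hP, hg.mul hE.injective hh fun x hx => ?_⟩
    rw [hcm hgP]
    exact conj_mem_conj_smul hx
  · rintro P g ⟨hP, hg⟩
    refine ⟨hrange hP hg, hg.inv hE.injective fun y hy => ?_⟩
    rw [hcm hP]
    exact mem_conj_smul.mp hy
  · rintro P _ hP ⟨t, rfl⟩
    exact ⟨hP, Induces.of_mem t⟩
  · intro P g k hP hgA hgP hgk
    refine ⟨hP, ?_⟩
    have hgP' : g ∈ A ⊓ normalizer (((P.comap ι).map ι : Subgroup Γ) : Set Γ) := by
      rw [hcm hP]
      exact ⟨hgA, hgP⟩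
    have h1 : hE.toAut (P.comap ι) ⟨g, hgP'⟩ ∈ upperPPrime p (E.aut (P.comap ι)) := by
      refine mem_upperPPrime_of_pow_eq_one (k := k) ?_
      rw [← map_pow, ← map_one (hE.toAut (P.comap ι))]
      congr 1
      exact Subtype.ext hgk
    exact ⟨_, F₀.comp_mem (hind _ ⟨_, h1, rfl⟩) (F₀.inclusion_mem le_top), hE.toAut_apply _⟩
  · rintro P Q g hC ⟨hP, hg⟩ hPQ hQ hgA hgQ
    refine ⟨hQ, Induces.extend hE hsub hsat hgA (fun x hx => ?_) _ _ (comap_mono hPQ) rfl ?_ hg⟩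
    · exact hgQ (conj_mem_conj_smul hx)
    · rwa [hcm hP]

theorem isWhole_of_hasIndexPrimeToP [Fact p.Prime] {ι : T →* Γ} {A : Subgroup Γ}
    {E : FusionSystem p T} (hE : IsConjFusion ι A E)
    (hR : ∀ R : Subgroup Γ → Γ → Prop, ConjClosed p A ι.range R →
      ∀ g ∈ A, MulAut.conj g • ι.range ≤ ι.range → R ι.range g)
    {T₀ : Subgroup T} {F₀ : FusionSystem p T₀} (hF₀ : E.IsNormalSubsystem T₀ F₀)
    (hind : E.HasIndexPrimeToP T₀ F₀) : E.IsWhole T₀ F₀ := by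
  obtain ⟨rfl, hind⟩ := hind
  refine isWhole_of_induces hE hF₀ fun g hgA hg => ?_
  have hcl := conjClosed_induces (hE.restrict ⊤) hF₀.isSubsystem hF₀.isSaturated hind
  have hrange : (ι.comp (⊤ : Subgroup T).subtype).range = ι.range := by
    rw [MonoidHom.range_comp, range_subtype, MonoidHom.range_eq_map]
  rw [hrange] at hcl
  have := (hR _ hcl g hgA (conj_smul_le_iff.mpr fun x hx => ?_)).2
  · refine this.mono fun x _ => ?_
    exact ⟨x, rfl⟩
  · obtain ⟨x, rfl⟩ := hx
    exact hg x

/-- If `P` is normal in `E`, then each conjugation can be modified so as to normalize `P`. -/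
theorem IsNormalSubgroup.exists_conj {ι : T →* Γ} {A : Subgroup Γ}
    {E : FusionSystem p T} (hE : IsConjFusion ι A E) {P : Subgroup T} (hP : E.IsNormalSubgroup P)
    {Q : Subgroup Γ} (hQ : Q ≤ ι.range) {g : Γ} (hgA : g ∈ A)
    (hg : MulAut.conj g • Q ≤ ι.range) :
    ∃ g' ∈ A, (∀ q ∈ Q, g' * q * g'⁻¹ = g * q * g⁻¹) ∧
      ∀ x ∈ P.map ι, g' * x * g'⁻¹ ∈ P.map ι := by
  have hmem : ∀ x : Q.comap ι, g * ι x * g⁻¹ ∈ ι.range := fun x =>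
    hg (conj_mem_conj_smul x.2)
  choose φ hφ using hmem
  let φ' : Q.comap ι →* (⊤ : Subgroup T) :=
    { toFun := fun x => ⟨φ x, mem_top _⟩
      map_one' := Subtype.ext (hE.injective (by rw [hφ]; simp))
      map_mul' := fun x y => Subtype.ext (hE.injective (by
        simp only [hφ, coe_mul, map_mul]
        group)) }
  have hφ' : φ' ∈ E.Hom (Q.comap ι) ⊤ := hE.mem_iff.mpr ⟨g, hgA, hφ⟩
  obtain ⟨ψ, hψ, hψφ, hψP⟩ := hP.2 _ _ φ' hφ'
  obtain ⟨g', hg'A, hg'⟩ := hE.mem_iff.mp hψ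
  refine ⟨g', hg'A, fun q hq => ?_, ?_⟩
  · obtain ⟨q, rfl⟩ := hQ hq
    have h1 := hg' (inclusion le_sup_right ⟨q, hq⟩)
    rw [hψφ ⟨q, hq⟩] at h1
    exact h1.symm.trans (hφ ⟨q, hq⟩)
  · rintro _ ⟨x, hx, rfl⟩
    have hx' : x ∈ P ⊔ Q.comap ι := mem_sup_left hx
    have h1 := hg' ⟨x, hx'⟩
    have h2 : ψ ⟨x, hx'⟩ ∈ P.subgroupOf (P ⊔ ⊤) := by
      rw [← hψP]
      exact mem_map_of_mem ψ hx
    exact ⟨_, h2, h1⟩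

/-- Sufficient conditions for the fusion system of a perfect group `G` to be reduced, expressed
inside a group `Γ` containing `G`. -/
theorem isReduced_of_embedding [Fact p.Prime] {G : Type*} [Group G] [Finite G] (S : Sylow p G)
    {f : G →* Γ} (hf : Function.Injective f) (hG : commutator G = ⊤) {A T : Subgroup Γ}
    (hA : f.range = A) (hT : (S : Subgroup G).map f = T)
    (hN : ∀ P ≤ T, (∀ Q ≤ T, ∀ g ∈ A, MulAut.conj g • Q ≤ T → ∃ g' ∈ A,
      (∀ q ∈ Q, g' * q * g'⁻¹ = g * q * g⁻¹) ∧ ∀ x ∈ P, g' * x * g'⁻¹ ∈ P) → P = ⊥)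
    (hR : ∀ R : Subgroup Γ → Γ → Prop, ConjClosed p A T R →
      ∀ g ∈ A, MulAut.conj g • T ≤ T → R T g) : (ofSylow S).IsReduced := by
  have hE := ofSylow_isConjFusion S hf
  have hrange : (f.comp (sylowIncl S)).range = T := by
    rw [MonoidHom.range_comp, ← hT]
    congr 1
    exact range_subtype _
  subst hA
  rw [← hrange] at hN hR
  refine ⟨ofSylow_isSaturated S, fun P hP => ?_, fun S₀ F₀ => isWhole_of_hasPPowerIndex hG,
    fun S₀ F₀ => isWhole_of_hasIndexPrimeToP hE hR⟩
  have h1 := hN (P.map (f.comp (sylowIncl S))) (map_le_range _ _) fun Q hQ g hgA hg =>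
    hP.exists_conj hE hQ hgA hg
  exact (map_eq_bot_iff_of_injective P hE.injective).mp h1

end Reduced

end FusionSystem

/-! ### Shifts, permutations and dilations of the rows -/

namespace WreathPerm

open Equiv Subgroup
open scoped commutatorElement

section Basic

variable {p : ℕ} {K U : Type*}

/-- The permutation shifting the row `i` by `f i`. -/
def shift (f : K → ZMod p) : Perm ((K × ZMod p) ⊕ U) where
  toFun := Sum.map (fun x => (x.1, x.2 + f x.1)) id
  invFun := Sum.map (fun x => (x.1, x.2 - f x.1)) id
  left_inv := by rintro (⟨i, x⟩ | u) <;> simp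
  right_inv := by rintro (⟨i, x⟩ | u) <;> simp

@[simp]
theorem shift_inl (f : K → ZMod p) (i : K) (x : ZMod p) :
    (shift f : Perm ((K × ZMod p) ⊕ U)) (Sum.inl (i, x)) = Sum.inl (i, x + f i) := rfl

@[simp]
theorem shift_inr (f : K → ZMod p) (u : U) :
    (shift f : Perm ((K × ZMod p) ⊕ U)) (Sum.inr u) = Sum.inr u := rfl

theorem shift_add (f g : K → ZMod p) :
    (shift (f + g) : Perm ((K × ZMod p) ⊕ U)) = shift f * shift g := by
  ext1 (⟨i, x⟩ | u)
  · simp [add_comm, add_left_comm]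
  · simp

@[simp]
theorem shift_zero : (shift (0 : K → ZMod p) : Perm ((K × ZMod p) ⊕ U)) = 1 := by
  ext1 (⟨i, x⟩ | u) <;> simp

theorem shift_neg (f : K → ZMod p) :
    (shift (-f) : Perm ((K × ZMod p) ⊕ U)) = (shift f)⁻¹ := by
  rw [eq_inv_iff_mul_eq_one, ← shift_add, neg_add_cancel, shift_zero]

theorem shift_sub (f g : K → ZMod p) :
    (shift (f - g) : Perm ((K × ZMod p) ⊕ U)) = shift f * (shift g)⁻¹ := by
  rw [sub_eq_add_neg, shift_add, shift_neg]

theorem shift_pow (f : K → ZMod p) (n : ℕ) :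
    (shift f : Perm ((K × ZMod p) ⊕ U)) ^ n = shift (n • f) := by
  induction n with
  | zero => simp
  | succ n ih => rw [pow_succ, ih, ← shift_add, succ_nsmul]

theorem shift_pow_self (f : K → ZMod p) : (shift f : Perm ((K × ZMod p) ⊕ U)) ^ p = 1 := by
  rw [shift_pow]
  convert shift_zero
  funext i
  simp

/-- The permutation of the rows by `σ`. -/
def rowPerm : Perm K →* Perm ((K × ZMod p) ⊕ U) where
  toFun σ :=
    { toFun := Sum.map (fun x => (σ x.1, x.2)) id
      invFun := Sum.map (fun x => (σ⁻¹ x.1, x.2)) id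
      left_inv := by rintro (⟨i, x⟩ | u) <;> simp
      right_inv := by rintro (⟨i, x⟩ | u) <;> simp }
  map_one' := by ext1 (⟨i, x⟩ | u) <;> rfl
  map_mul' σ τ := by ext1 (⟨i, x⟩ | u) <;> rfl

@[simp]
theorem rowPerm_inl (σ : Perm K) (i : K) (x : ZMod p) :
    (rowPerm σ : Perm ((K × ZMod p) ⊕ U)) (Sum.inl (i, x)) = Sum.inl (σ i, x) := rfl

@[simp]
theorem rowPerm_inr (σ : Perm K) (u : U) :
    (rowPerm σ : Perm ((K × ZMod p) ⊕ U)) (Sum.inr u) = Sum.inr u := rfl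

/-- The permutation multiplying the row `i` by `u i`. -/
def dilate : (K → (ZMod p)ˣ) →* Perm ((K × ZMod p) ⊕ U) where
  toFun u :=
    { toFun := Sum.map (fun x => (x.1, u x.1 * x.2)) id
      invFun := Sum.map (fun x => (x.1, ↑(u x.1)⁻¹ * x.2)) id
      left_inv := by rintro (⟨i, x⟩ | u) <;> simp
      right_inv := by rintro (⟨i, x⟩ | u) <;> simp }
  map_one' := by ext1 (⟨i, x⟩ | u) <;> simp
  map_mul' σ τ := by ext1 (⟨i, x⟩ | u) <;> simp [mul_assoc]

@[simp]
theorem dilate_inl (u : K → (ZMod p)ˣ) (i : K) (x : ZMod p) :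
    (dilate u : Perm ((K × ZMod p) ⊕ U)) (Sum.inl (i, x)) = Sum.inl (i, u i * x) := rfl

@[simp]
theorem dilate_inr (u : K → (ZMod p)ˣ) (v : U) :
    (dilate u : Perm ((K × ZMod p) ⊕ U)) (Sum.inr v) = Sum.inr v := rfl

theorem rowPerm_mul_shift (σ : Perm K) (f : K → ZMod p) :
    (rowPerm σ : Perm ((K × ZMod p) ⊕ U)) * shift f = shift (f ∘ σ.symm) * rowPerm σ := by
  ext1 (⟨i, x⟩ | u) <;> simp

theorem rowPerm_conj_shift (σ : Perm K) (f : K → ZMod p) :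
    (rowPerm σ : Perm ((K × ZMod p) ⊕ U)) * shift f * (rowPerm σ)⁻¹ = shift (f ∘ σ.symm) := by
  rw [rowPerm_mul_shift, mul_inv_cancel_right]

theorem dilate_conj_shift (u : K → (ZMod p)ˣ) (f : K → ZMod p) :
    (dilate u : Perm ((K × ZMod p) ⊕ U)) * shift f * (dilate u)⁻¹ =
      shift fun i => (u i : ZMod p) * f i := by
  rw [mul_inv_eq_iff_eq_mul]
  ext1 (⟨i, x⟩ | u) <;> simp [mul_add]

theorem rowPerm_conj_dilate (σ : Perm K) (u : K → (ZMod p)ˣ) :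
    (rowPerm σ : Perm ((K × ZMod p) ⊕ U)) * dilate u * (rowPerm σ)⁻¹ =
      dilate (u ∘ σ.symm) := by
  rw [mul_inv_eq_iff_eq_mul]
  ext1 (⟨i, x⟩ | u) <;> simp

variable (p K U) in
/-- The group of all shifts of the rows. -/
def shiftGroup : Subgroup (Perm ((K × ZMod p) ⊕ U)) where
  carrier := Set.range shift
  one_mem' := ⟨0, shift_zero⟩
  mul_mem' := by
    rintro _ _ ⟨f, rfl⟩ ⟨g, rfl⟩
    exact ⟨f + g, shift_add f g⟩
  inv_mem' := by
    rintro _ ⟨f, rfl⟩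
    exact ⟨-f, shift_neg f⟩

theorem shift_mem (f : K → ZMod p) : shift f ∈ shiftGroup p K U := ⟨f, rfl⟩

variable (p K U) in
/-- The wreath product of the shifts with the permutations of the rows. -/
def wreath : Subgroup (Perm ((K × ZMod p) ⊕ U)) where
  carrier := {g | ∃ f σ, g = shift f * rowPerm σ}
  one_mem' := ⟨0, 1, by simp⟩
  mul_mem' := by
    rintro _ _ ⟨f, σ, rfl⟩ ⟨g, τ, rfl⟩
    refine ⟨f + g ∘ σ.symm, σ * τ, ?_⟩
    rw [shift_add, map_mul, mul_assoc, ← mul_assoc (rowPerm σ), rowPerm_mul_shift]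
    simp only [mul_assoc]
  inv_mem' := by
    rintro _ ⟨f, σ, rfl⟩
    refine ⟨(-f) ∘ σ⁻¹.symm, σ⁻¹, ?_⟩
    rw [← rowPerm_mul_shift, mul_inv_rev, ← map_inv, shift_neg]

theorem shift_mul_rowPerm_mem (f : K → ZMod p) (σ : Perm K) :
    shift f * rowPerm σ ∈ wreath p K U := ⟨f, σ, rfl⟩

theorem rowPerm_mem_normalizer (σ : Perm K) :
    rowPerm σ ∈ normalizer (shiftGroup p K U : Set (Perm ((K × ZMod p) ⊕ U))) := by
  have h : ∀ σ : Perm K, ∀ g ∈ shiftGroup p K U,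
      rowPerm σ * g * (rowPerm σ)⁻¹ ∈ shiftGroup p K U := by
    rintro σ _ ⟨f, rfl⟩
    rw [rowPerm_conj_shift]
    exact shift_mem _
  refine mem_normalizer_iff.mpr fun g => ⟨h σ g, fun hg => ?_⟩
  have := h σ⁻¹ _ hg
  simpa [mul_assoc] using this

theorem dilate_mem_normalizer (u : K → (ZMod p)ˣ) :
    dilate u ∈ normalizer (shiftGroup p K U : Set (Perm ((K × ZMod p) ⊕ U))) := by
  have h : ∀ u : K → (ZMod p)ˣ, ∀ g ∈ shiftGroup p K U,
      dilate u * g * (dilate u)⁻¹ ∈ shiftGroup p K U := by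
    rintro u _ ⟨f, rfl⟩
    rw [dilate_conj_shift]
    exact shift_mem _
  refine mem_normalizer_iff.mpr fun g => ⟨h u g, fun hg => ?_⟩
  have := h u⁻¹ _ hg
  simpa [mul_assoc] using this

theorem wreath_le_normalizer :
    wreath p K U ≤ normalizer (shiftGroup p K U : Set (Perm ((K × ZMod p) ⊕ U))) := by
  rintro _ ⟨f, σ, rfl⟩
  exact mul_mem ((shiftGroup p K U).le_normalizer (shift_mem f)) (rowPerm_mem_normalizer σ)

/-- A self-map of `ZMod p` commuting up to `c` with the shift by `1` is affine. -/
theorem eq_add_mul_of_forall [NeZero p] {γ : ZMod p → ZMod p} {c : ZMod p}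
    (h : ∀ x, γ (x + 1) = γ x + c) (x : ZMod p) : γ x = γ 0 + x * c := by
  have key : ∀ n : ℕ, γ n = γ 0 + n * c := by
    intro n
    induction n with
    | zero => simp
    | succ n ih =>
      push_cast
      rw [h, ih]
      ring
  have := key x.val
  rwa [ZMod.natCast_zmod_val] at this

variable [DecidableEq K]

theorem commutator_shift_swap (i l : K) (c : ZMod p) :
    ⁅(shift (Pi.single i c : K → ZMod p) : Perm ((K × ZMod p) ⊕ U)),
      (rowPerm (swap i l) : Perm ((K × ZMod p) ⊕ U))⁆ =
      shift (Pi.single i c - Pi.single l c : K → ZMod p) := by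
  rw [commutatorElement_def, ← shift_neg, mul_assoc, mul_assoc, ← mul_assoc (rowPerm _),
    rowPerm_conj_shift, ← shift_add]
  congr 1
  funext j
  by_cases h1 : j = i
  · subst h1
    by_cases h2 : l = j
    · subst h2
      simp
    · simp [Pi.single_apply, h2, Ne.symm h2]
  · by_cases h2 : j = l
    · subst h2
      simp [Pi.single_apply, h1]
    · simp [Pi.single_apply, h1, h2, swap_apply_of_ne_of_ne h1 h2]

/-- A permutation commuting with all `shift (δ i - δ l)` is a shift. -/
theorem mem_shiftGroup_of_commute [Fact p.Prime] [Subsingleton U]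
    (h3 : ∀ i j : K, ∃ l, l ≠ i ∧ l ≠ j) {z : Perm ((K × ZMod p) ⊕ U)}
    (hz : ∀ i l : K, Commute z (shift (Pi.single i 1 - Pi.single l 1 : K → ZMod p))) :
    z ∈ shiftGroup p K U := by
  have hz' : ∀ i l q, z (shift (Pi.single i 1 - Pi.single l 1 : K → ZMod p) q) =
      shift (Pi.single i 1 - Pi.single l 1 : K → ZMod p) (z q) :=
    fun i l q => DFunLike.congr_fun (hz i l) q
  -- If z moved a point of row i to another row j, a shift by δ j - δ l with l different from i and
  -- j would fix the point but move its image. An image in U would be fixed while the point is moved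
  -- by δ i - δ l.
  have hrow : ∀ i x, ∃ y, z (Sum.inl (i, x)) = Sum.inl (i, y) := by
    intro i x
    rcases hq : z (Sum.inl (i, x)) with ⟨j, y⟩ | u
    · by_cases hij : j = i
      · exact ⟨y, by rw [hij]⟩
      · obtain ⟨l, hli, hlj⟩ := h3 i j
        have := hz' j l (Sum.inl (i, x))
        simp [hq, Pi.single_apply, hij, Ne.symm hij, hli.symm, hlj.symm] at this
    · obtain ⟨l, hli, -⟩ := h3 i i
      have := hz' i l (Sum.inl (i, x))
      rw [hq, shift_inr, ← hq] at this
      simp [Pi.single_apply, hli.symm] at this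
  choose γ hγ using hrow
  have haff : ∀ i x, γ i (x + 1) = γ i x + 1 := by
    intro i x
    obtain ⟨l, hli, -⟩ := h3 i i
    have := hz' i l (Sum.inl (i, x))
    simpa [hγ, Pi.single_apply, hli.symm] using this
  refine ⟨fun i => γ i 0, ?_⟩
  ext1 (⟨i, x⟩ | u)
  · rw [hγ, shift_inl, eq_add_mul_of_forall (haff i) x]
    simp [add_comm]
  · rcases hq : z (Sum.inr u) with ⟨j, y⟩ | u'
    · obtain ⟨l, hli, -⟩ := h3 j j
      have := hz' j l (Sum.inr u)
      simp [hq, Pi.single_apply, hli.symm] at this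
    · rw [Subsingleton.elim u' u, shift_inr]

end Basic

/-! ### The plane formed by the first p rows -/

section Square

variable {p : ℕ} {L U : Type*}

/-- The action of a permutation of `ZMod p × ZMod p` on the first `p` rows; the first coordinate is
the index of the row. -/
def square : Perm (ZMod p × ZMod p) →* Perm (((ZMod p ⊕ L) × ZMod p) ⊕ U) where
  toFun m :=
    { toFun := fun
        | Sum.inl (Sum.inl b, x) => Sum.inl (Sum.inl (m (b, x)).1, (m (b, x)).2)
        | Sum.inl (Sum.inr l, x) => Sum.inl (Sum.inr l, x)
        | Sum.inr u => Sum.inr u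
      invFun := fun
        | Sum.inl (Sum.inl b, x) => Sum.inl (Sum.inl (m⁻¹ (b, x)).1, (m⁻¹ (b, x)).2)
        | Sum.inl (Sum.inr l, x) => Sum.inl (Sum.inr l, x)
        | Sum.inr u => Sum.inr u
      left_inv := by rintro (⟨b | l, x⟩ | u) <;> simp
      right_inv := by rintro (⟨b | l, x⟩ | u) <;> simp }
  map_one' := by ext1 (⟨b | l, x⟩ | u) <;> rfl
  map_mul' m n := by ext1 (⟨b | l, x⟩ | u) <;> rfl

@[simp]
theorem square_inl_inl (m : Perm (ZMod p × ZMod p)) (b x : ZMod p) :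
    (square m : Perm (((ZMod p ⊕ L) × ZMod p) ⊕ U)) (Sum.inl (Sum.inl b, x)) =
      Sum.inl (Sum.inl (m (b, x)).1, (m (b, x)).2) := rfl

@[simp]
theorem square_inl_inr (m : Perm (ZMod p × ZMod p)) (l : L) (x : ZMod p) :
    (square m : Perm (((ZMod p ⊕ L) × ZMod p) ⊕ U)) (Sum.inl (Sum.inr l, x)) =
      Sum.inl (Sum.inr l, x) := rfl

@[simp]
theorem square_inr (m : Perm (ZMod p × ZMod p)) (u : U) :
    (square m : Perm (((ZMod p ⊕ L) × ZMod p) ⊕ U)) (Sum.inr u) = Sum.inr u := rfl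

/-- The translations of the plane `ZMod p × ZMod p`. -/
def translate (v : ZMod p × ZMod p) : Perm (ZMod p × ZMod p) := Equiv.addRight v

@[simp]
theorem translate_apply (v q : ZMod p × ZMod p) : translate v q = q + v := rfl

theorem translate_add (v w : ZMod p × ZMod p) :
    translate (v + w) = translate v * translate w := by
  ext1 q
  simp [add_comm, add_left_comm]

theorem translate_zero : translate (0 : ZMod p × ZMod p) = 1 := by
  ext1 q
  simp

theorem translate_neg (v : ZMod p × ZMod p) : translate (-v) = (translate v)⁻¹ := by
  rw [eq_inv_iff_mul_eq_one, ← translate_add, neg_add_cancel, translate_zero]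

theorem translate_pow_self (v : ZMod p × ZMod p) : translate v ^ p = 1 := by
  have : ∀ n : ℕ, translate v ^ n = translate (n • v) := by
    intro n
    induction n with
    | zero => simp [translate_zero]
    | succ n ih => rw [pow_succ, ih, ← translate_add, succ_nsmul]
  rw [this, ← translate_zero]
  congr 1
  ext <;> simp

variable (p L U) in
/-- The translations of the first `p` rows, seen as a plane. -/
def planeGroup : Subgroup (Perm (((ZMod p ⊕ L) × ZMod p) ⊕ U)) where
  carrier := Set.range fun v => square (translate v)
  one_mem' := ⟨0, by simp only [translate_zero, map_one]⟩
  mul_mem' := by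
    rintro _ _ ⟨v, rfl⟩ ⟨w, rfl⟩
    exact ⟨v + w, by simp only [translate_add, map_mul]⟩
  inv_mem' := by
    rintro _ ⟨v, rfl⟩
    exact ⟨-v, by simp only [translate_neg, map_inv]⟩

theorem translate_mem (v : ZMod p × ZMod p) : square (translate v) ∈ planeGroup p L U := ⟨v, rfl⟩

/-- The transvection adding `t` times the row index to the position in the row. -/
def transvection₁ (t : ZMod p) : Perm (ZMod p × ZMod p) where
  toFun q := (q.1, q.2 + t * q.1)
  invFun q := (q.1, q.2 - t * q.1)
  left_inv q := by simp
  right_inv q := by simp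

/-- The transvection adding `t` times the position in the row to the row index. -/
def transvection₂ (t : ZMod p) : Perm (ZMod p × ZMod p) where
  toFun q := (q.1 + t * q.2, q.2)
  invFun q := (q.1 - t * q.2, q.2)
  left_inv q := by simp
  right_inv q := by simp

@[simp]
theorem transvection₁_apply (t : ZMod p) (q : ZMod p × ZMod p) :
    transvection₁ t q = (q.1, q.2 + t * q.1) := rfl

@[simp]
theorem transvection₂_apply (t : ZMod p) (q : ZMod p × ZMod p) :
    transvection₂ t q = (q.1 + t * q.2, q.2) := rfl

theorem transvection₁_pow (t : ZMod p) (n : ℕ) :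
    transvection₁ t ^ n = transvection₁ ((n : ZMod p) * t) := by
  induction n with
  | zero => ext1 q; simp
  | succ n ih =>
    rw [pow_succ, ih]
    ext1 q
    simp only [Perm.mul_apply, transvection₁_apply, Prod.mk.injEq, true_and]
    push_cast
    ring

theorem transvection₂_pow (t : ZMod p) (n : ℕ) :
    transvection₂ t ^ n = transvection₂ ((n : ZMod p) * t) := by
  induction n with
  | zero => ext1 q; simp
  | succ n ih =>
    rw [pow_succ, ih]
    ext1 q
    simp only [Perm.mul_apply, transvection₂_apply, Prod.mk.injEq, and_true]
    push_cast
    ring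

theorem transvection₁_pow_self (t : ZMod p) : transvection₁ t ^ p = 1 := by
  rw [transvection₁_pow]
  ext1 q
  simp

theorem transvection₂_pow_self (t : ZMod p) : transvection₂ t ^ p = 1 := by
  rw [transvection₂_pow]
  ext1 q
  simp

theorem conj_translate_mem {m : Perm (ZMod p × ZMod p)}
    (hm : ∀ v w, m (v + w) = m v + m w) (v : ZMod p × ZMod p) :
    m * translate v * m⁻¹ = translate (m v) := by
  rw [mul_inv_eq_iff_eq_mul]
  ext1 q
  simp [hm]

theorem square_mem_normalizer {m : Perm (ZMod p × ZMod p)}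
    (hm : ∀ v w, m (v + w) = m v + m w) :
    square m ∈ normalizer (planeGroup p L U : Set (Perm (((ZMod p ⊕ L) × ZMod p) ⊕ U))) := by
  have h : ∀ {m : Perm (ZMod p × ZMod p)}, (∀ v w, m (v + w) = m v + m w) →
      ∀ g ∈ planeGroup p L U, square m * g * (square m)⁻¹ ∈ planeGroup p L U := by
    rintro m hm _ ⟨v, rfl⟩
    rw [← map_mul, ← map_inv, ← map_mul, conj_translate_mem hm]
    exact translate_mem _
  refine mem_normalizer_iff.mpr fun g => ⟨h hm g, fun hg => ?_⟩
  have := h (m := m⁻¹) (fun v w => ?_) _ hg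
  · simpa [mul_assoc] using this
  · rw [Perm.inv_eq_iff_eq, hm]
    simp

theorem translate_eq_shift_mul_rowPerm (v : ZMod p × ZMod p) :
    (square (translate v) : Perm (((ZMod p ⊕ L) × ZMod p) ⊕ U)) =
      shift (Sum.elim (fun _ => v.2) 0) *
        rowPerm (Perm.sumCongr (Equiv.addRight v.1) 1) := by
  ext1 (⟨b | l, x⟩ | u) <;> simp

theorem planeGroup_le_wreath : planeGroup p L U ≤ wreath p (ZMod p ⊕ L) U := by
  rintro _ ⟨v, rfl⟩
  simp only [translate_eq_shift_mul_rowPerm]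
  exact shift_mul_rowPerm_mem _ _

/-- A permutation commuting with the plane translations acts as a translation on the plane. -/
theorem exists_translate_of_commute [Fact p.Prime] {z : Perm (((ZMod p ⊕ L) × ZMod p) ⊕ U)}
    (hz : ∀ v, Commute z (square (translate v))) :
    ∃ v : ZMod p × ZMod p, ∀ b x,
      z (Sum.inl (Sum.inl b, x)) = Sum.inl (Sum.inl (b + v.1), x + v.2) := by
  have hz' : ∀ v q, z (square (translate v) q) = square (translate v) (z q) :=
    fun v q => DFunLike.congr_fun (hz v) q
  have h0 : ∃ v : ZMod p × ZMod p, z (Sum.inl (Sum.inl 0, 0)) = Sum.inl (Sum.inl v.1, v.2) := by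
    rcases hq : z (Sum.inl (Sum.inl 0, 0)) with ⟨b | l, x⟩ | u
    · exact ⟨(b, x), rfl⟩
    · have := hz' (1, 0) (Sum.inl (Sum.inl 0, 0))
      rw [hq, square_inl_inr, ← hq] at this
      simp at this
    · have := hz' (1, 0) (Sum.inl (Sum.inl 0, 0))
      rw [hq, square_inr, ← hq] at this
      simp at this
  obtain ⟨v, hv⟩ := h0
  refine ⟨v, fun b x => ?_⟩
  have := hz' (b, x) (Sum.inl (Sum.inl 0, 0))
  rw [hv] at this
  simpa [add_comm] using this

end Square

end WreathPerm

/-! ### Parity of the permutations -/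

namespace WreathPerm

open Equiv Subgroup
open scoped commutatorElement

theorem eq_zero_of_ne_one {p : ℕ} (h2 : p = 2) {a : ZMod p} (h : a ≠ 1) : a = 0 := by
  subst h2
  revert a
  decide

theorem one_add_one_eq_zero_of_two {p : ℕ} (h2 : p = 2) : (1 + 1 : ZMod p) = 0 := by
  subst h2
  decide

section Even

variable {p : ℕ} [Fact p.Prime] {K U : Type*} [Fintype K] [DecidableEq K] [Fintype U]
  [DecidableEq U]

theorem commutator_mem_alternatingGroup {α : Type*} [Fintype α] [DecidableEq α] (a b : Perm α) :
    ⁅a, b⁆ ∈ alternatingGroup α := by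
  rw [Perm.mem_alternatingGroup, map_commutatorElement]
  exact commutatorElement_eq_one_iff_commute.mpr (Commute.all _ _)

theorem mem_alternatingGroup_of_pow_eq_one {α : Type*} [Fintype α] [DecidableEq α] {m : ℕ}
    (hm : Odd m) {g : Perm α} (hg : g ^ m = 1) : g ∈ alternatingGroup α := by
  rw [Perm.mem_alternatingGroup]
  have h1 := congrArg Perm.sign hg
  rw [map_pow, map_one] at h1
  rcases Int.units_eq_one_or (Perm.sign g) with h | h
  · exact h
  · rw [h, hm.neg_one_pow] at h1
    exact absurd h1 (by decide)

theorem conj_mem_alternatingGroup {α : Type*} [Fintype α] [DecidableEq α] {g : Perm α}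
    (hg : g ∈ alternatingGroup α) (a : Perm α) : a * g * a⁻¹ ∈ alternatingGroup α := by
  rw [Perm.mem_alternatingGroup] at hg ⊢
  simp [hg]

theorem shift_single_sub_mem (i l : K) (c : ZMod p) :
    (shift (Pi.single i c - Pi.single l c : K → ZMod p) : Perm ((K × ZMod p) ⊕ U)) ∈
      alternatingGroup _ := by
  rw [← commutator_shift_swap]
  exact commutator_mem_alternatingGroup _ _

theorem sign_rowPerm (σ : Perm K) :
    Perm.sign (rowPerm σ : Perm ((K × ZMod p) ⊕ U)) = Perm.sign σ ^ p := by
  have : (rowPerm σ : Perm ((K × ZMod p) ⊕ U)) =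
      Perm.sumCongr (prodCongrLeft fun _ : ZMod p => σ) 1 := by
    ext1 (⟨i, x⟩ | u) <;> rfl
  rw [this, Perm.sign_sumCongr, Perm.sign_prodCongrLeft]
  simp [ZMod.card]

theorem rowPerm_mem_of_even {σ : Perm K} (hσ : σ ∈ alternatingGroup K) :
    (rowPerm σ : Perm ((K × ZMod p) ⊕ U)) ∈ alternatingGroup _ := by
  rw [Perm.mem_alternatingGroup] at hσ ⊢
  rw [sign_rowPerm, hσ, one_pow]

theorem rowPerm_mem_of_two (h2 : p = 2) (σ : Perm K) :
    (rowPerm σ : Perm ((K × ZMod p) ⊕ U)) ∈ alternatingGroup _ := by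
  rw [Perm.mem_alternatingGroup, sign_rowPerm, h2, Int.units_sq]

theorem dilate_conj_swap (i j : K) (c : (ZMod p)ˣ) :
    (rowPerm (swap i j) : Perm ((K × ZMod p) ⊕ U)) * dilate (Pi.mulSingle i c) *
      (rowPerm (swap i j))⁻¹ = dilate (Pi.mulSingle j c) := by
  rw [rowPerm_conj_dilate]
  congr 1
  funext l
  simp only [Function.comp_apply, symm_swap, Pi.mulSingle_apply]
  congr 1
  rw [eq_iff_iff, swap_apply_eq_iff, swap_apply_left]

/-- The two factors are conjugate by a row transposition, so their signs cancel without being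
computed. -/
theorem dilate_neg_one_mem (i j : K) :
    (dilate (Pi.mulSingle i (-1) * Pi.mulSingle j (-1)) : Perm ((K × ZMod p) ⊕ U)) ∈
      alternatingGroup _ := by
  have h : Perm.sign (dilate (Pi.mulSingle j (-1)) : Perm ((K × ZMod p) ⊕ U)) =
      Perm.sign (dilate (Pi.mulSingle i (-1)) : Perm ((K × ZMod p) ⊕ U)) := by
    rw [← dilate_conj_swap i j]
    simp only [map_mul, map_inv, Int.units_inv_eq_self]
    rw [mul_right_comm, Int.units_mul_self, one_mul]
  rw [Perm.mem_alternatingGroup, map_mul, map_mul, h, Int.units_mul_self]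

end Even

section EvenSquare

variable {p : ℕ} [Fact p.Prime] {L U : Type*} [Fintype L] [DecidableEq L] [Fintype U]
  [DecidableEq U]

/-- The linear map with matrix `!![1, 1; 1, 2]`. -/
def shear : Perm (ZMod p × ZMod p) := transvection₁ 1 * transvection₂ 1

theorem shear_apply (q : ZMod p × ZMod p) :
    shear q = (q.1 + q.2, q.2 + (q.1 + q.2)) := by
  simp [shear]

theorem shear_add (v w : ZMod p × ZMod p) : shear (v + w) = shear v + shear w := by
  simp only [shear_apply, Prod.fst_add, Prod.snd_add, Prod.mk_add_mk, Prod.mk.injEq]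
  constructor <;> ring

/-- The two transvections are conjugate under the exchange of coordinates, hence have equal signs.
-/
theorem square_shear_mem :
    (square shear : Perm (((ZMod p ⊕ L) × ZMod p) ⊕ U)) ∈ alternatingGroup _ := by
  have h : transvection₂ (1 : ZMod p) =
      Equiv.prodComm _ _ * transvection₁ 1 * (Equiv.prodComm (ZMod p) (ZMod p))⁻¹ := by
    rw [eq_mul_inv_iff_mul_eq]
    ext1 q
    simp
  rw [shear, h, Perm.mem_alternatingGroup]
  simp only [map_mul, map_inv, mul_inv_cancel_comm]
  rw [Int.units_mul_self]

theorem commutator_square_translate {m : Perm (ZMod p × ZMod p)}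
    (hm : ∀ v w, m (v + w) = m v + m w) (v : ZMod p × ZMod p) :
    (⁅(square m : Perm (((ZMod p ⊕ L) × ZMod p) ⊕ U)),
      (square (translate v) : Perm (((ZMod p ⊕ L) × ZMod p) ⊕ U))⁆) =
        square (translate (m v - v)) := by
  rw [← map_commutatorElement, commutatorElement_def, conj_translate_mem hm, ← translate_neg,
    ← translate_add, sub_eq_add_neg]

/-- The map shear - 1 has determinant -1, so for every p each translation is a commutator with the
shear. -/
theorem square_translate_mem (v : ZMod p × ZMod p) :
    (square (translate v) : Perm (((ZMod p ⊕ L) × ZMod p) ⊕ U)) ∈ alternatingGroup _ := by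
  have h : v = shear (v.2 - v.1, v.1) - (v.2 - v.1, v.1) := by
    ext <;> simp [shear_apply]
  rw [h, ← commutator_square_translate shear_add]
  exact commutator_mem_alternatingGroup _ _

theorem planeGroup_le_alternatingGroup : planeGroup p L U ≤ alternatingGroup _ := by
  rintro _ ⟨v, rfl⟩
  exact square_translate_mem v

end EvenSquare

/-! ### Absence of nontrivial normal subgroups -/

section Nice

variable {p : ℕ} [Fact p.Prime] {L U : Type*} [Fintype L] [DecidableEq L] [Fintype U]
  [DecidableEq U]

/-- The properties of the Sylow subgroup `T` of the alternating group that are used below. -/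
structure IsNice (T : Subgroup (Perm (((ZMod p ⊕ L) × ZMod p) ⊕ U))) : Prop where
  le_alternatingGroup : T ≤ alternatingGroup _
  le_wreath : T ≤ wreath p (ZMod p ⊕ L) U
  shiftGroup_le : shiftGroup p (ZMod p ⊕ L) U ⊓ alternatingGroup _ ≤ T
  planeGroup_le : planeGroup p L U ≤ T

variable {T : Subgroup (Perm (((ZMod p ⊕ L) × ZMod p) ⊕ U))}

theorem IsNice.shift_sub_mem (hT : IsNice T) (i l : ZMod p ⊕ L) (c : ZMod p) :
    shift (Pi.single i c - Pi.single l c) ∈ T :=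
  hT.shiftGroup_le ⟨shift_mem _, shift_single_sub_mem i l c⟩

theorem exists_perm_apply_eq {K : Type*} [DecidableEq K] {i j a b : K} (hij : i ≠ j)
    (hab : a ≠ b) : ∃ σ : Perm K, σ i = a ∧ σ j = b := by
  refine ⟨swap b (swap a i j) * swap a i, ?_, ?_⟩
  · rw [Perm.mul_apply, swap_apply_right, swap_apply_of_ne_of_ne hab]
    intro h
    have := congrArg (swap a i) h
    rw [swap_apply_left, swap_apply_self] at this
    exact hij this
  · rw [Perm.mul_apply, swap_apply_right]

/-- The subgroups of `T` satisfying the hypothesis below are invariant under the conjugations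
by even permutations that stay inside `T`. -/
def StableUnder (A T P : Subgroup (Perm (((ZMod p ⊕ L) × ZMod p) ⊕ U))) : Prop :=
  ∀ Q ≤ T, ∀ g ∈ A, MulAut.conj g • Q ≤ T → ∃ g' ∈ A,
    (∀ q ∈ Q, g' * q * g'⁻¹ = g * q * g⁻¹) ∧ ∀ x ∈ P, g' * x * g'⁻¹ ∈ P

variable {P : Subgroup (Perm (((ZMod p ⊕ L) × ZMod p) ⊕ U))}

/-- The hypothesis for Q = ⟨x⟩ replaces g by an element with the same effect on x that preserves P.
-/
theorem StableUnder.conj_mem (hP : StableUnder (alternatingGroup _) T P) (hPT : P ≤ T)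
    {x g : Perm (((ZMod p ⊕ L) × ZMod p) ⊕ U)} (hx : x ∈ P) (hg : g ∈ alternatingGroup _)
    (hgx : g * x * g⁻¹ ∈ T) : g * x * g⁻¹ ∈ P := by
  obtain ⟨g', -, hg', hg'P⟩ := hP (zpowers x) (zpowers_le.mpr (hPT hx)) g hg (by
    rw [conj_smul_le_iff]
    rintro _ ⟨k, rfl⟩
    simp only
    rw [← conj_zpow]
    exact zpow_mem hgx k)
  rw [← hg' x (mem_zpowers x)]
  exact hg'P x hx

theorem StableUnder.conj_shift_mem (hP : StableUnder (alternatingGroup _) T P) (hPT : P ≤ T)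
    (hT : IsNice T) {f : ZMod p ⊕ L → ZMod p} {g : Perm (((ZMod p ⊕ L) × ZMod p) ⊕ U)}
    (hx : shift f ∈ P) (hg : g ∈ alternatingGroup _)
    (hgn : g ∈ normalizer (shiftGroup p (ZMod p ⊕ L) U : Set _)) :
    g * shift f * g⁻¹ ∈ P :=
  hP.conj_mem hPT hx hg (hT.shiftGroup_le ⟨(mem_normalizer_iff.mp hgn _).mp (shift_mem f),
    conj_mem_alternatingGroup (hT.le_alternatingGroup (hPT hx)) g⟩)

variable [Subsingleton U]

/-- Commutators of y ∈ P with the shifts by δ i - δ l belong to P and are shifts, since T normalizes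
the shifts. If they are all trivial, then y is itself a shift. -/
theorem StableUnder.exists_shift_mem (hP : StableUnder (alternatingGroup _) T P) (hPT : P ≤ T)
    (hT : IsNice T) (h3 : ∀ i j : ZMod p ⊕ L, ∃ l, l ≠ i ∧ l ≠ j) (hne : P ≠ ⊥) :
    ∃ f ≠ 0, shift f ∈ P := by
  by_contra! hc
  refine hne ((eq_bot_iff_forall _).mpr fun y hy => ?_)
  have hcomm : y ∈ shiftGroup p (ZMod p ⊕ L) U := by
    refine mem_shiftGroup_of_commute h3 fun i l => ?_
    have he := hT.shift_sub_mem i l 1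
    have h1 : ⁅y, shift (Pi.single i 1 - Pi.single l 1)⁆ ∈ P := by
      have h2 := hP.conj_mem hPT (inv_mem hy) (hT.le_alternatingGroup he)
        (mul_mem (mul_mem he (inv_mem (hPT hy))) (inv_mem he))
      have h3 := mul_mem hy h2
      rwa [commutatorElement_def, mul_assoc, mul_assoc, ← mul_assoc (shift _)]
    have h2 : ⁅y, shift (Pi.single i 1 - Pi.single l 1)⁆ ∈ shiftGroup p (ZMod p ⊕ L) U := by
      have hyn := wreath_le_normalizer (hT.le_wreath (hPT hy))
      exact mul_mem ((mem_normalizer_iff.mp hyn _).mp (shift_mem _)) (inv_mem (shift_mem _))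
    obtain ⟨f, hf⟩ := h2
    rw [← hf] at h1
    have hf0 : f = 0 := by
      by_contra hf0
      exact hc f hf0 h1
    rw [hf0, shift_zero] at hf
    exact commutatorElement_eq_one_iff_commute.mp hf.symm
  obtain ⟨f, rfl⟩ := hcomm
  have hf0 : f = 0 := by
    by_contra hf0
    exact hc f hf0 hy
  rw [hf0, shift_zero]

/-- Transposing rows i and j and subtracting leaves a shift supported on these two rows; a row
permutation puts i in the plane and j outside it. All row permutations are even when p = 2. -/
theorem StableUnder.exists_shift_mem_of_ne {i j : ZMod p ⊕ L}
    (hP : StableUnder (alternatingGroup _) T P) (hPT : P ≤ T)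
    (hT : IsNice T) (h2 : p = 2) (l : L) {f : ZMod p ⊕ L → ZMod p} (hf : shift f ∈ P)
    (hij : f i ≠ f j) : ∃ f' : ZMod p ⊕ L → ZMod p, f' (Sum.inl 0) ≠ 0 ∧
      (∀ b ≠ 0, f' (Sum.inl b) = 0) ∧ shift f' ∈ P := by
  have h1 := hP.conj_shift_mem hPT hT hf (rowPerm_mem_of_two h2 (swap i j))
    (rowPerm_mem_normalizer _)
  rw [rowPerm_conj_shift] at h1
  have h3 := mul_mem h1 (inv_mem hf)
  rw [← shift_sub] at h3
  obtain ⟨σ, hσi, hσj⟩ := exists_perm_apply_eq (i := i) (j := j) (a := Sum.inl (0 : ZMod p))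
    (b := Sum.inr l) (fun h => hij (h ▸ rfl)) Sum.inl_ne_inr
  have h4 := hP.conj_shift_mem hPT hT h3 (rowPerm_mem_of_two h2 σ) (rowPerm_mem_normalizer _)
  rw [rowPerm_conj_shift] at h4
  refine ⟨_, ?_, fun b hb => ?_, h4⟩
  · have : σ.symm (Sum.inl 0) = i := by rw [symm_apply_eq, hσi]
    simp [this, sub_eq_zero, hij.symm]
  · have hi : σ.symm (Sum.inl b) ≠ i := by
      intro h
      rw [symm_apply_eq, hσi] at h
      exact hb (Sum.inl_injective h)
    have hj : σ.symm (Sum.inl b) ≠ j := by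
      intro h
      rw [symm_apply_eq, hσj] at h
      exact Sum.inl_ne_inr h
    simp [swap_apply_of_ne_of_ne hi hj]

/-- Row permutations are of no use when f is constant, that is, f = 1. The shear then changes the
shift by the plane translation (1, 1), and sends that translation to (0, 1), which is a shift of the
plane rows alone and so is not constant. -/
theorem StableUnder.exists_shift_mem_of_two (hP : StableUnder (alternatingGroup _) T P)
    (hPT : P ≤ T) (hT : IsNice T) (h2 : p = 2) (l : L) {f : ZMod p ⊕ L → ZMod p} (hf0 : f ≠ 0)
    (hf : shift f ∈ P) : ∃ f' : ZMod p ⊕ L → ZMod p, f' (Sum.inl 0) ≠ 0 ∧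
      (∀ b ≠ 0, f' (Sum.inl b) = 0) ∧ shift f' ∈ P := by
  by_cases hc : ∃ i j, f i ≠ f j
  · obtain ⟨i, j, hij⟩ := hc
    exact hP.exists_shift_mem_of_ne hPT hT h2 l hf hij
  push Not at hc
  have hf1 : f = fun _ => 1 := by
    funext i
    by_contra h
    have h0 : f i = 0 := eq_zero_of_ne_one h2 h
    exact hf0 (funext fun j => (hc j i).trans h0)
  have h11 : (1 + 1 : ZMod p) = 0 := one_add_one_eq_zero_of_two h2
  have hconj : (square shear : Perm (((ZMod p ⊕ L) × ZMod p) ⊕ U)) * shift f *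
      (square shear)⁻¹ = square (translate (1, 1)) * shift f := by
    rw [mul_inv_eq_iff_eq_mul, hf1]
    ext1 (⟨b | l, x⟩ | u)
    · simp only [Perm.mul_apply, shift_inl, square_inl_inl, shear_apply, translate_apply,
        Prod.mk_add_mk, Sum.inl.injEq, Prod.mk.injEq]
      constructor <;> ring
    · simp
    · simp
  have h3 : square (translate (1, 1)) ∈ P := by
    have := hP.conj_mem hPT hf square_shear_mem (by
      rw [hconj]
      exact mul_mem (hT.planeGroup_le (translate_mem _)) (hPT hf))
    rw [hconj] at this
    simpa using mul_mem this (inv_mem hf)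
  have h4 : shift (Sum.elim (fun _ => 1) 0) ∈ P := by
    have h5 : (square shear : Perm (((ZMod p ⊕ L) × ZMod p) ⊕ U)) * square (translate (1, 1)) *
      (square shear)⁻¹ = square (translate (0, 1)) := by
      rw [← map_mul, ← map_inv, ← map_mul, conj_translate_mem shear_add]
      congr 2
      simp [shear_apply, h11]
    have h6 := hP.conj_mem hPT h3 square_shear_mem (by
      rw [h5]
      exact hT.planeGroup_le (translate_mem _))
    rw [h5] at h6
    convert h6
    ext1 (⟨b | l, x⟩ | u) <;> simp
  exact hP.exists_shift_mem_of_ne hPT hT h2 l (i := Sum.inl 0) (j := Sum.inr l) h4 (by simp)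

/-- Subtracting from f its image under a sign change on two rows doubles f there and kills it
elsewhere. Using the pairs i, j and i, l leaves 4 f(i) on row i, which an even row permutation moves
into the plane. -/
theorem StableUnder.exists_shift_mem_of_odd (hP : StableUnder (alternatingGroup _) T P)
    (hPT : P ≤ T) (hT : IsNice T) (h2 : p ≠ 2) (h3 : ∀ i j : ZMod p ⊕ L, ∃ l, l ≠ i ∧ l ≠ j)
    {f : ZMod p ⊕ L → ZMod p} (hf0 : f ≠ 0)
    (hf : shift f ∈ P) : ∃ f' : ZMod p ⊕ L → ZMod p, f' (Sum.inl 0) ≠ 0 ∧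
      (∀ b ≠ 0, f' (Sum.inl b) = 0) ∧ shift f' ∈ P := by
  obtain ⟨i, hi⟩ := Function.ne_iff.mp hf0
  obtain ⟨j, hj, -⟩ := h3 i i
  obtain ⟨l, hli, hlj⟩ := h3 i j
  have step : ∀ {f : ZMod p ⊕ L → ZMod p} (i j), shift f ∈ P →
      shift (fun l => f l - ((Pi.mulSingle i (-1) * Pi.mulSingle j (-1) :
        ZMod p ⊕ L → (ZMod p)ˣ) l : ZMod p) * f l) ∈ P := by
    intro f i j hf
    have h1 := hP.conj_shift_mem hPT hT hf (dilate_neg_one_mem i j) (dilate_mem_normalizer _)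
    rw [dilate_conj_shift] at h1
    have := mul_mem hf (inv_mem h1)
    rwa [← shift_sub] at this
  have h4 := step i l (step i j hf)
  have h5 : (fun l_1 => f l_1 - ((Pi.mulSingle i (-1) * Pi.mulSingle j (-1) :
        ZMod p ⊕ L → (ZMod p)ˣ) l_1 : ZMod p) * f l_1 -
      ((Pi.mulSingle i (-1) * Pi.mulSingle l (-1) :
        ZMod p ⊕ L → (ZMod p)ˣ) l_1 : ZMod p) * (f l_1 - ((Pi.mulSingle i (-1) *
        Pi.mulSingle j (-1) : ZMod p ⊕ L → (ZMod p)ˣ) l_1 : ZMod p) * f l_1)) =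
      Pi.single i (4 * f i) := by
    funext m
    by_cases hmi : m = i
    · subst hmi
      simp [Pi.mulSingle_eq_of_ne hj.symm, Pi.mulSingle_eq_of_ne hli.symm]
      ring
    · by_cases hmj : m = j
      · subst hmj
        simp [Pi.mulSingle_eq_of_ne hmi, Pi.mulSingle_eq_of_ne hlj.symm, hmi]
      · simp [Pi.mulSingle_eq_of_ne hmi, Pi.mulSingle_eq_of_ne hmj, hmi]
  rw [h5] at h4
  -- If the transposition is odd, a second one of two other rows corrects the sign.
  have hσ : ∃ σ : Perm (ZMod p ⊕ L), σ i = Sum.inl 0 ∧ Perm.sign σ = 1 := by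
    rcases Int.units_eq_one_or (Perm.sign (swap i (Sum.inl 0 : ZMod p ⊕ L))) with h | h
    · exact ⟨_, swap_apply_left _ _, h⟩
    · obtain ⟨a, ha, -⟩ := h3 (Sum.inl 0) (Sum.inl 0)
      obtain ⟨b, hb, hba⟩ := h3 (Sum.inl 0) a
      refine ⟨swap a b * swap i (Sum.inl 0), ?_, ?_⟩
      · rw [Perm.mul_apply, swap_apply_left, swap_apply_of_ne_of_ne ha.symm hb.symm]
      · rw [map_mul, h, Perm.sign_swap hba.symm]
        decide
  obtain ⟨σ, hσi, hσ⟩ := hσ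
  have h6 := hP.conj_shift_mem hPT hT h4 (rowPerm_mem_of_even hσ) (rowPerm_mem_normalizer _)
  rw [rowPerm_conj_shift] at h6
  have h40 : (4 : ZMod p) ≠ 0 := by
    intro h
    have h7 : ((2 * 2 : ℕ) : ZMod p) = 0 := by
      rw [← h]
      norm_num
    rw [ZMod.natCast_eq_zero_iff, (Fact.out : p.Prime).dvd_mul, or_self,
      Nat.prime_dvd_prime_iff_eq Fact.out Nat.prime_two] at h7
    exact h2 h7
  refine ⟨_, ?_, fun b hb => ?_, h6⟩
  · have : σ.symm (Sum.inl 0) = i := by rw [symm_apply_eq, hσi]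
    simp only [Function.comp_apply, this, Pi.single_eq_same]
    exact mul_ne_zero h40 hi
  · have hi : σ.symm (Sum.inl b) ≠ i := by
      intro h
      rw [symm_apply_eq, hσi] at h
      exact hb (Sum.inl_injective h)
    simp [hi]

/-- A nontrivial subgroup of `T` cannot be normal in the fusion system. -/
theorem StableUnder.eq_bot (hP : StableUnder (alternatingGroup _) T P)
    (hPT : P ≤ T) (hT : IsNice T) (h3 : ∀ i j : ZMod p ⊕ L, ∃ l, l ≠ i ∧ l ≠ j)
    (hL : p = 2 → Nonempty L) : P = ⊥ := by
  by_contra hne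
  obtain ⟨f, hf0, hf⟩ := hP.exists_shift_mem hPT hT h3 hne
  have key : ∃ f' : ZMod p ⊕ L → ZMod p, f' (Sum.inl 0) ≠ 0 ∧
      (∀ b ≠ 0, f' (Sum.inl b) = 0) ∧ shift f' ∈ P := by
    by_cases h2 : p = 2
    · obtain ⟨l⟩ := hL h2
      exact hP.exists_shift_mem_of_two hPT hT h2 l hf0 hf
    · exact hP.exists_shift_mem_of_odd hPT hT h2 h3 hf0 hf
  clear! f
  obtain ⟨f, hf0, hfb, hf⟩ := key
  obtain ⟨g, hgA, hg, hgP⟩ := hP (planeGroup p L U) hT.planeGroup_le (square shear)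
    square_shear_mem (by
      rw [conj_smul_eq_self_iff.mpr (square_mem_normalizer shear_add)]
      exact hT.planeGroup_le)
  -- Since g acts on the translations as the shear does, it acts on the plane as the shear after a
  -- translation by some v.
  obtain ⟨v, hv⟩ := exists_translate_of_commute (z := (square shear)⁻¹ * g) fun w => by
    have h1 := hg _ (translate_mem w)
    have h2 := congrArg (fun y => (square shear)⁻¹ * y * g) h1
    simpa [Commute, SemiconjBy, mul_assoc] using h2
  have hgv : ∀ b x, g (Sum.inl (Sum.inl b, x)) =
      Sum.inl (Sum.inl (shear (b + v.1, x + v.2)).1, (shear (b + v.1, x + v.2)).2) := by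
    intro b x
    rw [← square_inl_inl, ← hv b x]
    simp
  obtain ⟨f', σ, hf'⟩ := hT.le_wreath (hPT (hgP _ hf))
  have hf'' : g * shift f = shift f' * rowPerm σ * g := by
    rw [← hf']
    group
  -- The points (0, 1) and (1, 0) have the same coordinate sum, so g sends them to a common row. The
  -- shift fixes the second and moves the first by f(0). Its conjugate lies in the wreath product,
  -- so it keeps their images in a common row, which forces f(0) = 0.
  have h1 := DFunLike.congr_fun hf'' (Sum.inl (Sum.inl 0, 1))
  have h2 := DFunLike.congr_fun hf'' (Sum.inl (Sum.inl 1, 0))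
  simp only [Perm.mul_apply, shift_inl, hgv, shear_apply, rowPerm_inl, hfb 1 one_ne_zero,
    Sum.inl.injEq, Prod.mk.injEq] at h1 h2
  have h3 : (0 + v.1 + (1 + v.2) : ZMod p) = 1 + v.1 + (0 + v.2) := by ring
  rw [h3] at h1
  have h4 := Sum.inl_injective (h1.1.trans (h2.1.symm))
  apply hf0
  linear_combination h4

end Nice

end WreathPerm

/-! ### The normalizer of the Sylow subgroup, and the case p = 2 -/

namespace WreathPerm

open Equiv Subgroup FusionSystem
open scoped commutatorElement

section Decomposition

variable {p : ℕ} [Fact p.Prime] {L U : Type*} [Fintype L] [DecidableEq L] [Fintype U]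
  [DecidableEq U] {T : Subgroup (Perm (((ZMod p ⊕ L) × ZMod p) ⊕ U))}

theorem apply_inr_of_mem_wreath {K : Type*} {t : Perm ((K × ZMod p) ⊕ U)}
    (ht : t ∈ wreath p K U) (u : U) : t (Sum.inr u) = Sum.inr u := by
  obtain ⟨f, σ, rfl⟩ := ht
  rfl

theorem apply_inl_of_mem_wreath {K : Type*} {t : Perm ((K × ZMod p) ⊕ U)}
    (ht : t ∈ wreath p K U) {i : K} {x : ZMod p} (h : t (Sum.inl (i, x)) = Sum.inl (i, x))
    (y : ZMod p) : t (Sum.inl (i, y)) = Sum.inl (i, y) := by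
  obtain ⟨f, σ, rfl⟩ := ht
  simp only [Perm.mul_apply, rowPerm_inl, shift_inl, Sum.inl.injEq, Prod.mk.injEq,
    add_eq_left] at h ⊢
  exact h

theorem IsNice.exists_mem (hT : IsNice T) (h3 : ∀ i j : ZMod p ⊕ L, ∃ l, l ≠ i ∧ l ≠ j)
    {i j : ZMod p ⊕ L} (hij : i ≠ j) : ∃ t ∈ T, (∀ x, t (Sum.inl (i, x)) = Sum.inl (i, x + 1)) ∧
      ∀ x, t (Sum.inl (j, x)) = Sum.inl (j, x) := by
  obtain ⟨l, hli, hlj⟩ := h3 i j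
  exact ⟨_, hT.shift_sub_mem i l 1, fun x => by simp [hli.symm],
    fun x => by simp [hij.symm, hlj.symm]⟩

theorem shiftGroup_normalizer_le {K : Type*} [Fintype K] [DecidableEq K] :
    normalizer (shiftGroup p K U : Set (Perm ((K × ZMod p) ⊕ U))) ≤
      normalizer ((shiftGroup p K U ⊓ alternatingGroup _ : Subgroup _) : Set _) := by
  intro g hg
  rw [← conj_smul_eq_self_iff, smul_inf, conj_smul_eq_self_iff.mpr hg,
    Normal.conj_smul_eq_self]

variable [Subsingleton U]

/-- The normalizer of `T` consists of monomial affine maps of the rows. -/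
theorem IsNice.exists_eq_of_conj_le (hT : IsNice T)
    (h3 : ∀ i j : ZMod p ⊕ L, ∃ l, l ≠ i ∧ l ≠ j)
    {g : Perm (((ZMod p ⊕ L) × ZMod p) ⊕ U)} (hg : MulAut.conj g • T ≤ T) :
    ∃ f σ u, g = shift f * rowPerm σ * dilate u := by
  have hgT : ∀ t ∈ T, g * t * g⁻¹ ∈ T := conj_smul_le_iff.mp hg
  have hgT' : ∀ t ∈ T, g⁻¹ * t * g ∈ T := by
    intro t ht
    rw [← eq_of_le_of_card_ge hg (card_conj_smul g T).ge] at ht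
    exact mem_conj_smul.mp ht
  have hrow : ∀ i x, ∃ j y, g (Sum.inl (i, x)) = Sum.inl (j, y) := by
    intro i x
    rcases hq : g (Sum.inl (i, x)) with ⟨j, y⟩ | u
    · exact ⟨j, y, rfl⟩
    · obtain ⟨l, hli, -⟩ := h3 i i
      obtain ⟨t, ht, hti, -⟩ := hT.exists_mem h3 hli.symm
      have h1 := apply_inr_of_mem_wreath (hT.le_wreath (hgT t ht)) u
      rw [← hq] at h1
      simp [hti] at h1
  choose ρ γ hργ using hrow
  -- An element of the wreath product fixing one point of a row fixes the row. Applied to the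
  -- conjugate of some t that moves row i and fixes row j, this keeps the images of the two rows
  -- apart; the next claim uses g⁻¹ in the same way.
  have hρ1 : ∀ i x j y, ρ i x = ρ j y → i = j := by
    intro i x j y h
    by_contra hij
    obtain ⟨t, ht, hti, htj⟩ := hT.exists_mem h3 hij
    have h1 : (g * t * g⁻¹) (Sum.inl (ρ j y, γ j y)) = Sum.inl (ρ j y, γ j y) := by
      rw [← hργ]
      simp [htj]
    have h2 := apply_inl_of_mem_wreath (hT.le_wreath (hgT t ht)) h1 (γ i x)
    rw [← h, ← hργ] at h2
    simp [hti] at h2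
  have hρ2 : ∀ i x y, ρ i x = ρ i y := by
    intro i x y
    by_contra hne
    obtain ⟨t, ht, hti, htj⟩ := hT.exists_mem h3 hne
    have h1 : (g⁻¹ * t * g) (Sum.inl (i, y)) = Sum.inl (i, y) := by
      rw [Perm.mul_apply, Perm.mul_apply, hργ, htj, ← hργ, Perm.inv_eq_iff_eq]
    have h2 := apply_inl_of_mem_wreath (hT.le_wreath (hgT' t ht)) h1 x
    rw [Perm.mul_apply, Perm.mul_apply, hργ, hti, Perm.inv_eq_iff_eq, hργ] at h2
    simp at h2
  have hinj : Function.Injective fun i => ρ i 0 := fun i j h => hρ1 i 0 j 0 h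
  obtain ⟨σ, hσ⟩ : ∃ σ : Perm (ZMod p ⊕ L), ∀ i, σ i = ρ i 0 :=
    ⟨Equiv.ofBijective _ (Finite.injective_iff_bijective.mp hinj), fun i => rfl⟩
  have hgσ : ∀ i x, g (Sum.inl (i, x)) = Sum.inl (σ i, γ i x) := by
    intro i x
    rw [hργ, hσ, hρ2 i x 0]
  -- The conjugate by g of a unit shift of row i lies in the wreath product, so it moves row σ i by
  -- a constant.
  have haff : ∀ i, ∃ c, ∀ x, γ i (x + 1) = γ i x + c := by
    intro i
    obtain ⟨l, hli, -⟩ := h3 i i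
    obtain ⟨t, ht, hti, -⟩ := hT.exists_mem h3 hli.symm
    obtain ⟨f, τ, hfτ⟩ := hT.le_wreath (hgT t ht)
    refine ⟨f (σ i), fun x => ?_⟩
    have h1 : (g * t * g⁻¹) (Sum.inl (σ i, γ i x)) = Sum.inl (σ i, γ i (x + 1)) := by
      rw [← hgσ, ← hgσ]
      simp [hti]
    rw [hfτ] at h1
    simp only [Perm.mul_apply, rowPerm_inl, shift_inl, Sum.inl.injEq, Prod.mk.injEq] at h1
    rw [← h1.2, h1.1]
  choose c hc using haff
  have hc0 : ∀ i, c i ≠ 0 := by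
    intro i h
    have h1 := hc i 0
    rw [h, add_zero, zero_add] at h1
    have h2 : g (Sum.inl (i, 1)) = g (Sum.inl (i, 0)) := by rw [hgσ, hgσ, h1]
    have h3 := g.injective h2
    simp at h3
  refine ⟨fun j => γ (σ.symm j) 0, σ, fun i => Units.mk0 (c i) (hc0 i), ?_⟩
  ext1 (⟨i, x⟩ | u)
  · rw [hgσ, eq_add_mul_of_forall (hc i) x]
    simp only [Perm.mul_apply, dilate_inl, rowPerm_inl, shift_inl, Units.val_mk0,
      symm_apply_apply, Sum.inl.injEq, Prod.mk.injEq, true_and]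
    ring
  · rcases hq : g (Sum.inr u) with ⟨j, y⟩ | u'
    · obtain ⟨l, hlj, -⟩ := h3 j j
      obtain ⟨t, ht, htj, -⟩ := hT.exists_mem h3 hlj.symm
      have h1 := apply_inr_of_mem_wreath (hT.le_wreath (hgT' t ht)) u
      rw [Perm.mul_apply, Perm.mul_apply, hq, htj, Perm.inv_eq_iff_eq, hq] at h1
      simp at h1
    · rw [Subsingleton.elim u' u]
      rfl

theorem centralizer_shiftGroup_le (h3 : ∀ i j : ZMod p ⊕ L, ∃ l, l ≠ i ∧ l ≠ j) :
    alternatingGroup _ ⊓ centralizer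
      ((shiftGroup p (ZMod p ⊕ L) U ⊓ alternatingGroup _ : Subgroup _) : Set _) ≤
        shiftGroup p (ZMod p ⊕ L) U ⊓ alternatingGroup _ := by
  rintro z ⟨hzA, hz⟩
  refine ⟨mem_shiftGroup_of_commute h3 fun i l => ?_, hzA⟩
  exact (mem_centralizer_iff.mp hz _ ⟨shift_mem _, shift_single_sub_mem i l 1⟩).symm

end Decomposition

section Good

variable {p : ℕ} {Γ : Type*} [Group Γ] {A T : Subgroup Γ} {R : Subgroup Γ → Γ → Prop}

/-- The elements of `A` normalizing `P` and related to `P` by `R`. -/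
def good (hR : ConjClosed p A T R) (P : Subgroup Γ) (hP : P ≤ T) : Subgroup Γ where
  carrier := {g | g ∈ A ∧ g ∈ normalizer (P : Set Γ) ∧ R P g}
  one_mem' := ⟨one_mem _, one_mem _, hR.of_mem hP (one_mem _)⟩
  mul_mem' := by
    rintro g h ⟨hgA, hgn, hg⟩ ⟨hhA, hhn, hh⟩
    refine ⟨mul_mem hgA hhA, mul_mem hgn hhn, hR.mul hh ?_⟩
    rwa [conj_smul_eq_self_iff.mpr hhn]
  inv_mem' := by
    rintro g ⟨hgA, hgn, hg⟩
    refine ⟨inv_mem hgA, inv_mem hgn, ?_⟩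
    have := hR.inv hg
    rwa [conj_smul_eq_self_iff.mpr hgn] at this

theorem mem_good_of_pow_eq_one (hR : ConjClosed p A T R) {P : Subgroup Γ} (hP : P ≤ T) {g : Γ}
    (hgA : g ∈ A) (hgn : g ∈ normalizer (P : Set Γ)) (hg : g ^ p = 1) : g ∈ good hR P hP :=
  ⟨hgA, hgn, hR.of_pow_eq_one (k := 1) hP hgA hgn (by rwa [pow_one])⟩

end Good

section Even

variable {p : ℕ} [Fact p.Prime] {L U : Type*} [Fintype L] [DecidableEq L] [Fintype U]
  [DecidableEq U] {T : Subgroup (Perm (((ZMod p ⊕ L) × ZMod p) ⊕ U))}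
  {R : Subgroup (Perm (((ZMod p ⊕ L) × ZMod p) ⊕ U)) →
    Perm (((ZMod p ⊕ L) × ZMod p) ⊕ U) → Prop}

theorem mem_good_shift (hR : ConjClosed p (alternatingGroup _) T R) (hT : IsNice T)
    {f : ZMod p ⊕ L → ZMod p} (hf : shift f ∈ alternatingGroup (((ZMod p ⊕ L) × ZMod p) ⊕ U)) :
    shift f ∈ good hR _ hT.shiftGroup_le :=
  mem_good_of_pow_eq_one hR _ hf (shiftGroup_normalizer_le (le_normalizer (shift_mem f)))
    (shift_pow_self f)

/-- There are no nontrivial dilations modulo 2, and row transpositions are even 2-elements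
generating all row permutations. -/
theorem related_of_two (hR : ConjClosed p (alternatingGroup _) T R) (hT : IsNice T)
    (h2 : p = 2) {f : ZMod p ⊕ L → ZMod p} {σ : Perm (ZMod p ⊕ L)} {u : ZMod p ⊕ L → (ZMod p)ˣ}
    (hg : shift f * rowPerm σ * dilate u ∈ alternatingGroup (((ZMod p ⊕ L) × ZMod p) ⊕ U)) :
    shift f * rowPerm σ * dilate u ∈ good hR _ hT.shiftGroup_le := by
  have hu : u = 1 := by
    funext i
    subst h2
    exact Subsingleton.elim _ _
  rw [hu, map_one, mul_one] at hg ⊢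
  have hσA := rowPerm_mem_of_two (U := U) h2 σ
  refine mul_mem (mem_good_shift hR hT ((mul_mem_cancel_right hσA).mp hg)) ?_
  have : σ ∈ (good hR _ hT.shiftGroup_le).comap rowPerm := by
    refine (closure_le _).mpr ?_ ((Perm.closure_isSwap (α := ZMod p ⊕ L)).ge (mem_top σ))
    rintro _ ⟨x, y, -, rfl⟩
    refine mem_good_of_pow_eq_one hR hT.shiftGroup_le (rowPerm_mem_of_two h2 _)
      (shiftGroup_normalizer_le (rowPerm_mem_normalizer _)) ?_
    have hs : (rowPerm (swap x y) : Perm (((ZMod p ⊕ L) × ZMod p) ⊕ U)) ^ 2 = 1 := by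
      rw [← map_pow, sq, swap_mul_self, map_one]
    obtain ⟨k, hk⟩ : 2 ∣ p := dvd_of_eq h2.symm
    rw [congrArg (rowPerm (swap x y) ^ ·) hk, pow_mul, hs, one_pow]
  exact this

end Even

end WreathPerm

/-! ### The normalizer of the Sylow subgroup for odd p -/

namespace WreathPerm

open Equiv Subgroup FusionSystem
open scoped commutatorElement

section Odd

variable {p : ℕ} [Fact p.Prime] {L U : Type*} [Fintype L] [DecidableEq L] [Fintype U]
  [DecidableEq U] {T : Subgroup (Perm (((ZMod p ⊕ L) × ZMod p) ⊕ U))}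
  {R : Subgroup (Perm (((ZMod p ⊕ L) × ZMod p) ⊕ U)) →
    Perm (((ZMod p ⊕ L) × ZMod p) ⊕ U) → Prop}

theorem mem_good_of_odd (hR : ConjClosed p (alternatingGroup _) T R) (hT : IsNice T)
    (hp : Odd p) {g : Perm (((ZMod p ⊕ L) × ZMod p) ⊕ U)}
    (hgn : g ∈ normalizer (shiftGroup p (ZMod p ⊕ L) U : Set _)) (hg : g ^ p = 1) :
    g ∈ good hR _ hT.shiftGroup_le :=
  mem_good_of_pow_eq_one hR _ (mem_alternatingGroup_of_pow_eq_one hp hg)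
    (shiftGroup_normalizer_le hgn) hg

/-- The commutator is g times a conjugate of g⁻¹, both of order dividing p. Nothing is required of
the parity or order of h. -/
theorem commutator_mem_good (hR : ConjClosed p (alternatingGroup _) T R) (hT : IsNice T)
    (hp : Odd p) {g h : Perm (((ZMod p ⊕ L) × ZMod p) ⊕ U)}
    (hgn : g ∈ normalizer (shiftGroup p (ZMod p ⊕ L) U : Set _))
    (hhn : h ∈ normalizer (shiftGroup p (ZMod p ⊕ L) U : Set _)) (hg : g ^ p = 1) :
    ⁅g, h⁆ ∈ good hR _ hT.shiftGroup_le := by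
  rw [commutatorElement_def, mul_assoc, mul_assoc, ← mul_assoc h]
  refine mul_mem (mem_good_of_odd hR hT hp hgn hg) (mem_good_of_odd hR hT hp
    (mul_mem (mul_mem hhn (inv_mem hgn)) (inv_mem hhn)) ?_)
  rw [conj_pow, inv_pow, hg, inv_one, mul_one, mul_inv_cancel]

variable (p L) in
/-- The cyclic permutation of the first `p` rows. -/
def rotate : Perm (ZMod p ⊕ L) := Perm.sumCongr (Equiv.addRight 1) 1

@[simp]
theorem rotate_inl (b : ZMod p) : rotate p L (Sum.inl b) = Sum.inl (b + 1) := rfl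

theorem rotate_pow_self : rotate p L ^ p = 1 := by
  have h : ∀ n : ℕ, rotate p L ^ n = Perm.sumCongr (Equiv.addRight (n : ZMod p)) 1 := by
    intro n
    induction n with
    | zero => ext1 (b | l) <;> simp
    | succ n ih =>
      rw [pow_succ, ih]
      ext1 (b | l)
      · simp only [Perm.mul_apply, rotate_inl, Perm.sumCongr_apply, Sum.map_inl, coe_addRight]
        push_cast
        congr 1
        ring
      · rfl
  rw [h]
  ext1 (b | l) <;> simp

/-- Three-cycles generate the alternating group, and each is a commutator of a p-cycle with a
transposition. The three points 0, 1, 2 are distinct because p is odd. -/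
theorem rowPerm_mem_good (hR : ConjClosed p (alternatingGroup _) T R) (hT : IsNice T)
    (hp : Odd p) {σ : Perm (ZMod p ⊕ L)} (hσ : σ ∈ alternatingGroup (ZMod p ⊕ L)) :
    rowPerm σ ∈ good hR _ hT.shiftGroup_le := by
  have h01 : (0 : ZMod p) ≠ 1 := zero_ne_one
  have h12 : (1 : ZMod p) ≠ 1 + 1 := by simp
  have h02 : (1 + 1 : ZMod p) ≠ 0 := by
    have := ZMod.ringChar_zmod_n p
    have h : (2 : ZMod p) ≠ 0 := Ring.two_ne_zero (by
      rw [this]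
      rintro rfl
      exact absurd hp (by decide))
    rwa [one_add_one_eq_two]
  set s : Perm (ZMod p ⊕ L) := swap (Sum.inl 0) (Sum.inl 1) with hs
  have h3 : ⁅rotate p L, s⁆.IsThreeCycle := by
    have : ⁅rotate p L, s⁆ = swap (Sum.inl 1) (Sum.inl (1 + 1)) * swap (Sum.inl 1) (Sum.inl 0) := by
      rw [commutatorElement_def, hs, ← swap_apply_apply, rotate_inl, rotate_inl, swap_inv, zero_add,
        swap_comm (Sum.inl 1) (Sum.inl 0)]
    rw [this]
    refine Perm.isThreeCycle_swap_mul_swap_same ?_ ?_ ?_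
    · simp
    · exact fun h => h01.symm (Sum.inl_injective h)
    · exact fun h => h02 (Sum.inl_injective h)
  have : σ ∈ (good hR _ hT.shiftGroup_le).comap rowPerm := by
    refine (closure_le _).mpr ?_
      ((Perm.closure_three_cycles_eq_alternating (α := ZMod p ⊕ L)).ge hσ)
    intro τ hτ
    obtain ⟨θ, rfl⟩ := isConj_iff.mp (Perm.isConj_iff_cycleType_eq.mpr (h3.trans hτ.symm))
    rw [conjugate_commutatorElement]
    refine mem_comap.mpr ?_
    rw [map_commutatorElement]
    refine commutator_mem_good hR hT hp (rowPerm_mem_normalizer _) (rowPerm_mem_normalizer _) ?_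
    rw [← map_pow, conj_pow, rotate_pow_self, mul_one, mul_inv_cancel, map_one]
  exact this

/-- This dilation is the commutator of a p-cycle taking row j to row i with the dilation of row j by
c. -/
theorem dilate_single_mem_good (hR : ConjClosed p (alternatingGroup _) T R) (hT : IsNice T)
    (hp : Odd p) (i j : ZMod p ⊕ L) (c : (ZMod p)ˣ) :
    dilate (Pi.mulSingle i c * (Pi.mulSingle j c)⁻¹) ∈ good hR _ hT.shiftGroup_le := by
  by_cases hij : i = j
  · rw [hij, mul_inv_cancel, map_one]
    exact one_mem _
  · obtain ⟨θ, h0, h1⟩ := exists_perm_apply_eq (i := (Sum.inl 0 : ZMod p ⊕ L)) (j := Sum.inl 1)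
      (by simp) (Ne.symm hij)
    have h2 : (θ * rotate p L * θ⁻¹) j = i := by
      rw [← h0, ← h1]
      simp
    have h3 : ⁅(rowPerm (θ * rotate p L * θ⁻¹) : Perm (((ZMod p ⊕ L) × ZMod p) ⊕ U)),
        (dilate (Pi.mulSingle j c) : Perm (((ZMod p ⊕ L) × ZMod p) ⊕ U))⁆ =
          dilate (Pi.mulSingle i c * (Pi.mulSingle j c)⁻¹) := by
      rw [commutatorElement_def, rowPerm_conj_dilate, map_mul, map_inv]
      congr 2
      funext l
      simp only [Function.comp_apply, Pi.mulSingle_apply]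
      congr 1
      rw [eq_iff_iff, symm_apply_eq, h2]
    rw [← h3]
    refine commutator_mem_good hR hT hp (rowPerm_mem_normalizer _) (dilate_mem_normalizer _) ?_
    rw [← map_pow, conj_pow, rotate_pow_self, mul_one, mul_inv_cancel, map_one]

theorem dilate_mem_good (hR : ConjClosed p (alternatingGroup _) T R) (hT : IsNice T)
    (hp : Odd p) {w : ZMod p ⊕ L → (ZMod p)ˣ} (hw : ∏ i, w i = 1) :
    dilate w ∈ good hR _ hT.shiftGroup_le := by
  have h1 : ∏ i, (Pi.mulSingle (Sum.inl 0) (w i) : ZMod p ⊕ L → (ZMod p)ˣ) = 1 := by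
    have := map_prod (MonoidHom.mulSingle (fun _ : ZMod p ⊕ L => (ZMod p)ˣ) (Sum.inl 0)) w
      Finset.univ
    rw [hw, map_one] at this
    exact this.symm
  have h2 : w = ∏ i, (Pi.mulSingle i (w i) * (Pi.mulSingle (Sum.inl 0) (w i))⁻¹) := by
    rw [Finset.prod_mul_distrib, Finset.prod_inv_distrib, h1, inv_one, mul_one,
      Finset.univ_prod_mulSingle]
  have h3 : w ∈ (good hR _ hT.shiftGroup_le).comap dilate := by
    rw [h2]
    exact prod_mem fun i _ => dilate_single_mem_good hR hT hp _ _ _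
  exact h3

end Odd

section SquareShift

variable {p : ℕ} {L U : Type*}

variable (p L U) in
/-- The shifts of the rows that do not belong to the plane. -/
def restGroup : Subgroup (Perm (((ZMod p ⊕ L) × ZMod p) ⊕ U)) where
  carrier := Set.range fun f : L → ZMod p => shift (Sum.elim 0 f)
  one_mem' := ⟨0, by
    rw [← shift_zero]
    exact congrArg shift (by ext (b | l) <;> rfl)⟩
  mul_mem' := by
    rintro _ _ ⟨f, rfl⟩ ⟨g, rfl⟩
    refine ⟨f + g, ?_⟩
    simp only [← shift_add]
    congr 1
    ext (b | l) <;> simp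
  inv_mem' := by
    rintro _ ⟨f, rfl⟩
    refine ⟨-f, ?_⟩
    simp only [← shift_neg]
    congr 1
    ext (b | l) <;> simp

theorem square_mem_centralizer_restGroup (m : Perm (ZMod p × ZMod p)) :
    square m ∈ centralizer (restGroup p L U : Set (Perm (((ZMod p ⊕ L) × ZMod p) ⊕ U))) := by
  rw [mem_centralizer_iff]
  rintro _ ⟨f, rfl⟩
  ext1 (⟨b | l, x⟩ | u) <;> simp

theorem square_mem_normalizer_sup {m : Perm (ZMod p × ZMod p)}
    (hm : ∀ v w, m (v + w) = m v + m w) :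
    square m ∈ normalizer ((planeGroup p L U ⊔ restGroup p L U : Subgroup _) :
      Set (Perm (((ZMod p ⊕ L) × ZMod p) ⊕ U))) :=
  normalizer_inf_normalizer_le_normalizer_sup _ _ ⟨square_mem_normalizer hm,
    centralizer_le_normalizer _ (square_mem_centralizer_restGroup m)⟩

/-- The translations act regularly on the plane, so only translations commute with them there; the
shifts of single rows outside the plane confine z to a shift of each such row. -/
theorem centralizer_sup_le [Fact p.Prime] [DecidableEq L] [Subsingleton U] :
    centralizer ((planeGroup p L U ⊔ restGroup p L U : Subgroup _) :
      Set (Perm (((ZMod p ⊕ L) × ZMod p) ⊕ U))) ≤ planeGroup p L U ⊔ restGroup p L U := by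
  intro z hz
  have hz1 : ∀ v, Commute z (square (translate v)) := fun v =>
    (mem_centralizer_iff.mp hz _ (mem_sup_left (translate_mem v))).symm
  have hz1' : ∀ v q, z (square (translate v) q) = square (translate v) (z q) :=
    fun v q => DFunLike.congr_fun (hz1 v) q
  have hz2 : ∀ f q, z (shift (Sum.elim 0 f) q) = shift (Sum.elim 0 f) (z q) := fun f q =>
    (DFunLike.congr_fun (mem_centralizer_iff.mp hz _ (mem_sup_right ⟨f, rfl⟩)) q).symm
  obtain ⟨v, hv⟩ := exists_translate_of_commute hz1
  have hrow : ∀ l x, ∃ y, z (Sum.inl (Sum.inr l, x)) = Sum.inl (Sum.inr l, y) := by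
    intro l x
    have h1 := hz2 (Pi.single l 1) (Sum.inl (Sum.inr l, x))
    have h2 : z (shift (Sum.elim 0 (Pi.single l 1)) (Sum.inl (Sum.inr l, x))) ≠
        z (Sum.inl (Sum.inr l, x)) := by
      simp
    rw [h1] at h2
    rcases hq : z (Sum.inl (Sum.inr l, x)) with ⟨b | l', y⟩ | u
    · simp [hq] at h2
    · by_cases hl : l' = l
      · exact ⟨y, by rw [hl]⟩
      · simp [hq, hl] at h2
    · simp [hq] at h2
  choose γ hγ using hrow
  have haff : ∀ l x, γ l (x + 1) = γ l x + 1 := by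
    intro l x
    have := hz2 (Pi.single l 1) (Sum.inl (Sum.inr l, x))
    simpa [hγ] using this
  have heq : z = square (translate v) * shift (Sum.elim 0 fun l => γ l 0) := by
    ext1 (⟨b | l, x⟩ | u)
    · simp [hv]
    · rw [hγ, eq_add_mul_of_forall (haff l) x]
      simp [add_comm]
    · rcases hq : z (Sum.inr u) with ⟨b | l, y⟩ | u'
      · have := hz1' (1, 0) (Sum.inr u)
        simp [hq] at this
      · have := hz2 (Pi.single l 1) (Sum.inr u)
        simp [hq] at this
      · rw [Subsingleton.elim u' u]
        simp
  rw [heq]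
  exact mul_mem (mem_sup_left (translate_mem v)) (mem_sup_right ⟨_, rfl⟩)

end SquareShift

section Torus

variable {p : ℕ} [Fact p.Prime] {L U : Type*} [Fintype L] [DecidableEq L] [Fintype U]
  [DecidableEq U] {T : Subgroup (Perm (((ZMod p ⊕ L) × ZMod p) ⊕ U))}
  {R : Subgroup (Perm (((ZMod p ⊕ L) × ZMod p) ⊕ U)) →
    Perm (((ZMod p ⊕ L) × ZMod p) ⊕ U) → Prop}

theorem restGroup_le_of_odd (hT : IsNice T) (hp : Odd p) : restGroup p L U ≤ T := by
  rintro _ ⟨f, rfl⟩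
  exact hT.shiftGroup_le ⟨shift_mem _, mem_alternatingGroup_of_pow_eq_one hp (shift_pow_self _)⟩

theorem transvection₁_mem_good (hR : ConjClosed p (alternatingGroup _) T R)
    (hP : planeGroup p L U ⊔ restGroup p L U ≤ T) (hp : Odd p) (t : ZMod p) :
    square (transvection₁ t) ∈ good hR _ hP := by
  have h : (square (transvection₁ t) : Perm (((ZMod p ⊕ L) × ZMod p) ⊕ U)) ^ p = 1 := by
    rw [← map_pow, transvection₁_pow_self, map_one]
  refine mem_good_of_pow_eq_one hR hP (mem_alternatingGroup_of_pow_eq_one hp h)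
    (square_mem_normalizer_sup fun v w => ?_) h
  ext
  · simp
  · simp
    ring

theorem transvection₂_mem_good (hR : ConjClosed p (alternatingGroup _) T R)
    (hP : planeGroup p L U ⊔ restGroup p L U ≤ T) (hp : Odd p) (t : ZMod p) :
    square (transvection₂ t) ∈ good hR _ hP := by
  have h : (square (transvection₂ t) : Perm (((ZMod p ⊕ L) × ZMod p) ⊕ U)) ^ p = 1 := by
    rw [← map_pow, transvection₂_pow_self, map_one]
  refine mem_good_of_pow_eq_one hR hP (mem_alternatingGroup_of_pow_eq_one hp h)
    (square_mem_normalizer_sup fun v w => ?_) h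
  ext
  · simp
    ring
  · simp

variable (L) in
/-- The permutation of the first `p` rows dividing their index by `a`. -/
def rowDiv (a : (ZMod p)ˣ) : Perm (ZMod p ⊕ L) := Perm.sumCongr (Units.mulLeft a⁻¹) 1

/-- On the plane this is the matrix diag(a⁻¹, a) of SL₂(p), in its usual factorization w(a) w(1)⁻¹
into transvections. -/
theorem rowPerm_mul_dilate_eq (a : (ZMod p)ˣ) :
    (rowPerm (rowDiv L a) * dilate (Sum.elim (fun _ => a) 1) :
      Perm (((ZMod p ⊕ L) × ZMod p) ⊕ U)) =
    square (transvection₁ a) * square (transvection₂ (-((a⁻¹ : (ZMod p)ˣ) : ZMod p))) *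
      square (transvection₁ a) * square (transvection₁ (-1)) * square (transvection₂ 1) *
        square (transvection₁ (-1)) := by
  simp only [← map_mul]
  ext1 (⟨b | l, x⟩ | u)
  · have ha : ((a⁻¹ : (ZMod p)ˣ) : ZMod p) * a = 1 := Units.inv_mul a
    simp only [Perm.mul_apply, dilate_inl, rowPerm_inl, square_inl_inl, transvection₁_apply,
      transvection₂_apply, rowDiv, Perm.sumCongr_apply, Sum.map_inl, Units.mulLeft_apply,
      Sum.elim_inl, Sum.inl.injEq, Prod.mk.injEq]
    constructor
    · linear_combination x * ha
    · linear_combination (a * x - b) * ha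
  · simp only [Perm.mul_apply, dilate_inl, rowPerm_inl, square_inl_inr, rowDiv,
      Perm.sumCongr_apply, Sum.map_inr, Sum.elim_inr, Pi.one_apply, Units.val_one, one_mul,
      Perm.one_apply]
  · rfl

variable [Subsingleton U]

/-- The transvections are p-elements normalizing `planeGroup ⊔ restGroup`, so their product is
related there. This group is self-centralizing, so the relation extends to its join with the even
shifts and restricts to the even shifts. -/
theorem rowPerm_mul_dilate_mem_good (hR : ConjClosed p (alternatingGroup _) T R) (hT : IsNice T)
    (hp : Odd p) (a : (ZMod p)ˣ) :
    rowPerm (rowDiv L a) * dilate (Sum.elim (fun _ => a) 1) ∈ good hR _ hT.shiftGroup_le := by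
  have hP := sup_le hT.planeGroup_le (restGroup_le_of_odd hT hp)
  have h1 : rowPerm (rowDiv L a) * dilate (Sum.elim (fun _ => a) 1) ∈ good hR _ hP := by
    rw [rowPerm_mul_dilate_eq]
    have h1 := transvection₁_mem_good hR hP hp
    have h2 := transvection₂_mem_good hR hP hp
    exact mul_mem (mul_mem (mul_mem (mul_mem (mul_mem (h1 _) (h2 _)) (h1 _)) (h1 _)) (h2 _)) (h1 _)
  have h2 := shiftGroup_normalizer_le (mul_mem (rowPerm_mem_normalizer (U := U) (rowDiv L a))
    (dilate_mem_normalizer (Sum.elim (fun _ => a) 1)))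
  obtain ⟨hA, hn, hr⟩ := h1
  set Q := (planeGroup p L U ⊔ restGroup p L U) ⊔
    (shiftGroup p (ZMod p ⊕ L) U ⊓ alternatingGroup _) with hQ
  have hQT : Q ≤ T := sup_le hP hT.shiftGroup_le
  refine ⟨hA, h2, hR.mono (hR.extend (inf_le_right.trans centralizer_sup_le) hr
    (le_sup_left : _ ≤ Q) hQT hA ?_) le_sup_right⟩
  rw [conj_smul_eq_self_iff.mpr (normalizer_inf_normalizer_le_normalizer_sup _ _ ⟨hn, h2⟩)]
  exact hQT

/-- The dilation v by a on the p rows of the plane has product a^p = a, so v⁻¹u has product 1. The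
factor v is supplied by the diagonal matrix, at the cost of the row permutation `rowDiv L a`; parity
makes the remaining row permutation even. -/
theorem related_of_odd (hR : ConjClosed p (alternatingGroup _) T R) (hT : IsNice T)
    (hp : Odd p) {f : ZMod p ⊕ L → ZMod p} {σ : Perm (ZMod p ⊕ L)} {u : ZMod p ⊕ L → (ZMod p)ˣ}
    (hg : shift f * rowPerm σ * dilate u ∈ alternatingGroup (((ZMod p ⊕ L) × ZMod p) ⊕ U)) :
    shift f * rowPerm σ * dilate u ∈ good hR _ hT.shiftGroup_le := by
  set a := ∏ i, u i with ha
  set v : ZMod p ⊕ L → (ZMod p)ˣ := Sum.elim (fun _ => a) 1 with hv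
  have hf := mem_good_shift hR hT
    (mem_alternatingGroup_of_pow_eq_one hp (shift_pow_self (U := U) f))
  have hsq := rowPerm_mul_dilate_mem_good hR hT hp a
  have hw : dilate (v⁻¹ * u) ∈ good hR _ hT.shiftGroup_le := by
    refine dilate_mem_good hR hT hp ?_
    simp only [Pi.mul_apply, Pi.inv_apply, Finset.prod_mul_distrib, Finset.prod_inv_distrib]
    rw [← ha, inv_mul_eq_one, Fintype.prod_sum_type]
    ext
    simp [hv, ZMod.card]
  have heq : (shift f * rowPerm σ * dilate u : Perm (((ZMod p ⊕ L) × ZMod p) ⊕ U)) =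
      shift f * rowPerm (σ * (rowDiv L a)⁻¹) * (rowPerm (rowDiv L a) * dilate v) *
        dilate (v⁻¹ * u) := by
    simp only [map_mul, map_inv]
    group
  rw [heq] at hg ⊢
  refine mul_mem (mul_mem (mul_mem hf (rowPerm_mem_good hR hT hp ?_)) hsq) hw
  rw [mul_mem_cancel_right hw.1, mul_mem_cancel_right hsq.1, mul_mem_cancel_left hf.1,
    Perm.mem_alternatingGroup, sign_rowPerm] at hg
  rw [Perm.mem_alternatingGroup]
  rcases Int.units_eq_one_or (Perm.sign (σ * (rowDiv L a)⁻¹)) with h | h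
  · exact h
  · rw [h, hp.neg_one_pow] at hg
    exact absurd hg (by decide)

/-- The relation is established on the even shifts and extends to T because these contain their
centralizer. -/
theorem related_of_conj_le (hR : ConjClosed p (alternatingGroup _) T R) (hT : IsNice T)
    (h3 : ∀ i j : ZMod p ⊕ L, ∃ l, l ≠ i ∧ l ≠ j) {g : Perm (((ZMod p ⊕ L) × ZMod p) ⊕ U)}
    (hgA : g ∈ alternatingGroup _) (hg : MulAut.conj g • T ≤ T) : R T g := by
  obtain ⟨f, σ, u, rfl⟩ := hT.exists_eq_of_conj_le h3 hg
  have h : shift f * rowPerm σ * dilate u ∈ good hR _ hT.shiftGroup_le := by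
    rcases (Fact.out : p.Prime).eq_two_or_odd' with h2 | hp
    · exact related_of_two hR hT h2 hgA
    · exact related_of_odd hR hT hp hgA
  exact hR.extend (centralizer_shiftGroup_le h3) h.2.2 hT.shiftGroup_le le_rfl hgA hg

end Torus

end WreathPerm

/-! ### Construction of the Sylow subgroup, and conclusion -/

namespace Subgroup

variable {G : Type*} [Group G] [Finite G] {p : ℕ} [Fact p.Prime]

theorem IsSylowIn.of_not_dvd_relIndex {X H A : Subgroup G} (h : IsSylowIn p X H) (hHA : H ≤ A)
    (hd : ¬ p ∣ H.relIndex A) : IsSylowIn p X A := by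
  have h1 : ¬ p ∣ (X.subgroupOf A).index := by
    have h2 : ¬ p ∣ X.relIndex H := by
      obtain ⟨T, rfl⟩ := h
      have h3 : ((T : Subgroup H).map H.subtype).subgroupOf H = T :=
        comap_map_eq_self_of_injective H.subtype_injective _
      rw [relIndex, h3]
      exact T.not_dvd_index
    have h4 : X.relIndex A = X.relIndex H * H.relIndex A :=
      (relIndex_mul_relIndex _ _ _ h.le hHA).symm
    rw [← relIndex, h4]
    exact Nat.Prime.not_dvd_mul Fact.out h2 hd
  exact ⟨IsPGroup.toSylow h.isPGroup.comap_subtype h1, map_subgroupOf_eq_of_le (h.le.trans hHA)⟩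

theorem IsSylowIn.le_of_normalizer {X H N : Subgroup G} (h : IsSylowIn p X H) (hNH : N ≤ H)
    (hN : IsPGroup p N) (hn : H ≤ normalizer (N : Set G)) : N ≤ X := by
  obtain ⟨k, hk, hkN⟩ := h.exists_conj_le hNH hN
  rwa [conj_smul_eq_self_iff.mpr (hn hk)] at hkN

/-- Both ways of computing the index of W ⊓ A are compared; the index of A in G cancels the one of W
⊓ A in W, which divides 2. So p = 2 needs no separate treatment. -/
theorem not_dvd_relIndex_of_index_eq_two {W A : Subgroup G} (hA : A.index = 2)
    (hW : ¬ p ∣ W.index) : ¬ p ∣ W.relIndex A := by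
  intro h
  have := normal_of_index_eq_two hA
  have h1 : W.relIndex A * A.index = A.relIndex W * W.index := by
    rw [← inf_relIndex_right, relIndex_mul_index inf_le_right, ← inf_relIndex_right A W,
      relIndex_mul_index inf_le_right, inf_comm]
  have h2 : A.relIndex W ∣ 2 := hA ▸ relIndex_dvd_index_of_normal A W
  have h3 : p * 2 ∣ W.index * 2 := by
    rw [mul_comm W.index]
    exact ((mul_dvd_mul_right h 2).trans (dvd_of_eq (hA ▸ h1))).trans (mul_dvd_mul_right h2 _)
  exact hW (Nat.dvd_of_mul_dvd_mul_right two_pos h3)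

end Subgroup

namespace WreathPerm

open Equiv Subgroup FusionSystem

section Index

variable {p : ℕ} [Fact p.Prime] {K U : Type*} [Fintype K] [DecidableEq K] [Fintype U]
  [DecidableEq U]

theorem card_wreath : Nat.card (wreath p K U) =
    p ^ Fintype.card K * (Fintype.card K).factorial := by
  have : Function.Bijective (fun x : (K → ZMod p) × Perm K =>
      (⟨shift x.1 * rowPerm x.2, shift_mul_rowPerm_mem _ _⟩ : wreath p K U)) := by
    constructor
    · rintro ⟨f, σ⟩ ⟨g, τ⟩ h
      have h1 : ∀ i, σ i = τ i ∧ f (σ i) = g (τ i) := by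
        intro i
        have := DFunLike.congr_fun (congrArg Subtype.val h) (Sum.inl (i, 0))
        simpa using this
      have h2 : σ = τ := Equiv.ext fun i => (h1 i).1
      subst h2
      have h3 : f = g := by
        funext i
        have := (h1 (σ.symm i)).2
        rwa [apply_symm_apply] at this
      rw [h3]
    · rintro ⟨_, f, σ, rfl⟩
      exact ⟨(f, σ), rfl⟩
  rw [← Nat.card_congr (Equiv.ofBijective _ this), Nat.card_prod, Nat.card_perm]
  simp

/-- For k rows and r < p further points, (pk + r)! and p^k k! have the same p-adic valuation. -/
theorem not_dvd_index_wreath (hU : Fintype.card U < p) : ¬ p ∣ (wreath p K U).index := by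
  have h1 := (wreath p K U).index_mul_card
  rw [card_wreath, Nat.card_perm, Nat.card_eq_fintype_card, Fintype.card_sum, Fintype.card_prod,
    ZMod.card, mul_comm _ p] at h1
  have h2 := congrArg (padicValNat p) h1
  have h3 : (wreath p K U).index ≠ 0 := index_ne_zero_of_finite
  rw [padicValNat_factorial_mul_add _ hU, padicValNat_factorial_mul, padicValNat.mul h3
    (mul_ne_zero (pow_ne_zero _ (NeZero.ne p)) (Nat.factorial_ne_zero _)),
    padicValNat.mul (pow_ne_zero _ (NeZero.ne p)) (Nat.factorial_ne_zero _),
    padicValNat.prime_pow] at h2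
  intro h
  have := one_le_padicValNat_of_dvd h3 h
  omega

theorem isPGroup_shiftGroup : IsPGroup p (shiftGroup p K U) := by
  rintro ⟨_, f, rfl⟩
  exact ⟨1, Subtype.ext (by simpa using shift_pow_self f)⟩

end Index

section Sylow

variable {p : ℕ} [Fact p.Prime] {L U : Type*} [Fintype L] [DecidableEq L] [Fintype U]
  [DecidableEq U]

theorem isPGroup_planeGroup : IsPGroup p (planeGroup p L U) := by
  rintro ⟨_, v, rfl⟩
  refine ⟨1, Subtype.ext ?_⟩
  rw [pow_one, coe_pow, coe_one, ← map_pow, translate_pow_self, map_one]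

/-- The plane group is a p-subgroup of W ⊓ A, so some Sylow subgroup of W ⊓ A contains it. The even
shifts form a normal p-subgroup of W ⊓ A and so lie in every Sylow subgroup. -/
theorem exists_isNice (hU : Fintype.card U < p) :
    ∃ T : Subgroup (Perm (((ZMod p ⊕ L) × ZMod p) ⊕ U)),
      IsSylowIn p T (alternatingGroup _) ∧ IsNice T := by
  set A := alternatingGroup (((ZMod p ⊕ L) × ZMod p) ⊕ U) with hA
  set W := wreath p (ZMod p ⊕ L) U with hW
  obtain ⟨T, hT, hPT⟩ := IsSylowIn.exists_le (p := p) (H := W ⊓ A)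
    (le_inf planeGroup_le_wreath planeGroup_le_alternatingGroup) isPGroup_planeGroup
  have hidx : A.index = 2 := by
    have : Nontrivial (((ZMod p ⊕ L) × ZMod p) ⊕ U) :=
      ⟨Sum.inl (Sum.inl 0, 0), Sum.inl (Sum.inl 0, 1), by simp⟩
    exact alternatingGroup.index_eq_two
  refine ⟨T, hT.of_not_dvd_relIndex inf_le_right ?_, hT.le.trans inf_le_right,
    hT.le.trans inf_le_left, ?_, hPT⟩
  · rw [inf_relIndex_right]
    exact not_dvd_relIndex_of_index_eq_two hidx (not_dvd_index_wreath hU)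
  · refine hT.le_of_normalizer (le_inf (inf_le_left.trans ?_) inf_le_right)
      (isPGroup_shiftGroup.to_le inf_le_left)
      ((inf_le_left.trans wreath_le_normalizer).trans shiftGroup_normalizer_le)
    rintro _ ⟨f, rfl⟩
    simpa using shift_mul_rowPerm_mem f (1 : Perm (ZMod p ⊕ L))

/-- The fusion system of an alternating group on a set decomposed into at least `p` rows of
length `p` and at most one further point is reduced. -/
theorem isReduced_of_equiv [Subsingleton U] {α : Type*} [Fintype α] [DecidableEq α]
    (e : α ≃ ((ZMod p ⊕ L) × ZMod p) ⊕ U) (h5 : 5 ≤ Nat.card α)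
    (h3 : 2 < Fintype.card (ZMod p ⊕ L)) (hL : p = 2 → Nonempty L)
    (S : Sylow p (alternatingGroup α)) : (ofSylow S).IsReduced := by
  have hU : Fintype.card U < p :=
    (Fintype.card_le_one_iff_subsingleton.mpr inferInstance).trans_lt (Fact.out : p.Prime).one_lt
  have h3' : ∀ i j : ZMod p ⊕ L, ∃ l, l ≠ i ∧ l ≠ j := by
    intro i j
    obtain ⟨l, -, hl⟩ := Finset.exists_mem_notMem_of_card_lt_card
      (s := {i, j}) (t := (Finset.univ : Finset (ZMod p ⊕ L)))
      (Finset.card_le_two.trans_lt h3)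
    simp only [Finset.mem_insert, Finset.mem_singleton, not_or] at hl
    exact ⟨l, hl⟩
  obtain ⟨T, ⟨T', rfl⟩, hT⟩ := exists_isNice (L := L) hU
  have hsurj : Function.Surjective e.altCongrHom.toMonoidHom := e.altCongrHom.surjective
  -- Sylow subgroups being conjugate, an arbitrary S can be carried exactly onto the chosen T'.
  obtain ⟨a, ha⟩ := MulAction.exists_smul_eq (alternatingGroup (((ZMod p ⊕ L) × ZMod p) ⊕ U))
    (S.mapSurjective hsurj) T'
  set E : alternatingGroup α ≃* alternatingGroup (((ZMod p ⊕ L) × ZMod p) ⊕ U) :=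
    e.altCongrHom.trans (MulAut.conj a) with hE
  have hS : (S : Subgroup _).map E.toMonoidHom = T' := by
    rw [← ha, Sylow.coe_subgroup_smul, Sylow.coe_mapSurjective]
    exact (map_map _ (MulAut.conj a).toMonoidHom e.altCongrHom.toMonoidHom).symm
  refine isReduced_of_embedding S (f := (alternatingGroup _).subtype.comp E.toMonoidHom)
    ((alternatingGroup _).subtype_injective.comp E.injective)
    (commutator_alternatingGroup_eq_top h5) (A := alternatingGroup _) ?_ ?_
    (fun P hPT hP => StableUnder.eq_bot hP hPT hT h3' hL)
    fun R hR g hgA hg => related_of_conj_le hR hT h3' hgA hg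
  · rw [MonoidHom.range_comp, MonoidHom.range_eq_top.mpr E.surjective, ← MonoidHom.range_eq_map,
      range_subtype]
  · rw [← map_map, hS]

end Sylow

end WreathPerm

theorem propositionF (p n : ℕ) (hp : p.Prime) (hn : p ^ 2 ≤ n)
    (hmod : n ≡ 0 [MOD p] ∨ n ≡ 1 [MOD p]) (h8 : p = 2 → 8 ≤ n)
    (S : Sylow p (alternatingGroup (Fin n))) :
    (FusionSystem.ofSylow S).IsReduced := by
  have := Fact.mk hp
  have hr : n % p ≤ 1 := by
    rcases hmod with h | h
    · rw [show n % p = 0 % p from h, Nat.zero_mod]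
      exact zero_le_one
    · rw [show n % p = 1 % p from h, Nat.mod_eq_of_lt hp.one_lt]
  have : Subsingleton (Fin (n % p)) := Fin.subsingleton_iff_le_one.mpr hr
  have hk : p ≤ n / p := by
    rw [Nat.le_div_iff_mul_le hp.pos, ← sq]
    exact hn
  have hk4 : p = 2 → 4 ≤ n / p := by
    rintro rfl
    have := h8 rfl
    omega
  have h3 : p ≠ 2 → 3 ≤ p := fun h => lt_of_le_of_ne hp.two_le (Ne.symm h)
  -- The bound p² ≤ n gives at least p rows, enough for a plane; the remaining n / p - p rows are
  -- indexed by L.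
  have e : Fin n ≃ ((ZMod p ⊕ Fin (n / p - p)) × ZMod p) ⊕ Fin (n % p) := by
    refine Fintype.equivOfCardEq ?_
    rw [Fintype.card_sum, Fintype.card_prod, Fintype.card_sum, ZMod.card, Fintype.card_fin,
      Fintype.card_fin, Fintype.card_fin, Nat.add_sub_cancel' hk, mul_comm, Nat.div_add_mod]
  refine WreathPerm.isReduced_of_equiv e ?_ ?_ ?_ S
  · rw [Nat.card_eq_fintype_card, Fintype.card_fin]
    by_cases h2 : p = 2
    · have := h8 h2
      omega
    · have := Nat.pow_le_pow_left (h3 h2) 2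
      omega
  · rw [Fintype.card_sum, ZMod.card, Fintype.card_fin, Nat.add_sub_cancel' hk]
    by_cases h2 : p = 2
    · have := hk4 h2
      omega
    · have := h3 h2
      omega
  · intro h2
    have := hk4 h2
    exact ⟨⟨0, by omega⟩⟩
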